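/- **X–I codes.** For $2m$ qubits grouped into $m\ge 1$ pairs $\{i,i'\}$, the X–I code $\Xi(2m)$ is the stabilizer code generated by $X_iX_{i'}X_jX_{j'}$ (two distinct pairs) and $Z_iZ_{i'}$. Its encoding map sends logical $l\in\{0,1\}$ to the uniform superposition of the computational basis states that are constant on each pair and in which the number of pairs in state $1$ has parity $l$. These two words form an orthonormal basis of the code space; every $X_iX_{i'}$ acts as logical $X$, and $\prod Z$ over one qubit of each pair acts as logical $Z$. **Vertex tensors.** In the regular hyperbolic honeycomb $\{5,3,4\}$ each vertex has six legs (edges), which form the octahedron $\{3,4\}$; the edges of this octahedron correspond to the pentagons and its triangles to the dodecahedra (cells) at the vertex. Consider the following vertex tensors. 1. *Octahedron $\{3,4\}$.* One qubit on each leg; one $\Xi(6)$, with antipodal legs paired. 2. *Truncated octahedron $t\{3,4\}$.* One qubit for each incident (leg, pentagon); six $\Xi(4)$, one on the four qubits of each pair of antipodal long edges (those inherited from the octahedron), antipodal qubits paired. Either the six codes have independent logical qubits or (GHZ version) they share one logical qubit, $l\mapsto\bar l^{\otimes 6}$. 3. *Cantellated octahedron $rr\{4,3\}$.* One qubit for each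 incident (leg, cell); four $\Xi(6)$, one on the six qubits of each pair of antipodal triangles, antipodal qubits paired. 4. *Omnitruncated octahedron $tr\{4,3\}$.* One qubit for each incident (leg, pentagon, cell); eight $\Xi(6)$, one on each hexagon, opposite vertices of the hexagon paired. **Network.** Put the vertex tensor at every vertex of $\{5,3,4\}$ and, on every edge, a Hadamard gate between each qubit of one end and its partner at the other end. The partner is the image of the qubit either under the reflection in the perpendicular bisector plane of the edge (mirror pairing) or under the point inversion in the midpoint of the edge (inversion pairing). "Isometry" means a positive multiple of an isometry. A vertex tensor is *angular $k$-uniform* if it is an isometry from any at most $k$ legs that belong to one common cell, together with the logical qubits, to the remaining legs. It is *multi-angular $k$-uniform* if the same holds for any set of legs of which at most $k$ belong to each cell. The *multi-tensor isometry condition* says: (a) for any two adjacent vertices, the two vertex tensors contracted over their common edge form an isometry from the logical qubits and two incoming legs, one at each vertex, both lying in one pentagon with the common edge, to all other open legs; (b) let $L_0$ be a single vertex or the vertex set of a single cell, and let $L_{n+1}$ be the set of vertices not in $L_0\cup\dots\cup L_n$ that share a cell with a vertex of $L_0\cup\dots\cup L_n$. Then every $L_n$ is finite, and the contraction of all tensors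 at vertices of $L_n$, with all edges inside $L_n$, is an isometry from the legs leading to earlier layers together with the logical qubits to all other open legs. **Theorem.** The vertex tensors 1, 2 (both versions) and 3 are angular $2$-, $1$- and $2$-uniform, respectively, and the networks built from them satisfy the multi-tensor isometry condition for the mirror pairing as well as for the inversion pairing. The vertex tensor 4 is multi-angular $1$-uniform, and the network built from it satisfies the multi-tensor isometry condition for the inversion pairing. -/

import Mathlib

open scoped ComplexConjugate

noncomputable section

/-! ### X–I codes -/

namespace XICode

variable {Q P : Type}

/-- The Pauli operator `∏_{i ∈ s} X_i` on `n`-qubit vectors, the qubits being indexed by `Q` and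
vectors being given by their amplitudes in the computational basis. -/
def pauliX (s : Set Q) (ψ : (Q → Bool) → ℂ) : (Q → Bool) → ℂ :=
  open Classical in fun a => ψ (fun i => if i ∈ s then !(a i) else a i)

/-- The Pauli operator `∏_{i ∈ s} Z_i`. -/
def pauliZ (s : Set Q) (ψ : (Q → Bool) → ℂ) : (Q → Bool) → ℂ :=
  fun a => (-1 : ℂ) ^ (Set.ncard {i | i ∈ s ∧ a i = true}) * ψ a

/-- The code space of the X–I code. The map `pair` sends a physical qubit to its (antipodal) pair.
The stabilizers are `X_i X_{i'} X_j X_{j'}` for two distinct pairs and `Z_i Z_{i'}` for each pair. -/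
def codeSpace (pair : Q → P) : Set ((Q → Bool) → ℂ) :=
  {ψ | (∀ p p' : P, p ≠ p' → pauliX {i | pair i = p ∨ pair i = p'} ψ = ψ) ∧
    ∀ p : P, pauliZ {i | pair i = p} ψ = ψ}

/-- The logical basis states of the X–I code: the uniform superposition of all basis states that
are constant on every pair and in which the number of pairs in state `1` is even (for logical `0`)
or odd (for logical `1`). -/
def word (pair : Q → P) (l : Bool) (a : Q → Bool) : ℂ :=
  open Classical in
  if (∀ i j, pair i = pair j → a i = a j) ∧
      (Odd (Set.ncard {p : P | ∃ i, pair i = p ∧ a i = true}) ↔ l = true) then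
    ((Real.sqrt (2 ^ (Nat.card P - 1)) : ℝ) : ℂ)⁻¹
  else 0

/-- `word` is an orthonormal basis of the code space, on which `X_i X_{i'}` acts as logical `X` and
`∏ Z`, over one qubit of each pair, acts as logical `Z`. -/
def IsEncoding (pair : Q → P) : Prop :=
  (∀ ψ, ψ ∈ codeSpace pair ↔ ∃ α β : ℂ, ψ = α • word pair false + β • word pair true) ∧
  (∀ l l' : Bool, ∑ᶠ a : Q → Bool, conj (word pair l a) * word pair l' a =
    if l = l' then 1 else 0) ∧
  (∀ (p : P) (l : Bool), pauliX {i | pair i = p} (word pair l) = word pair (!l)) ∧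
  (∀ (T : Set Q) (l : Bool), (∀ p : P, ∃! i, i ∈ T ∧ pair i = p) →
    pauliZ T (word pair l) = (if l then (-1 : ℂ) else 1) • word pair l)

end XICode

/-! ### The honeycomb `{5,3,4}`

The flags (vertex, edge, pentagon, dodecahedron) of the regular honeycomb `{5,3,4}` are the elements
of its symmetry group, the Coxeter group `[5,3,4]`; `g * r i` is the flag that differs from the flag
`g` exactly in its element of dimension `i`. Partial flags are the cosets of standard parabolic
subgroups: the generators `r i` with `i` not among the listed dimensions do not change the partial
flag. The symmetry group acts by left multiplication. -/

namespace Honeycomb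

/-- The Coxeter matrix of the Schläfli symbol `{5,3,4}`. -/
def schlaefli : CoxeterMatrix (Fin 4) where
  M := !![1, 5, 2, 2; 5, 1, 3, 2; 2, 3, 1, 4; 2, 2, 4, 1]
  isSymm := by ext i j; fin_cases i <;> fin_cases j <;> rfl
  diagonal := by decide
  off_diagonal := by intro i j h; fin_cases i <;> fin_cases j <;> simp_all

abbrev Flag : Type := schlaefli.Group

/-- The flag adjacency of dimension `i`. -/
def r (i : Fin 4) : Flag := schlaefli.simple i

abbrev vertexStab : Subgroup Flag := Subgroup.closure {r 1, r 2, r 3}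
abbrev legStab : Subgroup Flag := Subgroup.closure {r 2, r 3}
abbrev cellStab : Subgroup Flag := Subgroup.closure {r 0, r 1, r 2}

abbrev Vertex : Type := Flag ⧸ vertexStab

/-- A leg is an edge of the honeycomb together with one of its two end vertices, i.e. one of the
six vertices of the octahedral vertex figure `{3,4}` of that vertex. -/
abbrev Leg : Type := Flag ⧸ legStab

abbrev Cell : Type := Flag ⧸ cellStab

def vertexOf (g : Flag) : Vertex := QuotientGroup.mk g
def legOf (g : Flag) : Leg := QuotientGroup.mk g
def cellOf (g : Flag) : Cell := QuotientGroup.mk g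

/-- The central inversion of the octahedron at a vertex. -/
def antipode : Flag := (r 1 * r 2 * r 3) ^ 3

/-- The half-turn of a hexagonal face of the omnitruncated octahedron onto the opposite vertices:
a hexagon consists of the six flags `g, g * r 1, g * r 1 * r 2, …`. -/
def hexAntipode : Flag := r 1 * r 2 * r 1

theorem r_mem {s : Set Flag} {i : Fin 4} (h : r i ∈ s) : r i ∈ Subgroup.closure s :=
  Subgroup.subset_closure h

theorem antipode_mem : antipode ∈ vertexStab :=
  pow_mem (mul_mem (mul_mem (r_mem (by simp)) (r_mem (by simp))) (r_mem (by simp))) 3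

/-- How the qubits of the two legs of one edge are matched, see `Pairing.twist`. -/
inductive Pairing
  | mirror
  | inversion

/-- The flag `g` of the vertex `v` is matched with the flag `g * twist` of the neighbouring vertex:
with its image under the reflection in the perpendicular bisector plane of the edge, or with its
image under the point inversion in the midpoint of the edge. -/
def Pairing.twist : Pairing → Flag
  | .mirror => r 0
  | .inversion => r 0 * (r 2 * r 3) ^ 2

/-! ### Vertex tensors from X–I codes -/

/-- A vertex tensor built from X–I codes. Physical qubits, antipodal pairs of qubits, X–I codes
and logical qubits are the cosets of the four subgroups, and incidence is inclusion of cosets. -/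
structure Construction where
  qubit : Subgroup Flag
  pair : Subgroup Flag
  block : Subgroup Flag
  logical : Subgroup Flag
  qubit_le_leg : qubit ≤ legStab
  qubit_le_pair : qubit ≤ pair
  pair_le_block : pair ≤ block
  block_le_logical : block ≤ logical
  logical_le_vertex : logical ≤ vertexStab

/-- One X–I code on the six vertices of the octahedron `{3,4}`. -/
def octahedron : Construction where
  qubit := Subgroup.closure {r 2, r 3}
  pair := Subgroup.closure {r 2, r 3, antipode}
  block := vertexStab
  logical := vertexStab
  qubit_le_leg := le_rfl
  qubit_le_pair := Subgroup.closure_mono (by intro x; simp; tauto)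
  pair_le_block := by
    rw [Subgroup.closure_le]
    rintro x (rfl | rfl | rfl)
    exacts [r_mem (by simp), r_mem (by simp), antipode_mem]
  block_le_logical := le_rfl
  logical_le_vertex := le_rfl

theorem truncated_block_le : Subgroup.closure {r 1, r 3, antipode} ≤ vertexStab := by
  rw [Subgroup.closure_le]
  rintro x (rfl | rfl | rfl)
  exacts [r_mem (by simp), r_mem (by simp), antipode_mem]

/-- The truncated octahedron `t{3,4}`: its 24 vertices are the (vertex, edge, pentagon)-flags; the
four vertices on a pair of antipodal long edges (edges inherited from the octahedron) carry one
X–I code. Every code has its own logical qubit. -/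
def truncated : Construction where
  qubit := Subgroup.closure {r 3}
  pair := Subgroup.closure {r 3, antipode}
  block := Subgroup.closure {r 1, r 3, antipode}
  logical := Subgroup.closure {r 1, r 3, antipode}
  qubit_le_leg := Subgroup.closure_mono (by intro x; simp; tauto)
  qubit_le_pair := Subgroup.closure_mono (by intro x; simp; tauto)
  pair_le_block := Subgroup.closure_mono (by intro x; simp; tauto)
  block_le_logical := le_rfl
  logical_le_vertex := truncated_block_le

/-- The GHZ version on `t{3,4}`: the six codes share one logical qubit, logical `l` being encoded
as the product of the six code words `l`. -/
def truncatedGHZ : Construction where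
  qubit := Subgroup.closure {r 3}
  pair := Subgroup.closure {r 3, antipode}
  block := Subgroup.closure {r 1, r 3, antipode}
  logical := vertexStab
  qubit_le_leg := Subgroup.closure_mono (by intro x; simp; tauto)
  qubit_le_pair := Subgroup.closure_mono (by intro x; simp; tauto)
  pair_le_block := Subgroup.closure_mono (by intro x; simp; tauto)
  block_le_logical := truncated_block_le
  logical_le_vertex := le_rfl

/-- The cantellated octahedron `rr{4,3}`: its 24 vertices are the (vertex, edge, cell)-flags; the
six vertices of a pair of antipodal triangular faces carry one X–I code. -/
def cantellated : Construction where
  qubit := Subgroup.closure {r 2}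
  pair := Subgroup.closure {r 2, antipode}
  block := Subgroup.closure {r 1, r 2, antipode}
  logical := Subgroup.closure {r 1, r 2, antipode}
  qubit_le_leg := Subgroup.closure_mono (by intro x; simp; tauto)
  qubit_le_pair := Subgroup.closure_mono (by intro x; simp; tauto)
  pair_le_block := Subgroup.closure_mono (by intro x; simp; tauto)
  block_le_logical := le_rfl
  logical_le_vertex := by
    rw [Subgroup.closure_le]
    rintro x (rfl | rfl | rfl)
    exacts [r_mem (by simp), r_mem (by simp), antipode_mem]

/-- The omnitruncated octahedron `tr{4,3}`: its 48 vertices are the flags; the six vertices of each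
hexagonal face carry one X–I code. -/
def omnitruncated : Construction where
  qubit := ⊥
  pair := Subgroup.closure {hexAntipode}
  block := Subgroup.closure {r 1, r 2}
  logical := Subgroup.closure {r 1, r 2}
  qubit_le_leg := bot_le
  qubit_le_pair := bot_le
  pair_le_block := by
    rw [Subgroup.closure_le]
    rintro x rfl
    exact mul_mem (mul_mem (r_mem (by simp)) (r_mem (by simp))) (r_mem (by simp))
  block_le_logical := le_rfl
  logical_le_vertex := Subgroup.closure_mono (by intro x; simp; tauto)

namespace Construction

variable (C : Construction)

abbrev Qubit : Type := Flag ⧸ C.qubit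
abbrev Pair : Type := Flag ⧸ C.pair
abbrev Block : Type := Flag ⧸ C.block
abbrev Logical : Type := Flag ⧸ C.logical

def qubitLeg : C.Qubit → Leg := Subgroup.quotientMapOfLE C.qubit_le_leg
def qubitPair : C.Qubit → C.Pair := Subgroup.quotientMapOfLE C.qubit_le_pair
def pairBlock : C.Pair → C.Block := Subgroup.quotientMapOfLE C.pair_le_block
def blockLogical : C.Block → C.Logical := Subgroup.quotientMapOfLE C.block_le_logical
def logicalVertex : C.Logical → Vertex := Subgroup.quotientMapOfLE C.logical_le_vertex
def blockVertex (b : C.Block) : Vertex := C.logicalVertex (C.blockLogical b)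
def qubitVertex (q : C.Qubit) : Vertex := C.blockVertex (C.pairBlock (C.qubitPair q))

/-- The qubit `q` is matched with the qubit `q'` of the neighbouring vertex. -/
def Bonded (e : Pairing) (q q' : C.Qubit) : Prop :=
  ∃ g : Flag, q = QuotientGroup.mk g ∧ q' = QuotientGroup.mk (g * e.twist)

/-- Each vertex carries `N` copies of `Ξ(2m)`, and every edge matches the qubits of its two legs
one to one. -/
def HasShape (N m : ℕ) : Prop :=
  (∀ v : Vertex, {b : C.Block | C.blockVertex b = v}.ncard = N) ∧
  (∀ b : C.Block, {p : C.Pair | C.pairBlock p = b}.ncard = m) ∧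
  (∀ p : C.Pair, {q : C.Qubit | C.qubitPair q = p}.ncard = 2) ∧
  (∀ e : Pairing, ∀ q : C.Qubit, ∃! q' : C.Qubit, C.Bonded e q q') ∧
  (∀ e : Pairing, ∀ q q' : C.Qubit, C.Bonded e q q' →
    C.Bonded e q' q ∧ C.qubitVertex q ≠ C.qubitVertex q')

/-- The amplitude of one X–I code of a vertex tensor, for physical indices `a` and logical
index `l`. -/
def blockTensor (b : C.Block) (a : C.Qubit → Bool) (l : Bool) : ℂ :=
  XICode.word
    (fun q : {q : C.Qubit // C.pairBlock (C.qubitPair q) = b} =>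
      (⟨C.qubitPair q.1, q.2⟩ : {p : C.Pair // C.pairBlock p = b}))
    l (fun q => a q.1)

/-- The vertex tensor at `v`; it depends only on the values of `a` and `l` on the physical and
logical qubits of `v`. -/
def vertexTensor (v : Vertex) (a : C.Qubit → Bool) (l : C.Logical → Bool) : ℂ :=
  ∏ᶠ b : {b : C.Block // C.blockVertex b = v}, C.blockTensor b.1 a (l (C.blockLogical b.1))

/-- The Hadamard gate. -/
def hadamard (x y : Bool) : ℂ := (if x && y then (-1 : ℂ) else 1) / ((Real.sqrt 2 : ℝ) : ℂ)

theorem hadamard_comm (x y : Bool) : hadamard x y = hadamard y x := by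
  simp [hadamard, Bool.and_comm]

/-- The matched pairs of qubits both of whose vertices lie in `S`. -/
def bonds (e : Pairing) (S : Set Vertex) : Set (Sym2 C.Qubit) :=
  {s | (∃ q q', C.Bonded e q q' ∧ s = s(q, q')) ∧ ∀ q ∈ s, C.qubitVertex q ∈ S}

/-- The physical qubits of `S` that are contracted within `S`. -/
def internal (e : Pairing) (S : Set Vertex) : Set C.Qubit :=
  {q | C.qubitVertex q ∈ S ∧ ∃ q', C.Bonded e q q' ∧ C.qubitVertex q' ∈ S}

/-- The physical qubits of `S` that stay open. -/
def external (e : Pairing) (S : Set Vertex) : Set C.Qubit :=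
  {q | C.qubitVertex q ∈ S} \ C.internal e S

/-- The part of the tensor network on the vertices in `S`: vertex tensors at the vertices, Hadamard
gates on all matched pairs of qubits between vertices of `S`, and summation over all indices of
internal qubits. It depends only on the values of `a` on the external qubits of `S` and of `l` on
the logical qubits of `S`. Hadamard gates on the open legs are left out: they are unitary. -/
def network (e : Pairing) (S : Set Vertex) (a : C.Qubit → Bool) (l : C.Logical → Bool) : ℂ :=
  ∑ᶠ i : C.internal e S → Bool,
    (∏ᶠ v ∈ S, C.vertexTensor v (Function.extend Subtype.val i a) l) *
      ∏ᶠ s ∈ C.bonds e S, Sym2.lift ⟨hadamard, hadamard_comm⟩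
        (s.map (Function.extend Subtype.val i a))

/-- `T`, read as a linear map from the qubits in `I` and the logical qubits in `L` to the qubits
in `O`, is a positive multiple of an isometry. -/
def IsIsometry (T : (C.Qubit → Bool) → (C.Logical → Bool) → ℂ) (L : Set C.Logical)
    (I O : Set C.Qubit) : Prop :=
  open Classical in
  ∃ c : ℝ, 0 < c ∧ ∀ (a a' : C.Qubit → Bool) (l l' : C.Logical → Bool),
    ∑ᶠ o : O → Bool, conj (T (Function.extend Subtype.val o a) l) *
        T (Function.extend Subtype.val o a') l' =
      if (∀ q ∈ I, a q = a' q) ∧ (∀ x ∈ L, l x = l' x) then (c : ℂ) else 0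

/-- The vertex tensor at `v` is an isometry from the legs in `K` and the logical qubits of `v` to
the other legs of `v`. -/
def VertexIsometry (v : Vertex) (K : Finset Leg) : Prop :=
  C.IsIsometry (C.vertexTensor v) {x | C.logicalVertex x = v}
    {q | C.qubitVertex q = v ∧ C.qubitLeg q ∈ K} {q | C.qubitVertex q = v ∧ C.qubitLeg q ∉ K}

/-- Angular `k`-uniformity: isometry for any at most `k` incoming legs in one angular area, i.e.
legs at `v` that are edges of a common cell. -/
def AngularUniform (k : ℕ) : Prop :=
  ∀ (v : Vertex) (c : Cell) (K : Finset Leg), K.card ≤ k →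
    (∀ x ∈ K, ∃ g : Flag, legOf g = x ∧ vertexOf g = v ∧ cellOf g = c) → C.VertexIsometry v K

/-- Multi-angular `k`-uniformity: isometry for any set of incoming legs with at most `k` legs in
each angular area. -/
def MultiAngularUniform (k : ℕ) : Prop :=
  ∀ (v : Vertex) (K : Finset Leg), (∀ x ∈ K, ∃ g : Flag, legOf g = x ∧ vertexOf g = v) →
    (∀ c : Cell, {x | x ∈ K ∧ ∃ g : Flag, legOf g = x ∧ cellOf g = c}.ncard ≤ k) →
    C.VertexIsometry v K

/-- The network on `S` is an isometry from the open legs in `I` and all logical qubits of `S` to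
the other open legs. -/
def ClusterIsometry (e : Pairing) (S : Set Vertex) (I : Set Leg) : Prop :=
  C.IsIsometry (C.network e S) {x | C.logicalVertex x ∈ S}
    {q | q ∈ C.external e S ∧ C.qubitLeg q ∈ I} {q | q ∈ C.external e S ∧ C.qubitLeg q ∉ I}

end Construction

/-! ### Layers -/

/-- The union of the first layers around `seed`: one step adds all vertices of all cells that
contain a vertex of the previous set. -/
def ball (seed : Set Vertex) : ℕ → Set Vertex
  | 0 => seed
  | n + 1 => {w | ∃ g h : Flag, vertexOf g ∈ ball seed n ∧ cellOf g = cellOf h ∧ vertexOf h = w}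

/-- The vertices of the layers before layer `n`. -/
def inner (seed : Set Vertex) : ℕ → Set Vertex
  | 0 => ∅
  | n + 1 => ball seed n

def layer (seed : Set Vertex) (n : ℕ) : Set Vertex := ball seed n \ inner seed n

/-- The legs that lead to a vertex of an earlier layer. -/
def incoming (seed : Set Vertex) (n : ℕ) : Set Leg :=
  {x | ∃ g : Flag, legOf g = x ∧ vertexOf (g * r 0) ∈ inner seed n}

def cellVertices (c : Cell) : Set Vertex := {v | ∃ g : Flag, vertexOf g = v ∧ cellOf g = c}

namespace Construction

variable (C : Construction)

/-- Every layer is finite, and the network on it is an isometry from its incoming legs and its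
logical qubits to its outgoing legs. -/
def LayerIsometry (e : Pairing) (seed : Set Vertex) : Prop :=
  ∀ n : ℕ, (layer seed n).Finite ∧ C.ClusterIsometry e (layer seed n) (incoming seed n)

/-- The multi-tensor isometry condition. First, for two vertices joined by an edge, the two vertex
tensors and the edge tensor between them form an isometry with one incoming leg at each of the two
vertices, the two incoming legs lying in a common pentagon with the edge. Second, each of the
concentric layers around any vertex and around any cell is an isometry from the incoming legs and
the logical qubits to the outgoing legs. -/
def MultiTensorIsometry (e : Pairing) : Prop :=
  (∀ g : Flag, C.ClusterIsometry e {vertexOf g, vertexOf (g * r 0)}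
    {legOf (g * r 1), legOf (g * r 0 * r 1)}) ∧
  (∀ v : Vertex, C.LayerIsometry e {v}) ∧
  (∀ c : Cell, C.LayerIsometry e (cellVertices c))

end Construction

end Honeycomb

end

noncomputable section

namespace Honeycomb

/-! ### A criterion for isometry -/

/-! Linear algebra over the field with two elements. Up to a positive constant a code word is the
indicator of an affine space (constancy on pairs, one parity equation per block), and a Hadamard
gate on a bond contributes the sign of a product of two bits. A contracted network is thus a sum of
signs over words, and an entry of its Gram matrix is a double sum over words `x` and `x + D` with
equal outgoing bits. For fixed `D` the sum over `x` is a character sum: an X stabilizer that flips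
two pairs of one block without incoming qubits permutes the words and multiplies every summand by
the same sign, the difference of the two values of `pairSum`. Hence `isIsometry_network`: the
network is an isometry if no pair carries two incoming qubits, every block has a pair carrying none,
and a homogeneous linear system for `D` has only the zero solution. The system says that `D` is
constant on pairs, vanishes on outgoing qubits, and has the same sum over the partners of any two
pairs of one block that are free of incoming qubits. `clusterIsometry_of` restates this for
functions on flags.

Word problem. The dodecahedra of `{5,3,4}` have right dihedral angles, so every flag is a product of
reflections in the twelve walls of a base cell, two of which commute when their faces are adjacent,
followed by one of the 120 symmetries of that cell. A product of reflections has a Cartier–Foata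
normal form, a stack of cliques of adjacent faces, and `push` is multiplication by one reflection.
Since `push` is an involution and commutes for adjacent faces, the Coxeter group acts on pairs
(stack, flag of the dodecahedron); this action is faithful, so by `wd_eq_iff` equality of words is
decided by evaluation. All finite incidence facts at a vertex are obtained in this way.

Layers. The length of the stack is the level of a cell, counted from a cell, or from a vertex if the
three walls at that vertex are made to fix the empty stack. Cells with a common vertex differ in
level by at most one. If the last clique of a cell is contained in the three faces at a vertex, it
can be removed by moving around that vertex; otherwise no cell at the vertex has lower level. So the
balls are described by levels (`IsBall`), and `Layer` collects the consequences. Call a face near if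
its wall can be crossed without raising the level, and far otherwise. A leg that passes through a
far face leads outwards, and each vertex of a layer has at most one incoming leg (`enters_unique`).

Vanishing of `D`. If antipodal qubits are paired, `D` vanishes on a leg whose antipode leaves. For
the remaining legs the block equation is used at the other end of the leg: once the antipode there
and the two perpendicular axes are under control, one term is left. Membership in the last clique
decides near from far; when the third face and a neighbouring candidate both pass below the last
clique, `adj_of_deep` shows that they would be adjacent, which they are not
(`Layer.zeroAt_of_cell`). For the hexagons of the omnitruncated octahedron the block equation at the
inverted flag is used in the same way, with a case distinction according to which of the three faces
at the vertex are near (`HexSolution.eq_zero_of_cell`); the inversion moves the matched qubit away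
from the pentagon in which its mirror image would meet the same obstruction. Around two adjacent
vertices the antipodal case needs no block equation at all. -/

/-- A bit as an element of the field with two elements. -/
def bit (x : Bool) : ZMod 2 := if x then 1 else 0

theorem bit_xor (x y : Bool) : bit (xor x y) = bit x + bit y := by
  cases x <;> cases y <;> decide

theorem bit_injective : Function.Injective bit := by
  intro x y; cases x <;> cases y <;> decide

/-- The character of the field with two elements. -/
def sgn (z : ZMod 2) : ℂ := if z = 0 then 1 else -1

theorem sgn_zero : sgn 0 = 1 := by simp [sgn]

theorem zmod_two_cases (z : ZMod 2) : z = 0 ∨ z = 1 := by revert z; decide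

theorem sgn_add (y z : ZMod 2) : sgn (y + z) = sgn y * sgn z := by
  have h : (1 : ZMod 2) + 1 = 0 := by decide
  rcases zmod_two_cases y with rfl | rfl <;> rcases zmod_two_cases z with rfl | rfl <;>
    simp [sgn, h]

theorem conj_sgn (z : ZMod 2) : conj (sgn z) = sgn z := by
  unfold sgn; split_ifs <;> simp

theorem sgn_sum {ι : Type*} (s : Finset ι) (f : ι → ZMod 2) :
    sgn (∑ i ∈ s, f i) = ∏ i ∈ s, sgn (f i) := by
  classical
  induction s using Finset.induction_on with
  | empty => simp [sgn_zero]
  | insert a s ha ih => rw [Finset.sum_insert ha, Finset.prod_insert ha, sgn_add, ih]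

theorem odd_ncard_iff {α : Type*} [Fintype α] (f : α → Bool) :
    Odd ({x | f x = true}.ncard) ↔ ∑ x, bit (f x) = 1 := by
  classical
  have h1 : {x | f x = true}.ncard = (Finset.univ.filter fun x => f x = true).card := by
    rw [← Set.ncard_coe_finset]; simp
  have h2 : ∑ x, bit (f x) = ((Finset.univ.filter fun x => f x = true).card : ZMod 2) := by
    simp [bit]
  rw [h1, h2, ZMod.natCast_eq_one_iff_odd]

namespace Construction

theorem hadamard_eq (x y : Bool) :
    hadamard x y = sgn (bit x * bit y) * ((Real.sqrt 2 : ℝ) : ℂ)⁻¹ := by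
  cases x <;> cases y <;> simp [hadamard, sgn, bit, div_eq_mul_inv]

theorem finprod_mem_ite {ι : Type*} {s : Set ι} (hs : s.Finite) (c : ι → Prop) (k : ι → ℝ)
    [∀ i, Decidable (c i)] [Decidable (∀ i ∈ s, c i)] :
    ∏ᶠ i ∈ s, (if c i then (k i : ℂ) else 0) =
      if ∀ i ∈ s, c i then ((∏ᶠ i ∈ s, k i : ℝ) : ℂ) else 0 := by
  classical
  rw [finprod_mem_eq_finite_toFinset_prod _ hs, finprod_mem_eq_finite_toFinset_prod _ hs,
    Finset.prod_ite_zero]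
  simp

variable (C : Construction)

/-- A qubit of each pair. -/
def rep (p : C.Pair) : C.Qubit := QuotientGroup.mk p.out

theorem qubitPair_rep (p : C.Pair) : C.qubitPair (C.rep p) = p := by
  rw [rep, qubitPair, Subgroup.quotientMapOfLE_apply_mk]
  exact Quotient.out_eq' p

theorem blockLogical_surjective : Function.Surjective C.blockLogical := by
  intro x
  refine ⟨QuotientGroup.mk x.out, ?_⟩
  rw [blockLogical, Subgroup.quotientMapOfLE_apply_mk]
  exact Quotient.out_eq' x

/-- The parity of the pairs of a block. -/
def par (b : C.Block) (x : C.Qubit → Bool) : ZMod 2 :=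
  ∑ᶠ p ∈ {p | C.pairBlock p = b}, bit (x (C.rep p))

/-- The assignment `x` occurs in the code words with logical indices `l`. -/
def IsWord (S : Set Vertex) (x : C.Qubit → Bool) (l : C.Logical → Bool) : Prop :=
  ∀ b, C.blockVertex b ∈ S →
    (∀ q q', C.pairBlock (C.qubitPair q) = b → C.qubitPair q = C.qubitPair q' → x q = x q') ∧
      C.par b x = bit (l (C.blockLogical b))

variable {C} {N m : ℕ}

theorem HasShape.finite_block (hC : C.HasShape N m) (hN : 0 < N) (v : Vertex) : {b : C.Block | C.blockVertex b = v}.Finite :=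
  Set.finite_of_ncard_pos (by rw [hC.1]; exact hN)

theorem HasShape.finite_pair (hC : C.HasShape N m) (hm : 0 < m) (b : C.Block) : {p : C.Pair | C.pairBlock p = b}.Finite :=
  Set.finite_of_ncard_pos (by rw [hC.2.1]; exact hm)

theorem HasShape.finite_qubit (hC : C.HasShape N m) (p : C.Pair) : {q : C.Qubit | C.qubitPair q = p}.Finite :=
  Set.finite_of_ncard_pos (by rw [hC.2.2.1]; exact two_pos)

theorem HasShape.finite_qubits (hC : C.HasShape N m) (hN : 0 < N) (hm : 0 < m) {S : Set Vertex} (hS : S.Finite) :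
    {q : C.Qubit | C.qubitVertex q ∈ S}.Finite := by
  have h1 : {b : C.Block | C.blockVertex b ∈ S}.Finite :=
    (hS.biUnion fun v _ => hC.finite_block hN v).subset fun b hb => by
      simpa using hb
  have h2 : {p : C.Pair | C.blockVertex (C.pairBlock p) ∈ S}.Finite :=
    (h1.biUnion fun b _ => hC.finite_pair hm b).subset fun p hp => by
      simpa using hp
  exact (h2.biUnion fun p _ => hC.finite_qubit p).subset fun q hq => by
    simpa [qubitVertex] using hq

-- The code word becomes the indicator of an affine subspace: constancy on pairs and one parity
-- equation, with a common amplitude. Everything later only uses this linear description.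
open Classical in
theorem blockTensor_eq (hC : C.HasShape N m) (hm : 0 < m) (b : C.Block) (a : C.Qubit → Bool) (l : Bool) :
    C.blockTensor b a l =
      if (∀ q q', C.pairBlock (C.qubitPair q) = b → C.qubitPair q = C.qubitPair q' → a q = a q') ∧
        C.par b a = bit l
      then (((Real.sqrt (2 ^ (m - 1)))⁻¹ : ℝ) : ℂ) else 0 := by
  have hcard : Nat.card {p : C.Pair // C.pairBlock p = b} = m := hC.2.1 b
  have : Finite {p : C.Pair // C.pairBlock p = b} := (hC.finite_pair hm b).to_subtype
  let _ := Fintype.ofFinite {p : C.Pair // C.pairBlock p = b}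
  rw [blockTensor, XICode.word, hcard, Complex.ofReal_inv]
  refine if_congr ?_ rfl rfl
  have hconst : (∀ i j : {q : C.Qubit // C.pairBlock (C.qubitPair q) = b},
      (⟨C.qubitPair i.1, i.2⟩ : {p : C.Pair // C.pairBlock p = b}) = ⟨C.qubitPair j.1, j.2⟩ →
        a i = a j) ↔
      ∀ q q', C.pairBlock (C.qubitPair q) = b → C.qubitPair q = C.qubitPair q' → a q = a q' := by
    constructor
    · intro h q q' hq hqq
      exact h ⟨q, hq⟩ ⟨q', hqq ▸ hq⟩ (Subtype.ext hqq)
    · intro h i j hij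
      exact h i j i.2 (congrArg Subtype.val hij)
  rw [hconst]
  refine and_congr_right fun h => ?_
  have hset : {p : {p : C.Pair // C.pairBlock p = b} |
      ∃ i : {q : C.Qubit // C.pairBlock (C.qubitPair q) = b},
        (⟨C.qubitPair i.1, i.2⟩ : {p : C.Pair // C.pairBlock p = b}) = p ∧ a i = true} =
      {p | a (C.rep p.1) = true} := by
    ext p
    constructor
    · rintro ⟨i, rfl, hi⟩
      have := h i.1 (C.rep (C.qubitPair i.1)) i.2 (C.qubitPair_rep _).symm
      exact this.symm.trans hi
    · intro hp
      exact ⟨⟨C.rep p.1, by rw [C.qubitPair_rep]; exact p.2⟩,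
        Subtype.ext (C.qubitPair_rep _), hp⟩
  rw [hset, odd_ncard_iff]
  have hpar : C.par b a = ∑ p : {p : C.Pair // C.pairBlock p = b}, bit (a (C.rep p.1)) := by
    rw [par, ← finsum_eq_sum_of_fintype]
    exact (finsum_set_coe_eq_finsum_mem (f := fun p => bit (a (C.rep p)))
      {p | C.pairBlock p = b}).symm
  rw [hpar]
  generalize ∑ p : {p : C.Pair // C.pairBlock p = b}, bit (a (C.rep p.1)) = z
  revert z l
  decide

end Construction

end Honeycomb

/-! ### The X–I code -/

namespace XICode

open Honeycomb (bit)

variable {Q P : Type} {pair : Q → P}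

/-- The parity of an assignment of bits to the pairs. -/
def parity [Fintype P] (b : P → Bool) : ZMod 2 := ∑ p, bit (b p)

theorem exists_comp_eq (hp : Function.Surjective pair) {a : Q → Bool}
    (ha : ∀ i j, pair i = pair j → a i = a j) : ∃ b : P → Bool, a = b ∘ pair := by
  refine ⟨fun p => a (hp p).choose, funext fun i => ?_⟩
  exact ha _ _ (hp (pair i)).choose_spec.symm

theorem word_comp [Fintype P] (hp : Function.Surjective pair) (l : Bool) (b : P → Bool) :
    word pair l (b ∘ pair) =
      if parity b = bit l then ((Real.sqrt (2 ^ (Nat.card P - 1)) : ℝ) : ℂ)⁻¹ else 0 := by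
  classical
  rw [word]
  refine if_congr ?_ rfl rfl
  have h1 : {p : P | ∃ i, pair i = p ∧ (b ∘ pair) i = true} = {p | b p = true} := by
    ext p
    constructor
    · rintro ⟨i, rfl, h⟩; exact h
    · intro h
      obtain ⟨i, rfl⟩ := hp p
      exact ⟨i, rfl, h⟩
  rw [h1, Honeycomb.odd_ncard_iff, ← parity]
  have h2 : ∀ i j, pair i = pair j → (b ∘ pair) i = (b ∘ pair) j := fun i j h => by simp [h]
  rw [and_iff_right h2]
  generalize parity b = z
  revert z l
  decide

theorem word_eq_zero (l : Bool) {a : Q → Bool} (ha : ¬ ∀ i j, pair i = pair j → a i = a j) :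
    word pair l a = 0 := by
  rw [word, if_neg]
  exact fun h => ha h.1

/-- Flip the bits of the pairs in `A`. -/
def toggle (A : Set P) (b : P → Bool) : P → Bool :=
  open Classical in fun p => if p ∈ A then !(b p) else b p

theorem toggle_toggle (A : Set P) (b : P → Bool) : toggle A (toggle A b) = b := by
  funext p
  by_cases h : p ∈ A <;> simp [toggle, h]

theorem pauliX_apply (A : Set P) (ψ : (Q → Bool) → ℂ) (b : P → Bool) :
    pauliX {i | pair i ∈ A} ψ (b ∘ pair) = ψ (toggle A b ∘ pair) := rfl

theorem parity_toggle [Fintype P] (p : P) (b : P → Bool) : parity (toggle {p} b) = parity b + 1 := by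
  classical
  have h : ∀ x, bit (toggle {p} b x) = bit (b x) + if x = p then 1 else 0 := by
    intro x
    by_cases h : x = p
    · subst h
      cases hb : b x <;> simp [toggle, hb, bit]
      decide
    · simp [toggle, h]
  simp only [parity, h, Finset.sum_add_distrib, Finset.sum_ite_eq', Finset.mem_univ, if_true]

theorem toggle_pair {p p' : P} (h : p ≠ p') (b : P → Bool) :
    toggle {x | x = p ∨ x = p'} b = toggle {p} (toggle {p'} b) := by
  funext x
  by_cases h1 : x = p
  · subst h1; simp [toggle, h]
  · by_cases h2 : x = p'
    · subst h2; simp [toggle, h1]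
    · simp [toggle, h1, h2]

theorem pauliX_word_of_not_const (A : Set P) (l : Bool) {a : Q → Bool}
    (ha : ¬ ∀ i j, pair i = pair j → a i = a j) :
    pauliX {i | pair i ∈ A} (word pair l) a = 0 := by
  refine word_eq_zero l fun h => ha fun i j hij => ?_
  have := h i j hij
  by_cases hA : pair i ∈ A
  · have hA' : pair j ∈ A := hij ▸ hA
    simpa [hA, hA'] using this
  · have hA' : pair j ∉ A := hij ▸ hA
    simpa [hA, hA'] using this

theorem pauliX_word [Fintype P] (hp : Function.Surjective pair) (p : P) (l : Bool) :
    pauliX {i | pair i = p} (word pair l) = word pair (!l) := by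
  funext a
  change pauliX {i | pair i ∈ ({p} : Set P)} (word pair l) a = _
  by_cases ha : ∀ i j, pair i = pair j → a i = a j
  · obtain ⟨b, rfl⟩ := exists_comp_eq hp ha
    rw [pauliX_apply, word_comp hp, word_comp hp, parity_toggle]
    refine if_congr ?_ rfl rfl
    generalize parity b = z
    revert z l
    decide
  · rw [pauliX_word_of_not_const _ l ha, word_eq_zero _ ha]

theorem ncard_pair_of_const [Finite Q] (h2 : ∀ p : P, {q : Q | pair q = p}.ncard = 2) (p : P)
    (b : P → Bool) : Even ({i | i ∈ {i | pair i = p} ∧ (b ∘ pair) i = true}.ncard) := by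
  cases hb : b p
  · have : {i | i ∈ {i | pair i = p} ∧ (b ∘ pair) i = true} = ∅ := by
      ext i
      simp only [Set.mem_ofPred_eq, Function.comp_apply, Set.mem_empty_iff_false, iff_false]
      rintro ⟨rfl, h⟩
      rw [hb] at h
      exact Bool.false_ne_true h
    rw [this]; simp
  · have : {i | i ∈ {i | pair i = p} ∧ (b ∘ pair) i = true} = {i | pair i = p} := by
      ext i
      simp only [Set.mem_ofPred_eq, Function.comp_apply, and_iff_left_iff_imp]
      rintro rfl; exact hb
    rw [this, h2]
    exact even_two

theorem word_mem_codeSpace [Fintype P] [Finite Q] (h2 : ∀ p : P, {q : Q | pair q = p}.ncard = 2)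
    (hp : Function.Surjective pair) (l : Bool) : word pair l ∈ codeSpace pair := by
  constructor
  · intro p p' hpp
    funext a
    change pauliX {i | pair i ∈ {x | x = p ∨ x = p'}} (word pair l) a = _
    by_cases ha : ∀ i j, pair i = pair j → a i = a j
    · obtain ⟨b, rfl⟩ := exists_comp_eq hp ha
      rw [pauliX_apply, word_comp hp, word_comp hp, toggle_pair hpp, parity_toggle, parity_toggle,
        add_assoc, CharTwo.add_self_eq_zero, add_zero]
    · rw [pauliX_word_of_not_const _ l ha, word_eq_zero _ ha]
  · intro p
    funext a
    by_cases ha : ∀ i j, pair i = pair j → a i = a j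
    · obtain ⟨b, rfl⟩ := exists_comp_eq hp ha
      rw [pauliZ, (ncard_pair_of_const h2 p b).neg_one_pow, one_mul]
    · rw [pauliZ, word_eq_zero _ ha, mul_zero]

/-- If the two bits of a pair differ, the stabilizer `Z Z` of that pair acts on the basis state by
-1, so the amplitude equals its own negative. -/
theorem codeSpace_apply_of_not_const (h2 : ∀ p : P, {q : Q | pair q = p}.ncard = 2)
    {ψ : (Q → Bool) → ℂ} (hψ : ψ ∈ codeSpace pair) {a : Q → Bool}
    (ha : ¬ ∀ i j, pair i = pair j → a i = a j) : ψ a = 0 := by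
  push Not at ha
  obtain ⟨i, j, hij, hne⟩ := ha
  wlog hi : a i = true generalizing i j
  · refine this j i hij.symm hne.symm ?_
    cases h : a j
    · rw [h] at hne; exact absurd (Bool.not_eq_true _ ▸ hi) hne
    · rfl
  have hj : a j = false := by
    cases h : a j
    · rfl
    · rw [hi, h] at hne; exact absurd rfl hne
  have h3 : {q | q ∈ {q | pair q = pair i} ∧ a q = true} = {i} := by
    obtain ⟨x, y, hxy, hs⟩ := Set.ncard_eq_two.1 (h2 (pair i))
    have hix : i ∈ ({x, y} : Set Q) := hs ▸ rfl
    have hjx : j ∈ ({x, y} : Set Q) := hs ▸ hij.symm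
    have hne' : i ≠ j := by rintro rfl; exact hne rfl
    rw [hs]
    ext q
    simp only [Set.mem_insert_iff, Set.mem_singleton_iff, Set.mem_ofPred_eq] at *
    constructor
    · rintro ⟨hq, hq'⟩
      have : q ≠ j := by rintro rfl; rw [hj] at hq'; exact Bool.false_ne_true hq'
      aesop
    · rintro rfl; exact ⟨hix, hi⟩
  have h4 := congrFun (hψ.2 (pair i)) a
  rw [pauliZ, h3, Set.ncard_singleton] at h4
  have h5 : -ψ a = ψ a := by simpa using h4
  exact self_eq_neg.1 h5.symm

/-- The X stabilizers allow the flip of one pair to be replaced by the flip of any other. Adding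
pairs one at a time, every assignment is reduced to the zero assignment or to a single flip at `p₀`,
according to its parity. -/
theorem codeSpace_apply [Fintype P] {ψ : (Q → Bool) → ℂ} (hψ : ψ ∈ codeSpace pair) (p₀ : P) (b : P → Bool) :
    (parity b = 0 → ψ (b ∘ pair) = ψ ((fun _ => false) ∘ pair)) ∧
      (parity b = 1 → ψ (b ∘ pair) = ψ (toggle {p₀} (fun _ => false) ∘ pair)) := by
  classical
  set z : P → Bool := fun _ => false with hz
  have hflip : ∀ (p p' : P) (b : P → Bool), p ≠ p' →
      ψ (toggle {p} b ∘ pair) = ψ (toggle {p'} b ∘ pair) := by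
    intro p p' b h
    have := congrFun (hψ.1 p p' h) (toggle {p'} b ∘ pair)
    change pauliX {i | pair i ∈ {x | x = p ∨ x = p'}} ψ _ = _ at this
    rw [pauliX_apply, toggle_pair h, toggle_toggle] at this
    exact this
  -- The value at the assignment flipped at `p₀` is carried along, because adding a pair exchanges
  -- the two values.
  have key : ∀ s : Finset P, ∀ c : P → Bool, c = (fun p => decide (p ∈ s)) →
      (parity c = 0 → ψ (c ∘ pair) = ψ (z ∘ pair) ∧
        ψ (toggle {p₀} c ∘ pair) = ψ (toggle {p₀} z ∘ pair)) ∧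
      (parity c = 1 → ψ (c ∘ pair) = ψ (toggle {p₀} z ∘ pair) ∧
        ψ (toggle {p₀} c ∘ pair) = ψ (z ∘ pair)) := by
    intro s
    induction s using Finset.induction_on with
    | empty =>
      rintro c rfl
      have : (fun p : P => decide (p ∈ (∅ : Finset P))) = z := by simp [hz]
      rw [this]
      refine ⟨fun _ => ⟨rfl, rfl⟩, fun h => ?_⟩
      simp [parity, hz, bit] at h
    | insert p s hps ih =>
      intro c hc
      have hc' : c = toggle {p} (fun p => decide (p ∈ s)) := by
        rw [hc]; funext x
        by_cases h : x = p
        · subst h; simp [toggle, hps]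
        · simp [toggle, h]
      set c' : P → Bool := fun p => decide (p ∈ s)
      have h1 : ψ (c ∘ pair) = ψ (toggle {p₀} c' ∘ pair) := by
        by_cases h : p = p₀
        · rw [hc', h]
        · rw [hc', hflip p p₀ c' h]
      have h2 : ψ (toggle {p₀} c ∘ pair) = ψ (c' ∘ pair) := by
        by_cases h : p = p₀
        · rw [hc', h, toggle_toggle]
        · have := hflip p₀ p c fun h' => h h'.symm
          rw [this, hc', toggle_toggle]
      have h3 : parity c = parity c' + 1 := by rw [hc', parity_toggle]
      obtain ⟨ih0, ih1⟩ := ih c' rfl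
      rw [h1, h2, h3]
      constructor
      · intro h
        have : parity c' = 1 := by
          revert h; generalize parity c' = t; revert t; decide
        exact (ih1 this).symm
      · intro h
        have : parity c' = 0 := by
          revert h; generalize parity c' = t; revert t; decide
        exact (ih0 this).symm
  have h := key (Finset.univ.filter fun p => b p = true) b (by funext p; simp)
  exact ⟨fun h0 => (h.1 h0).1, fun h1 => (h.2 h1).1⟩

/-- Flipping one pair is a bijection between even and odd assignments of the pairs, so each class
has half of all assignments, and the amplitude is normalised for that number. -/
theorem sum_word [Fintype P] (hp : Function.Surjective pair) [Nonempty P] [Fintype (Q → Bool)] (l : Bool) :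
    ∑ a : Q → Bool, conj (word pair l a) * word pair l a = 1 := by
  classical
  have hinj : Function.Injective fun b : P → Bool => b ∘ pair := hp.injective_comp_right
  set κ : ℂ := ((Real.sqrt (2 ^ (Nat.card P - 1)) : ℝ) : ℂ)⁻¹ with hκ
  have hκ2 : conj κ * κ * 2 ^ Fintype.card P = 2 := by
    have h1 : (Real.sqrt (2 ^ (Nat.card P - 1)) : ℝ) * Real.sqrt (2 ^ (Nat.card P - 1)) =
        2 ^ (Nat.card P - 1) := Real.mul_self_sqrt (by positivity)
    -- Since `P` is nonempty, the truncated subtraction in the exponent loses nothing.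
    have h2 : Fintype.card P = (Nat.card P - 1) + 1 := by
      rw [Nat.card_eq_fintype_card]
      have := Fintype.card_pos (α := P)
      omega
    have h3 : conj κ = κ := by rw [hκ, map_inv₀, Complex.conj_ofReal]
    have h4 : (((Real.sqrt (2 ^ (Nat.card P - 1)) : ℝ) : ℂ)) *
        ((Real.sqrt (2 ^ (Nat.card P - 1)) : ℝ) : ℂ) = 2 ^ (Nat.card P - 1) := by
      rw [← Complex.ofReal_mul, h1]; push_cast; rfl
    rw [h3, h2, pow_succ, ← h4, hκ]
    have h5 : ((Real.sqrt (2 ^ (Nat.card P - 1)) : ℝ) : ℂ) ≠ 0 := by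
      rw [Ne, Complex.ofReal_eq_zero]
      positivity
    field_simp
  have h1 : ∀ l, ∑ a : Q → Bool, conj (word pair l a) * word pair l a =
      ∑ b : P → Bool, if parity b = bit l then conj κ * κ else 0 := by
    intro l
    symm
    refine Fintype.sum_of_injective (fun b : P → Bool => b ∘ pair) hinj _ _ ?_ ?_
    · intro a ha
      rw [word_eq_zero l, mul_zero]
      intro h
      obtain ⟨b, rfl⟩ := exists_comp_eq hp h
      exact ha ⟨b, rfl⟩
    · intro b
      rw [word_comp hp]
      split_ifs <;> simp [hκ]
  have hsum : (∑ b : P → Bool, if parity b = bit true then conj κ * κ else 0) +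
      (∑ b : P → Bool, if parity b = bit false then conj κ * κ else 0) = 2 := by
    rw [← Finset.sum_add_distrib, ← hκ2]
    have : ∀ b : P → Bool, ((if parity b = bit true then conj κ * κ else 0) +
        if parity b = bit false then conj κ * κ else 0) = conj κ * κ := by
      intro b
      rcases Honeycomb.zmod_two_cases (parity b) with h | h <;> simp [h, bit]
    simp only [this, Finset.sum_const, Finset.card_univ, Fintype.card_pi, Fintype.card_bool,
      Finset.prod_const, nsmul_eq_mul]
    push_cast
    ring
  have heq : (∑ b : P → Bool, if parity b = bit true then conj κ * κ else 0) =
      ∑ b : P → Bool, if parity b = bit false then conj κ * κ else 0 := by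
    have p₀ : P := Classical.arbitrary P
    have hinv : Function.Involutive (toggle ({p₀} : Set P)) := toggle_toggle _
    rw [← Equiv.sum_comp (hinv.toPerm _)]
    refine Finset.sum_congr rfl fun b _ => if_congr ?_ rfl rfl
    change parity (toggle {p₀} b) = _ ↔ _
    rw [parity_toggle]
    generalize parity b = t
    revert t; decide
  rw [h1]
  have h2 : (2 : ℂ) ≠ 0 := two_ne_zero
  cases l
  · rw [heq, ← two_mul] at hsum
    exact mul_left_cancel₀ h2 (hsum.trans (mul_one _).symm)
  · rw [← heq, ← two_mul] at hsum
    exact mul_left_cancel₀ h2 (hsum.trans (mul_one _).symm)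

theorem isEncoding [Fintype P] [Finite Q] [Nonempty P] (h2 : ∀ p : P, {q : Q | pair q = p}.ncard = 2) :
    IsEncoding pair := by
  classical
  have hp : Function.Surjective pair := by
    intro p
    have : {q : Q | pair q = p}.Nonempty := by
      rw [Set.nonempty_iff_ne_empty]
      intro h
      have := h2 p
      rw [h] at this
      simp at this
    exact this
  have := Fintype.ofFinite Q
  have hκ : ((Real.sqrt (2 ^ (Nat.card P - 1)) : ℝ) : ℂ)⁻¹ ≠ 0 := by
    rw [Ne, inv_eq_zero, Complex.ofReal_eq_zero]
    positivity
  refine ⟨fun ψ => ⟨fun hψ => ?_, ?_⟩, fun l l' => ?_, fun p l => pauliX_word hp p l,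
    fun T l hT => ?_⟩
  · obtain ⟨p₀⟩ := ‹Nonempty P›
    set κ := ((Real.sqrt (2 ^ (Nat.card P - 1)) : ℝ) : ℂ)⁻¹ with hk
    refine ⟨ψ ((fun _ => false) ∘ pair) / κ, ψ (toggle {p₀} (fun _ => false) ∘ pair) / κ, ?_⟩
    funext a
    by_cases ha : ∀ i j, pair i = pair j → a i = a j
    · obtain ⟨b, rfl⟩ := exists_comp_eq hp ha
      obtain ⟨h3, h4⟩ := codeSpace_apply hψ p₀ b
      simp only [Pi.add_apply, Pi.smul_apply, word_comp hp, ← hk, smul_eq_mul]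
      rcases Honeycomb.zmod_two_cases (parity b) with h | h
      · rw [h3 h]
        simp [h, bit, hκ]
      · rw [h4 h]
        simp [h, bit, hκ]
    · rw [codeSpace_apply_of_not_const h2 hψ ha]
      simp [word_eq_zero _ ha]
  · rintro ⟨α, β, rfl⟩
    have h3 := word_mem_codeSpace h2 hp false
    have h4 := word_mem_codeSpace h2 hp true
    constructor
    · intro p p' h
      have e1 := h3.1 p p' h
      have e2 := h4.1 p p' h
      funext a
      have e1 := congrFun e1 a
      have e2 := congrFun e2 a
      simp only [pauliX, Pi.add_apply, Pi.smul_apply] at *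
      rw [e1, e2]
    · intro p
      have e1 := h3.2 p
      have e2 := h4.2 p
      funext a
      have e1 := congrFun e1 a
      have e2 := congrFun e2 a
      simp only [pauliZ, Pi.add_apply, Pi.smul_apply, smul_eq_mul] at *
      rw [mul_add, mul_left_comm, e1, mul_left_comm, e2]
  · rw [finsum_eq_sum_of_fintype]
    by_cases h : l = l'
    · subst h
      rw [if_pos rfl, sum_word hp]
    · rw [if_neg h]
      refine Finset.sum_eq_zero fun a _ => ?_
      by_cases ha : ∀ i j, pair i = pair j → a i = a j
      · obtain ⟨b, rfl⟩ := exists_comp_eq hp ha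
        rw [word_comp hp, word_comp hp]
        by_cases h3 : parity b = bit l
        · have h4 : parity b ≠ bit l' := fun h4 => h (Honeycomb.bit_injective (h3.symm.trans h4))
          rw [if_neg h4, mul_zero]
        · rw [if_neg h3, map_zero, zero_mul]
      · rw [word_eq_zero _ ha, map_zero, zero_mul]
  · funext a
    by_cases ha : ∀ i j, pair i = pair j → a i = a j
    · obtain ⟨b, rfl⟩ := exists_comp_eq hp ha
      have h3 : {i | i ∈ T ∧ (b ∘ pair) i = true}.ncard = {p | b p = true}.ncard := by
        have h4 : pair '' {i | i ∈ T ∧ (b ∘ pair) i = true} = {p | b p = true} := by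
          ext p
          constructor
          · rintro ⟨i, ⟨-, hi⟩, rfl⟩; exact hi
          · intro h
            obtain ⟨i, ⟨hi, rfl⟩, -⟩ := hT p
            exact ⟨i, ⟨hi, h⟩, rfl⟩
        rw [← h4, Set.InjOn.ncard_image]
        intro i hi j hj hij
        exact (hT (pair j)).unique ⟨hi.1, hij⟩ ⟨hj.1, rfl⟩
      rw [pauliZ, h3, Pi.smul_apply, smul_eq_mul, word_comp hp]
      by_cases h5 : parity b = bit l
      · have h6 := Honeycomb.odd_ncard_iff b
        rw [← parity, h5] at h6
        rw [if_pos h5]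
        cases l
        · have : ¬ Odd ({p | b p = true}.ncard) := by rw [h6]; decide
          rw [(Nat.not_odd_iff_even.1 this).neg_one_pow]; simp
        · have : Odd ({p | b p = true}.ncard) := by rw [h6]; decide
          rw [this.neg_one_pow]; simp
      · rw [if_neg h5, mul_zero, mul_zero]
    · rw [pauliZ, Pi.smul_apply, word_eq_zero _ ha, mul_zero, smul_zero]

end XICode

/-! ### The contracted network as a signed sum over words -/

namespace Honeycomb

namespace Construction

variable {C : Construction} {N m : ℕ}

theorem exists_vertexTensor_eq (hC : C.HasShape N m) (hN : 0 < N) (hm : 0 < m) {S : Set Vertex}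
    (hS : S.Finite) : ∃ K : ℝ, 0 < K ∧ ∀ a l, ∏ᶠ v ∈ S, C.vertexTensor v a l =
      open Classical in if C.IsWord S a l then (K : ℂ) else 0 := by
  classical
  have hκ : (0 : ℝ) < (Real.sqrt (2 ^ (m - 1)))⁻¹ := by positivity
  set κ : ℝ := (Real.sqrt (2 ^ (m - 1)))⁻¹
  have hpos : ∀ v, 0 < ∏ᶠ b ∈ {b : C.Block | C.blockVertex b = v}, κ := by
    intro v
    rw [finprod_mem_eq_finite_toFinset_prod _ (hC.finite_block hN v)]
    exact Finset.prod_pos fun _ _ => hκ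
  refine ⟨∏ᶠ v ∈ S, ∏ᶠ b ∈ {b : C.Block | C.blockVertex b = v}, κ, ?_, ?_⟩
  · rw [finprod_mem_eq_finite_toFinset_prod _ hS]
    exact Finset.prod_pos fun v _ => hpos v
  · intro a l
    have h1 : ∀ v, C.vertexTensor v a l = if ∀ b ∈ {b : C.Block | C.blockVertex b = v},
        (∀ q q', C.pairBlock (C.qubitPair q) = b → C.qubitPair q = C.qubitPair q' → a q = a q') ∧
        C.par b a = bit (l (C.blockLogical b))
        then ((∏ᶠ b ∈ {b : C.Block | C.blockVertex b = v}, κ : ℝ) : ℂ) else 0 := by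
      intro v
      rw [← finprod_mem_ite (hC.finite_block hN v) _ (fun _ => κ), vertexTensor]
      simp only [blockTensor_eq hC hm]
      exact finprod_set_coe_eq_finprod_mem (f := fun b => if
        (∀ q q', C.pairBlock (C.qubitPair q) = b → C.qubitPair q = C.qubitPair q' → a q = a q') ∧
        C.par b a = bit (l (C.blockLogical b)) then (κ : ℂ) else 0)
        {b : C.Block | C.blockVertex b = v}
    simp only [h1]
    rw [finprod_mem_ite hS]
    refine if_congr ?_ rfl rfl
    constructor
    · intro h b hb
      exact h _ hb b rfl
    · rintro h v hv b rfl
      exact h b hv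

/-- The exponent of the product of the Hadamard gates. -/
def phase (C : Construction) (e : Pairing) (S : Set Vertex) (x : C.Qubit → Bool) : ZMod 2 :=
  ∑ᶠ s ∈ C.bonds e S, Sym2.lift ⟨fun q q' => bit (x q) * bit (x q'), fun _ _ => mul_comm _ _⟩ s

theorem finite_bonds (hC : C.HasShape N m) (hN : 0 < N) (hm : 0 < m) (e : Pairing) {S : Set Vertex}
    (hS : S.Finite) : (C.bonds e S).Finite := by
  have h := hC.finite_qubits hN hm hS
  refine ((h.prod h).image fun p => s(p.1, p.2)).subset ?_
  rintro s ⟨⟨q, q', -, rfl⟩, h2⟩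
  exact ⟨(q, q'), ⟨h2 q (by simp), h2 q' (by simp)⟩, rfl⟩

theorem exists_bonds_eq (hC : C.HasShape N m) (hN : 0 < N) (hm : 0 < m) (e : Pairing)
    {S : Set Vertex} (hS : S.Finite) : ∃ K : ℝ, 0 < K ∧ ∀ x : C.Qubit → Bool,
      ∏ᶠ s ∈ C.bonds e S, Sym2.lift ⟨hadamard, hadamard_comm⟩ (s.map x) =
        K * sgn (C.phase e S x) := by
  have hf := finite_bonds hC hN hm e hS
  refine ⟨∏ s ∈ hf.toFinset, (Real.sqrt 2)⁻¹, Finset.prod_pos fun _ _ => by positivity,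
    fun x => ?_⟩
  rw [finprod_mem_eq_finite_toFinset_prod _ hf, phase, finsum_mem_eq_finite_toFinset_sum _ hf,
    sgn_sum, Complex.ofReal_prod, ← Finset.prod_mul_distrib]
  refine Finset.prod_congr rfl fun s _ => ?_
  induction s with
  | _ q q' => simp [hadamard_eq, mul_comm]

/-- The assignment with given values on the external and internal qubits. -/
def assign {O J : Set C.Qubit} (o : O → Bool) (i : J → Bool) (a : C.Qubit → Bool) :
    C.Qubit → Bool :=
  Function.extend Subtype.val i (Function.extend Subtype.val o a)

theorem assign_xor {O J : Set C.Qubit} (o o' : O → Bool) (i i' : J → Bool)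
    (a a' : C.Qubit → Bool) (q : C.Qubit) :
    assign (fun k => xor (o k) (o' k)) (fun k => xor (i k) (i' k)) (fun k => xor (a k) (a' k)) q =
      xor (assign o i a q) (assign o' i' a' q) := by
  have ext : ∀ {A : Set C.Qubit} (f : A → Bool) (g : C.Qubit → Bool) (q : C.Qubit),
      Function.extend Subtype.val f g q = open Classical in if h : q ∈ A then f ⟨q, h⟩ else g q := by
    intro A f g q
    by_cases h : q ∈ A
    · rw [dif_pos h]
      exact Subtype.val_injective.extend_apply f g ⟨q, h⟩
    · rw [dif_neg h]
      refine Function.extend_apply' _ _ _ ?_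
      rintro ⟨y, rfl⟩
      exact h y.2
  simp only [assign, ext]
  split_ifs <;> rfl

theorem assign_of_mem {O J : Set C.Qubit} (o : O → Bool) (i : J → Bool) (a : C.Qubit → Bool)
    {q : C.Qubit} (h : q ∈ J) : assign o i a q = i ⟨q, h⟩ :=
  Subtype.val_injective.extend_apply i _ ⟨q, h⟩

theorem assign_of_notMem {O J : Set C.Qubit} (o : O → Bool) (i : J → Bool) (a : C.Qubit → Bool)
    {q : C.Qubit} (h : q ∉ J) : assign o i a q = Function.extend Subtype.val o a q :=
  Function.extend_apply' _ _ _ (by rintro ⟨y, rfl⟩; exact h y.2)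

theorem assign_of_mem_left {O J : Set C.Qubit} (o : O → Bool) (i : J → Bool) (a : C.Qubit → Bool)
    {q : C.Qubit} (h : q ∉ J) (h' : q ∈ O) : assign o i a q = o ⟨q, h'⟩ := by
  rw [assign_of_notMem _ _ _ h]
  exact Subtype.val_injective.extend_apply o _ ⟨q, h'⟩

theorem assign_of_notMem_of_notMem {O J : Set C.Qubit} (o : O → Bool) (i : J → Bool)
    (a : C.Qubit → Bool) {q : C.Qubit} (h : q ∉ J) (h' : q ∉ O) : assign o i a q = a q := by
  rw [assign_of_notMem _ _ _ h]
  exact Function.extend_apply' _ _ _ (by rintro ⟨y, rfl⟩; exact h' y.2)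

open Classical in
/-- The summand of the network. -/
def weight (C : Construction) (e : Pairing) (S : Set Vertex) (x : C.Qubit → Bool)
    (l : C.Logical → Bool) : ℂ :=
  if C.IsWord S x l then sgn (C.phase e S x) else 0

theorem conj_weight (e : Pairing) (S : Set Vertex) (x : C.Qubit → Bool) (l : C.Logical → Bool) :
    conj (C.weight e S x l) = C.weight e S x l := by
  unfold weight
  split_ifs <;> simp [conj_sgn]

/-- All normalisations are collected in one positive constant, which the notion of isometry ignores;
what remains is a sum of signs over words. -/
theorem exists_network_eq (hC : C.HasShape N m) (hN : 0 < N) (hm : 0 < m) (e : Pairing)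
    {S : Set Vertex} (hS : S.Finite) [Fintype (C.internal e S → Bool)] :
    ∃ K : ℝ, 0 < K ∧ ∀ (a : C.Qubit → Bool) (l : C.Logical → Bool),
      C.network e S a l = K * ∑ i : C.internal e S → Bool,
        C.weight e S (Function.extend Subtype.val i a) l := by
  obtain ⟨K, hK, h1⟩ := exists_vertexTensor_eq hC hN hm hS
  obtain ⟨K', hK', h2⟩ := exists_bonds_eq hC hN hm e hS
  refine ⟨K * K', mul_pos hK hK', fun a l => ?_⟩
  rw [network, finsum_eq_sum_of_fintype, Finset.mul_sum]
  refine Finset.sum_congr rfl fun i _ => ?_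
  rw [h1, h2, weight]
  split_ifs
  · push_cast; ring
  · simp

/-! The weights only depend on the qubits of `S`. -/

theorem isWord_congr {S : Set Vertex} {x y : C.Qubit → Bool} {l : C.Logical → Bool}
    (h : ∀ q, C.qubitVertex q ∈ S → x q = y q) : C.IsWord S x l ↔ C.IsWord S y l := by
  suffices H : ∀ {x y : C.Qubit → Bool}, (∀ q, C.qubitVertex q ∈ S → x q = y q) →
      C.IsWord S x l → C.IsWord S y l from ⟨H h, H fun q hq => (h q hq).symm⟩
  intro x y h hx b hb
  have hq : ∀ q, C.pairBlock (C.qubitPair q) = b → C.qubitVertex q ∈ S := fun q hq => by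
    rw [qubitVertex, hq]; exact hb
  constructor
  · intro q q' h1 h2
    rw [← h q (hq q h1), ← h q' (hq q' (h2 ▸ h1))]
    exact (hx b hb).1 q q' h1 h2
  · rw [← (hx b hb).2, par, par]
    refine finsum_mem_congr rfl fun p hp => ?_
    rw [h _ (hq _ (by rw [C.qubitPair_rep]; exact hp))]

theorem phase_congr {e : Pairing} {S : Set Vertex} {x y : C.Qubit → Bool}
    (h : ∀ q, C.qubitVertex q ∈ S → x q = y q) : C.phase e S x = C.phase e S y := by
  refine finsum_mem_congr rfl fun s hs => ?_
  induction s with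
  | _ q q' => simp [h q (hs.2 q (by simp)), h q' (hs.2 q' (by simp))]

theorem weight_congr {e : Pairing} {S : Set Vertex} {x y : C.Qubit → Bool} {l : C.Logical → Bool}
    (h : ∀ q, C.qubitVertex q ∈ S → x q = y q) : C.weight e S x l = C.weight e S y l := by
  classical
  unfold weight
  rw [phase_congr h]
  exact if_congr (isWord_congr h) rfl rfl

theorem par_xor (hC : C.HasShape N m) (hm : 0 < m) (b : C.Block) (x y : C.Qubit → Bool) :
    C.par b (fun q => xor (x q) (y q)) = C.par b x + C.par b y := by
  simp only [par, bit_xor]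
  exact finsum_mem_add_distrib (hC.finite_pair hm b)

theorem IsWord.xor (hC : C.HasShape N m) (hm : 0 < m) {S : Set Vertex} {x y : C.Qubit → Bool}
    {l l' : C.Logical → Bool} (hx : C.IsWord S x l) (hy : C.IsWord S y l') :
    C.IsWord S (fun q => Bool.xor (x q) (y q)) (fun k => Bool.xor (l k) (l' k)) := by
  intro b hb
  refine ⟨fun q q' h1 h2 => ?_, ?_⟩
  · beta_reduce
    rw [(hx b hb).1 q q' h1 h2, (hy b hb).1 q q' h1 h2]
  · rw [par_xor hC hm, (hx b hb).2, (hy b hb).2, bit_xor]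

/-- The sum over a pair of the values of `d` at the partners of its internal qubits. -/
def pairSum (C : Construction) (e : Pairing) (S : Set Vertex) (d : C.Qubit → Bool) (p : C.Pair) :
    ZMod 2 :=
  ∑ᶠ q ∈ {q | q ∈ C.internal e S ∧ C.qubitPair q = p}, ∑ᶠ q' ∈ {q' | C.Bonded e q q'}, bit (d q')

/-- The phase is a quadratic form in the assignment. Its second difference in the directions `w` and
`d` is the associated bilinear form, which does not depend on the base point `x`. -/
theorem phase_add (hC : C.HasShape N m) (hN : 0 < N) (hm : 0 < m) (e : Pairing) {S : Set Vertex}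
    (hS : S.Finite) (x w d : C.Qubit → Bool) :
    C.phase e S (fun q => xor (x q) (w q)) + C.phase e S (fun q => xor (xor (x q) (w q)) (d q)) +
      (C.phase e S x + C.phase e S (fun q => xor (x q) (d q))) =
    ∑ᶠ s ∈ C.bonds e S, Sym2.lift ⟨fun q q' => bit (w q) * bit (d q') + bit (w q') * bit (d q),
      fun _ _ => add_comm _ _⟩ s := by
  have hf := finite_bonds hC hN hm e hS
  rw [phase, phase, phase, phase, ← finsum_mem_add_distrib hf, ← finsum_mem_add_distrib hf,
    ← finsum_mem_add_distrib hf]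
  refine finsum_mem_congr rfl fun s _ => ?_
  induction s with
  | _ q q' =>
    simp only [Sym2.lift_mk, bit_xor]
    generalize bit (x q) = a
    generalize bit (x q') = b
    generalize bit (w q) = c
    generalize bit (w q') = f
    generalize bit (d q) = g
    generalize bit (d q') = h
    revert a b c f g h
    decide

/-- The partner map is an involution without fixed points, so each bond within `S` is counted by
exactly its two internal ends. -/
theorem sum_bonds (hC : C.HasShape N m) (hN : 0 < N) (hm : 0 < m) (e : Pairing) {S : Set Vertex}
    (hS : S.Finite) (w d : C.Qubit → Bool) :
    ∑ᶠ s ∈ C.bonds e S, Sym2.lift ⟨fun q q' => bit (w q) * bit (d q') + bit (w q') * bit (d q),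
      fun _ _ => add_comm _ _⟩ s =
    ∑ᶠ q ∈ C.internal e S, bit (w q) * ∑ᶠ q' ∈ {q' | C.Bonded e q q'}, bit (d q') := by
  classical
  have hf := finite_bonds hC hN hm e hS
  have hi : (C.internal e S).Finite := (hC.finite_qubits hN hm hS).subset fun q hq => hq.1
  have hp := hC.2.2.2.1 e
  choose partner hpart huniq using hp
  have hset : ∀ q, {q' | C.Bonded e q q'} = {partner q} := by
    intro q; ext q'
    exact ⟨fun h => huniq q q' h, fun h => by rw [Set.mem_singleton_iff.1 h]; exact hpart q⟩
  have hinv : ∀ q, partner (partner q) = q := fun q =>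
    (huniq _ _ (hC.2.2.2.2 e q _ (hpart q)).1).symm
  have hne : ∀ q, partner q ≠ q := fun q h => (hC.2.2.2.2 e q _ (hpart q)).2 (by rw [h])
  have hint : ∀ q, q ∈ C.internal e S ↔ C.qubitVertex q ∈ S ∧ C.qubitVertex (partner q) ∈ S := by
    intro q
    refine and_congr_right fun _ => ⟨?_, fun h => ⟨_, hpart q, h⟩⟩
    rintro ⟨q', h1, h2⟩
    rwa [← huniq q q' h1]
  simp only [hset, finsum_mem_singleton]
  rw [finsum_mem_eq_finite_toFinset_sum _ hf, finsum_mem_eq_finite_toFinset_sum _ hi]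
  rw [← Finset.sum_fiberwise_of_maps_to (g := fun q => s(q, partner q)) (t := hf.toFinset)]
  · refine Finset.sum_congr rfl fun s hs => ?_
    obtain ⟨⟨q, q', hb, rfl⟩, h2⟩ := hf.mem_toFinset.1 hs
    obtain rfl := huniq q q' hb
    have hv := h2 q (by simp)
    have hv' := h2 (partner q) (by simp)
    have : hi.toFinset.filter (fun k => s(k, partner k) = s(q, partner q)) = {q, partner q} := by
      ext k
      simp only [Finset.mem_filter, Set.Finite.mem_toFinset, hint, Finset.mem_insert,
        Finset.mem_singleton, Sym2.eq_iff]
      constructor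
      · rintro ⟨-, h | h⟩
        · exact Or.inl h.1
        · exact Or.inr h.1
      · rintro (rfl | rfl)
        · exact ⟨⟨hv, hv'⟩, Or.inl ⟨rfl, rfl⟩⟩
        · exact ⟨⟨hv', by rwa [hinv]⟩, Or.inr ⟨rfl, hinv _⟩⟩
    rw [this, Finset.sum_pair (hne q).symm, hinv]
    rfl
  · intro q hq
    rw [Set.Finite.mem_toFinset, hint] at hq
    rw [Set.Finite.mem_toFinset]
    refine ⟨⟨q, _, hpart q, rfl⟩, fun k hk => ?_⟩
    rcases Sym2.mem_iff.1 hk with rfl | rfl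
    exacts [hq.1, hq.2]

end Construction

end Honeycomb

/-! ### Translations by X stabilizers and extension of partial words -/

namespace Honeycomb

namespace Construction

variable {C : Construction} {N m : ℕ}

/-- The indicator of two pairs. -/
def pairFlip (p p' : C.Pair) : C.Qubit → Bool :=
  open Classical in fun q => decide (C.qubitPair q = p ∨ C.qubitPair q = p')

theorem bit_pairFlip {p p' : C.Pair} (hp : p ≠ p') (q : C.Qubit) : bit (pairFlip p p' q) =
    open Classical in (if C.qubitPair q = p then 1 else 0) + if C.qubitPair q = p' then 1 else 0 := by
  by_cases h1 : C.qubitPair q = p <;> by_cases h2 : C.qubitPair q = p'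
  · exact absurd (h1.symm.trans h2) hp
  all_goals simp_all [pairFlip, bit]

/-- This is the action of the stabilizer `X_i X_{i'} X_j X_{j'}`: two flips in one block cancel in
its parity, so translation by them preserves the words and their logical indices. -/
theorem isWord_pairFlip (hC : C.HasShape N m) (hm : 0 < m) (S : Set Vertex) {p p' : C.Pair}
    (hp : p ≠ p') (hb : C.pairBlock p = C.pairBlock p') :
    C.IsWord S (pairFlip p p') (fun _ => false) := by
  classical
  intro b _
  refine ⟨fun q q' _ h => by simp [pairFlip, h], ?_⟩
  have hf := hC.finite_pair hm b
  simp only [par, bit_pairFlip hp, C.qubitPair_rep]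
  rw [finsum_mem_add_distrib hf, finsum_mem_eq_finite_toFinset_sum _ hf,
    finsum_mem_eq_finite_toFinset_sum _ hf, Finset.sum_ite_eq', Finset.sum_ite_eq']
  simp only [Set.Finite.mem_toFinset, Set.mem_ofPred_eq, hb]
  split_ifs <;> decide

/-- Evaluates the bilinear form of the phase on such a translation. The result decides whether the
translation changes the sign of the summands. -/
theorem sum_pairFlip (hC : C.HasShape N m) (hN : 0 < N) (hm : 0 < m) (e : Pairing) {S : Set Vertex}
    (hS : S.Finite) (d : C.Qubit → Bool) {p p' : C.Pair} (hp : p ≠ p') :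
    ∑ᶠ q ∈ C.internal e S, bit (pairFlip p p' q) * ∑ᶠ q' ∈ {q' | C.Bonded e q q'}, bit (d q') =
      C.pairSum e S d p + C.pairSum e S d p' := by
  classical
  have hi : (C.internal e S).Finite := (hC.finite_qubits hN hm hS).subset fun q hq => hq.1
  have key : ∀ p, C.pairSum e S d p = ∑ᶠ q ∈ C.internal e S,
      (if C.qubitPair q = p then 1 else 0) * ∑ᶠ q' ∈ {q' | C.Bonded e q q'}, bit (d q') := by
    intro p
    have h2 : {q | q ∈ C.internal e S ∧ C.qubitPair q = p}.Finite := hi.subset fun q hq => hq.1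
    rw [pairSum, finsum_mem_eq_finite_toFinset_sum _ h2, finsum_mem_eq_finite_toFinset_sum _ hi]
    simp only [ite_mul, one_mul, zero_mul]
    rw [← Finset.sum_filter]
    congr 1
    ext q
    simp
  rw [key, key, ← finsum_mem_add_distrib hi]
  simp only [bit_pairFlip hp, add_mul]

theorem isWord_zero (S : Set Vertex) : C.IsWord S (fun _ => false) (fun _ => false) := by
  intro b _
  simp [par, bit]

theorem IsWord.logical_eq {S : Set Vertex} {x : C.Qubit → Bool} {l l' : C.Logical → Bool}
    (h : C.IsWord S x l) (h' : C.IsWord S x l') (k : C.Logical) (hk : C.logicalVertex k ∈ S) :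
    l k = l' k := by
  obtain ⟨b, rfl⟩ := C.blockLogical_surjective k
  exact bit_injective ((h b hk).2.symm.trans (h' b hk).2)

/-- Every pair carries at most one prescribed bit, and each block has a pair without any; the bit of
that free pair is used to correct the parity of the block. -/
theorem exists_isWord (hC : C.HasShape N m) (hm : 0 < m) {S : Set Vertex} {I : Set C.Qubit}
    (h1 : ∀ q ∈ I, ∀ q' ∈ I, C.qubitPair q = C.qubitPair q' → q = q')
    (h2 : ∀ b, C.blockVertex b ∈ S → ∃ p, C.pairBlock p = b ∧ ∀ q ∈ I, C.qubitPair q ≠ p)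
    (hI : ∀ q ∈ I, C.qubitVertex q ∈ S) (a : C.Qubit → Bool) (l : C.Logical → Bool) :
    ∃ y, C.IsWord S y l ∧ ∀ q ∈ I, y q = a q := by
  classical
  have h2' : ∀ b, ∃ p, C.blockVertex b ∈ S → C.pairBlock p = b ∧ ∀ q ∈ I, C.qubitPair q ≠ p := by
    intro b
    by_cases hb : C.blockVertex b ∈ S
    · obtain ⟨p, hp⟩ := h2 b hb
      exact ⟨p, fun _ => hp⟩
    · exact ⟨QuotientGroup.mk 1, fun h => absurd h hb⟩
  choose f hf using h2'
  -- Pairs without a prescribed qubit get the value `false`; by `h1` the choice for the other pairs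
  -- is unambiguous.
  set z : C.Pair → Bool := fun p => if h : ∃ q ∈ I, C.qubitPair q = p then a h.choose else false
    with hz
  have hbit : Function.Surjective bit := by
    intro t; rcases zmod_two_cases t with rfl | rfl
    exacts [⟨false, rfl⟩, ⟨true, rfl⟩]
  choose unbit hunbit using hbit
  set u : C.Block → ZMod 2 := fun b =>
    bit (l (C.blockLogical b)) + ∑ᶠ p ∈ {p | C.pairBlock p = b}, bit (z p) with hu
  refine ⟨fun q => if C.qubitPair q = f (C.pairBlock (C.qubitPair q)) then
    unbit (u (C.pairBlock (C.qubitPair q))) else z (C.qubitPair q), ?_, ?_⟩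
  · intro b hb
    obtain ⟨hfb, hfI⟩ := hf b hb
    refine ⟨fun q q' _ h => by simp only [h], ?_⟩
    have hzf : z (f b) = false := by
      rw [hz]; exact dif_neg (by rintro ⟨q, hq, h⟩; exact hfI q hq h)
    have hfin := hC.finite_pair hm b
    have h3 : C.par b (fun q => if C.qubitPair q = f (C.pairBlock (C.qubitPair q)) then
        unbit (u (C.pairBlock (C.qubitPair q))) else z (C.qubitPair q)) =
        ∑ᶠ p ∈ {p | C.pairBlock p = b}, (bit (z p) + if p = f b then u b else 0) := by
      refine finsum_mem_congr rfl fun p hp => ?_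
      have hp' : C.pairBlock p = b := hp
      simp only [C.qubitPair_rep, hp']
      split_ifs with h
      · rw [hunbit, h, hzf]; simp [bit]
      · simp
    rw [h3, finsum_mem_add_distrib hfin, finsum_mem_eq_finite_toFinset_sum _ hfin,
      finsum_mem_eq_finite_toFinset_sum _ hfin, Finset.sum_ite_eq', if_pos (by simpa using hfb), hu]
    simp only
    rw [finsum_mem_eq_finite_toFinset_sum _ hfin]
    generalize ∑ p ∈ hfin.toFinset, bit (z p) = s
    generalize bit (l (C.blockLogical b)) = t
    revert s t
    decide
  · intro q hq
    have h3 : C.qubitPair q ≠ f (C.pairBlock (C.qubitPair q)) := (hf _ (hI q hq)).2 q hq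
    have h4 : ∃ q' ∈ I, C.qubitPair q' = C.qubitPair q := ⟨q, hq, rfl⟩
    simp only [if_neg h3, hz, dif_pos h4]
    rw [h1 _ h4.choose_spec.1 q hq h4.choose_spec.2]

end Construction

end Honeycomb

/-! ### The isometry criterion as a linear system -/

namespace Honeycomb

namespace Construction

variable {C : Construction} {N m : ℕ}

/-- Restriction of an assignment. -/
def restr (J : Set C.Qubit) (x : C.Qubit → Bool) : J → Bool := fun k => x k.1

/-- Translation of the assignments of two sets of qubits. -/
def translate (O J : Set C.Qubit) (w : C.Qubit → Bool) :
    Equiv.Perm ((O → Bool) × (J → Bool)) :=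
  Function.Involutive.toPerm
    (fun z => (fun k => xor (z.1 k) (restr O w k), fun k => xor (z.2 k) (restr J w k)))
    (by intro z; simp)

theorem assign_restr {O J I : Set C.Qubit} {S : Set Vertex}
    (hcov : ∀ q, C.qubitVertex q ∈ S → q ∈ J ∨ q ∈ O ∨ q ∈ I) (w a : C.Qubit → Bool)
    (h : ∀ q ∈ I, w q = a q) (q : C.Qubit)
    (hq : C.qubitVertex q ∈ S) : assign (restr O w) (restr J w) a q = w q := by
  by_cases hJ : q ∈ J
  · rw [assign_of_mem _ _ _ hJ]; rfl
  by_cases hO : q ∈ O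
  · rw [assign_of_mem_left _ _ _ hJ hO]; rfl
  have hI : q ∈ I := by rcases hcov q hq with h | h | h <;> tauto
  rw [assign_of_notMem_of_notMem _ _ _ hJ hO, h q hI]

theorem assign_translate {O J I : Set C.Qubit} {S : Set Vertex}
    (hcov : ∀ q, C.qubitVertex q ∈ S → q ∈ J ∨ q ∈ O ∨ q ∈ I) (w a a' : C.Qubit → Bool)
    (h : ∀ q ∈ I, w q = xor (a q) (a' q))
    (z : (O → Bool) × (J → Bool)) (q : C.Qubit) (hq : C.qubitVertex q ∈ S) :
    assign (translate O J w z).1 (translate O J w z).2 a' q = xor (assign z.1 z.2 a q) (w q) := by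
  have h1 := assign_restr (J := J) (O := O) hcov w _ h q hq
  rw [← h1, ← assign_xor]
  have : (fun k => xor (a k) (xor (a k) (a' k))) = a' := by funext k; simp
  rw [this]
  rfl

/-- If some `x` and `x + D` are both words, `D` is constant on pairs, and flipping the two pairs
provided by `h` permutes the terms of the sum while negating each of them. If there is no such `x`,
every term is zero. -/
theorem sum_weight_eq_zero (hC : C.HasShape N m) (hN : 0 < N) (hm : 0 < m) {e : Pairing}
    {S : Set Vertex} (hS : S.Finite) {I O J : Set C.Qubit} [Fintype (O → Bool)] [Fintype (J → Bool)]
    (hcov : ∀ q, C.qubitVertex q ∈ S → q ∈ J ∨ q ∈ O ∨ q ∈ I)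
    (a : C.Qubit → Bool) (D : C.Qubit → Bool)
    (h : (∀ q q', C.qubitVertex q ∈ S → C.qubitPair q = C.qubitPair q' → D q = D q') →
      ∃ p p', C.pairBlock p = C.pairBlock p' ∧ (∀ q ∈ I, C.qubitPair q ≠ p ∧ C.qubitPair q ≠ p') ∧
        C.pairSum e S D p ≠ C.pairSum e S D p') (l l' : C.Logical → Bool) :
    ∑ z : (O → Bool) × (J → Bool), C.weight e S (assign z.1 z.2 a) l *
      C.weight e S (fun q => xor (assign z.1 z.2 a q) (D q)) l' = 0 := by
  classical
  by_cases hz : ∃ z : (O → Bool) × (J → Bool), C.IsWord S (assign z.1 z.2 a) l ∧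
    C.IsWord S (fun q => xor (assign z.1 z.2 a q) (D q)) l'
  · obtain ⟨z, hz1, hz2⟩ := hz
    obtain ⟨p, p', hb, hI, hne⟩ := h (by
      intro q q' hq hqq
      have h1 := (hz1 _ hq).1 q q' rfl hqq
      have h2 := (hz2 _ hq).1 q q' rfl hqq
      simp only [h1] at h2
      simpa using h2)
    have hp : p ≠ p' := by rintro rfl; exact hne rfl
    have hw := isWord_pairFlip hC hm S hp hb
    have hw0 : ∀ q ∈ I, pairFlip p p' q = xor (a q) (a q) := by
      intro q hq; simp [pairFlip, hI q hq]
    set w := pairFlip p p'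
    have hiff : ∀ x k, C.IsWord S (fun q => xor (x q) (w q)) k ↔ C.IsWord S x k := by
      intro x k
      constructor <;> intro hx
      · have := hx.xor hC hm hw
        simpa using this
      · have := hx.xor hC hm hw
        simpa using this
    set F : (C.Qubit → Bool) → ℂ := fun x =>
      C.weight e S x l * C.weight e S (fun q => xor (x q) (D q)) l' with hF
    have hFc : ∀ x y, (∀ q, C.qubitVertex q ∈ S → x q = y q) → F x = F y := by
      intro x y hxy
      simp only [hF]
      rw [weight_congr (x := x) (y := y) hxy, weight_congr (x := fun q => xor (x q) (D q))
        (y := fun q => xor (y q) (D q)) (fun q hq => by simp only [hxy q hq])]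
    have hneg : ∀ x, F (fun q => xor (x q) (w q)) = - F x := by
      intro x
      have h5 : (fun q => xor (xor (x q) (w q)) (D q)) = fun q => xor (xor (x q) (D q)) (w q) := by
        funext q; cases x q <;> cases w q <;> simp
      have h4 := phase_add hC hN hm e hS x w D
      rw [sum_bonds hC hN hm e hS, sum_pairFlip hC hN hm e hS D hp] at h4
      simp only [hF, weight, h5, hiff]
      by_cases h6 : C.IsWord S x l
      · by_cases h7 : C.IsWord S (fun q => xor (x q) (D q)) l'
        · simp only [if_pos h6, if_pos h7]
          rw [← sgn_add, ← sgn_add]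
          rw [h5] at h4
          revert h4 hne
          generalize C.phase e S (fun q => xor (x q) (w q)) +
            C.phase e S (fun q => xor (xor (x q) (D q)) (w q)) = s
          generalize C.phase e S x + C.phase e S (fun q => xor (x q) (D q)) = t
          generalize C.pairSum e S D p = u
          generalize C.pairSum e S D p' = v
          intro h1 h2
          have h3 : s = t + 1 := by
            revert s t u v; decide
          have h8 : sgn 1 = -1 := by simp [sgn]
          rw [h3, sgn_add, h8]; ring
        · simp [h7]
      · simp [h6]
    have hsum : ∑ z : (O → Bool) × (J → Bool), F (assign z.1 z.2 a) =
        ∑ z : (O → Bool) × (J → Bool), - F (assign z.1 z.2 a) := by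
      rw [← Equiv.sum_comp (translate O J w)]
      refine Finset.sum_congr rfl fun z _ => ?_
      rw [← hneg]
      exact hFc _ _ (assign_translate hcov w a a hw0 z)
    rw [Finset.sum_neg_distrib] at hsum
    exact self_eq_neg.1 hsum
  · refine Finset.sum_eq_zero fun z _ => ?_
    by_cases h6 : C.IsWord S (assign z.1 z.2 a) l
    · have h7 : ¬ C.IsWord S (fun q => xor (assign z.1 z.2 a q) (D q)) l' := fun h7 => hz ⟨z, h6, h7⟩
      simp [weight, h7]
    · simp [weight, h6]

/-- An entry of the Gram matrix is a double sum over internal assignments. Sorted by the difference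
`D` of the two assignments, all terms cancel unless `D` vanishes on `S`, which is what `h3` forces
in the absence of a cancelling translation. The surviving sum counts words, and by `h1` and `h2`
their number does not depend on the input or on the logical indices. -/
theorem isIsometry_network (hC : C.HasShape N m) (hN : 0 < N) (hm : 0 < m) (e : Pairing)
    {S : Set Vertex} (hS : S.Finite) {I O : Set C.Qubit}
    (hcov : ∀ q, C.qubitVertex q ∈ S → q ∈ C.internal e S ∨ q ∈ O ∨ q ∈ I)
    (hO : ∀ q ∈ O, C.qubitVertex q ∈ S) (hI : ∀ q ∈ I, C.qubitVertex q ∈ S)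
    (hdJ : ∀ q ∈ I, q ∉ C.internal e S) (hdO : ∀ q ∈ I, q ∉ O) (hJO : ∀ q ∈ O, q ∉ C.internal e S)
    (h1 : ∀ q ∈ I, ∀ q' ∈ I, C.qubitPair q = C.qubitPair q' → q = q')
    (h2 : ∀ b, C.blockVertex b ∈ S → ∃ p, C.pairBlock p = b ∧ ∀ q ∈ I, C.qubitPair q ≠ p)
    (h3 : ∀ d : C.Qubit → Bool,
      (∀ q q', C.qubitVertex q ∈ S → C.qubitPair q = C.qubitPair q' → d q = d q') →
      (∀ q ∈ O, d q = false) →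
      (∀ p p', C.pairBlock p = C.pairBlock p' → C.blockVertex (C.pairBlock p) ∈ S →
        (∀ q ∈ I, C.qubitPair q ≠ p ∧ C.qubitPair q ≠ p') →
        C.pairSum e S d p = C.pairSum e S d p') →
      ∀ q, C.qubitVertex q ∈ S → d q = false) :
    C.IsIsometry (C.network e S) {x | C.logicalVertex x ∈ S} I O := by
  classical
  set J := C.internal e S with hJdef
  have hfin := hC.finite_qubits hN hm hS
  have hJ : J.Finite := hfin.subset fun q hq => hq.1
  have hOf : O.Finite := hfin.subset fun q hq => hO q hq
  have := hJ.to_subtype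
  have := hOf.to_subtype
  let _ := Fintype.ofFinite (J → Bool)
  let _ := Fintype.ofFinite (O → Bool)
  obtain ⟨K, hK, hnet⟩ := exists_network_eq hC hN hm e hS
  set cnt : ℕ := (Finset.univ.filter fun z : (O → Bool) × (J → Bool) =>
    C.IsWord S (assign z.1 z.2 fun _ => false) fun _ => false).card with hcnt
  have hcntpos : 0 < cnt := by
    refine Finset.card_pos.2 ⟨(fun _ => false, fun _ => false), ?_⟩
    rw [Finset.mem_filter]
    refine ⟨Finset.mem_univ _, (isWord_congr fun q _ => ?_).2 (isWord_zero S)⟩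
    by_cases h : q ∈ J
    · exact assign_of_mem _ _ _ h
    by_cases h' : q ∈ O
    · exact assign_of_mem_left _ _ _ h h'
    · exact assign_of_notMem_of_notMem _ _ _ h h'
  -- Translation by one word that extends the input `a` with logical indices `l` identifies the
  -- words for zero data with those for `a` and `l`.
  have hcount : ∀ a l, (Finset.univ.filter fun z : (O → Bool) × (J → Bool) =>
      C.IsWord S (assign z.1 z.2 a) l).card = cnt := by
    intro a l
    obtain ⟨y, hy, hya⟩ := exists_isWord hC hm h1 h2 hI a l
    symm
    refine Finset.card_bij (fun z _ => translate O J y z) ?_ ?_ ?_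
    · intro z hz
      rw [Finset.mem_filter] at hz ⊢
      refine ⟨Finset.mem_univ _, ?_⟩
      have h5 := hz.2.xor hC hm hy
      simp only [Bool.false_bne] at h5
      refine (isWord_congr fun q hq => ?_).2 h5
      exact assign_translate hcov y _ a (fun q hq => by simp [hya q hq]) z q hq
    · intro z _ z' _ h; exact (translate O J y).injective h
    · intro z hz
      rw [Finset.mem_filter] at hz
      refine ⟨(translate O J y) z, ?_, ?_⟩
      · rw [Finset.mem_filter]
        refine ⟨Finset.mem_univ _, ?_⟩
        have h5 := hz.2.xor hC hm hy
        simp only [bne_self_eq_false] at h5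
        refine (isWord_congr fun q hq => ?_).2 h5
        exact assign_translate hcov y a _ (fun q hq => by simp [hya q hq]) z q hq
      · refine Prod.ext ?_ ?_ <;> funext k <;> simp [translate, restr]
  refine ⟨K * K * cnt, by positivity, fun a a' l l' => ?_⟩
  rw [finsum_eq_sum_of_fintype]
  -- Here `d` is the difference of the two internal assignments; the outgoing bits agree, and the
  -- inputs differ by `a + a'`.
  set W : (J → Bool) → ℂ := fun d => ∑ z : (O → Bool) × (J → Bool),
    C.weight e S (assign z.1 z.2 a) l *
      C.weight e S (fun q => xor (assign z.1 z.2 a q)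
        (assign (fun _ : O => false) d (fun k => xor (a k) (a' k)) q)) l' with hW
  have hsum : ∑ o : O → Bool, conj (C.network e S (Function.extend Subtype.val o a) l) *
      C.network e S (Function.extend Subtype.val o a') l' = K * K * ∑ d, W d := by
    simp only [hnet, map_mul, Complex.conj_ofReal, map_sum, conj_weight, hW]
    rw [Finset.sum_comm, Fintype.sum_prod_type, Finset.mul_sum]
    refine Finset.sum_congr rfl fun o _ => ?_
    have h5 : ∀ i : J → Bool, ∑ d : J → Bool,
        C.weight e S (fun q => xor (assign o i a q)
          (assign (fun _ : O => false) d (fun k => xor (a k) (a' k)) q)) l' =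
        ∑ j : J → Bool, C.weight e S (assign o j a') l' := by
      intro i
      have hinv : Function.Involutive fun d : J → Bool => fun k => xor (i k) (d k) := by
        intro d; simp
      rw [← Equiv.sum_comp (hinv.toPerm _)]
      refine Finset.sum_congr rfl fun d _ => ?_
      congr 1
      funext q
      rw [← assign_xor]
      have e1 : (fun k => xor (a k) (xor (a k) (a' k))) = a' := by funext k; simp
      have e2 : (fun k => xor (i k) ((hinv.toPerm _) d k)) = d := hinv d
      simp only [e1, e2, Bool.xor_false]
    simp only [← Finset.mul_sum, h5]
    rw [← Finset.sum_mul]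
    change (K : ℂ) * _ * (K * _) = _
    simp only [assign]
    ring
  rw [hsum]
  have hzero : ∀ d, (∃ q, C.qubitVertex q ∈ S ∧
      assign (fun _ : O => false) d (fun k => xor (a k) (a' k)) q ≠ false) → W d = 0 := by
    rintro d ⟨q, hq, hne⟩
    refine sum_weight_eq_zero hC hN hm hS hcov a _ (fun hconst => ?_) l l'
    by_contra hcon
    push Not at hcon
    refine hne (h3 _ hconst (fun q hq => ?_) (fun p p' hb hp hI => ?_) q hq)
    · rw [assign_of_mem_left _ _ _ (hJO q hq) hq]
    · exact hcon p p' hb hI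
  by_cases hA : ∀ q ∈ I, a q = a' q
  · have hD0 : ∀ q, C.qubitVertex q ∈ S → assign (fun _ : O => false) (fun _ : J => false)
        (fun k => xor (a k) (a' k)) q = false := by
      intro q hq
      by_cases h : q ∈ J
      · exact assign_of_mem _ _ _ h
      by_cases h' : q ∈ O
      · exact assign_of_mem_left _ _ _ h h'
      rw [assign_of_notMem_of_notMem _ _ _ h h']
      rcases hcov q hq with h5 | h5 | h5
      · exact absurd h5 h
      · exact absurd h5 h'
      · simp [hA q h5]
    have h5 : ∑ d, W d = W fun _ => false := by
      refine Finset.sum_eq_single _ (fun d _ hd => hzero d ?_) (by simp)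
      obtain ⟨k, hk⟩ := Function.ne_iff.1 hd
      exact ⟨k.1, k.2.1, by rwa [assign_of_mem _ _ _ k.2]⟩
    rw [h5]
    have h6 : W (fun _ => false) = ∑ z : (O → Bool) × (J → Bool),
        if C.IsWord S (assign z.1 z.2 a) l ∧ C.IsWord S (assign z.1 z.2 a) l' then 1 else 0 := by
      refine Finset.sum_congr rfl fun z _ => ?_
      rw [weight_congr (y := assign z.1 z.2 a) (l := l')
        (fun q hq => by rw [hD0 q hq, Bool.xor_false])]
      have h8 : ∀ t, sgn t * sgn t = 1 := by
        intro t; rw [← sgn_add]; rw [CharTwo.add_self_eq_zero, sgn_zero]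
      unfold weight
      by_cases h9 : C.IsWord S (assign z.1 z.2 a) l <;>
        by_cases h10 : C.IsWord S (assign z.1 z.2 a) l' <;> simp [h9, h10, h8]
    rw [h6]
    by_cases hL : ∀ x ∈ {x | C.logicalVertex x ∈ S}, l x = l' x
    · rw [if_pos ⟨hA, hL⟩]
      have h7 : ∀ x, C.IsWord S x l ↔ C.IsWord S x l' := by
        intro x
        refine forall_congr' fun b => forall_congr' fun hb => and_congr_right fun _ => ?_
        rw [hL (C.blockLogical b) hb]
      simp only [← h7, and_self, Finset.sum_boole, hcount]
      push_cast
      ring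
    · rw [if_neg (fun h => hL h.2)]
      rw [Finset.sum_eq_zero, mul_zero]
      intro z _
      rw [if_neg]
      rintro ⟨h7, h8⟩
      exact hL fun x hx => h7.logical_eq h8 x hx
  · rw [if_neg (fun h => hA h.1), Finset.sum_eq_zero, mul_zero]
    intro d _
    push Not at hA
    obtain ⟨q, hq, hne⟩ := hA
    refine hzero d ⟨q, hI q hq, ?_⟩
    rw [assign_of_notMem_of_notMem _ _ _ (hdJ q hq) (hdO q hq)]
    simpa using hne

end Construction

end Honeycomb

/-! ### The linear system in terms of flags -/

namespace Honeycomb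

theorem Pairing.exists_twist (e : Pairing) : ∃ k ∈ legStab, e.twist = r 0 * k := by
  cases e
  · exact ⟨1, one_mem _, (mul_one _).symm⟩
  · exact ⟨(r 2 * r 3) ^ 2, pow_mem (mul_mem (r_mem (by simp)) (r_mem (by simp))) 2, rfl⟩

theorem legStab_le : legStab ≤ vertexStab :=
  Subgroup.closure_mono (by intro x; simp; tauto)

theorem vertexOf_mul {k : Flag} (hk : k ∈ vertexStab) (g : Flag) :
    vertexOf (g * k) = vertexOf g := by
  rw [vertexOf, vertexOf, QuotientGroup.eq]
  simpa using inv_mem hk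

theorem legOf_mul {k : Flag} (hk : k ∈ legStab) (g : Flag) : legOf (g * k) = legOf g := by
  rw [legOf, legOf, QuotientGroup.eq]
  simpa using inv_mem hk

theorem vertexOf_mul_twist (e : Pairing) (g : Flag) :
    vertexOf (g * e.twist) = vertexOf (g * r 0) := by
  obtain ⟨k, hk, h⟩ := e.exists_twist
  rw [h, ← mul_assoc, vertexOf_mul (legStab_le hk)]

/-- The qubits at the flag `g` are read in along a leg in `J`. -/
def Enters (S : Set Vertex) (J : Set Leg) (g : Flag) : Prop :=
  vertexOf g ∈ S ∧ vertexOf (g * r 0) ∉ S ∧ legOf g ∈ J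

/-- The qubits at the flag `g` leave along a leg that is not in `J`. -/
def Leaves (S : Set Vertex) (J : Set Leg) (g : Flag) : Prop :=
  vertexOf g ∈ S ∧ vertexOf (g * r 0) ∉ S ∧ legOf g ∉ J

namespace Construction

variable {C : Construction} {N m : ℕ}

/-- The two qubits of a pair are exchanged by `η`. -/
structure PairedBy (C : Construction) (η : Flag) : Prop where
  mem : η ∈ C.pair
  notMem : η ∉ C.qubit
  cover : ∀ k ∈ C.pair, k ∈ C.qubit ∨ η⁻¹ * k ∈ C.qubit

theorem qubitVertex_mk (g : Flag) : C.qubitVertex (QuotientGroup.mk g) = vertexOf g := rfl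

theorem qubitLeg_mk (g : Flag) : C.qubitLeg (QuotientGroup.mk g) = legOf g := rfl

theorem qubitPair_mk (g : Flag) : C.qubitPair (QuotientGroup.mk g) = QuotientGroup.mk g := rfl

theorem pairBlock_mk (g : Flag) : C.pairBlock (QuotientGroup.mk g) = QuotientGroup.mk g := rfl

theorem HasShape.bonded_iff (hC : C.HasShape N m) (e : Pairing) (g : Flag) (q : C.Qubit) :
    C.Bonded e (QuotientGroup.mk g) q ↔ q = QuotientGroup.mk (g * e.twist) := by
  have h : C.Bonded e (QuotientGroup.mk g) (QuotientGroup.mk (g * e.twist)) := ⟨g, rfl, rfl⟩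
  exact ⟨fun hq => (hC.2.2.2.1 e _).unique hq h, fun hq => hq ▸ h⟩

theorem HasShape.mem_internal (hC : C.HasShape N m) (e : Pairing) (S : Set Vertex) (g : Flag) :
    (QuotientGroup.mk g : C.Qubit) ∈ C.internal e S ↔
      vertexOf g ∈ S ∧ vertexOf (g * r 0) ∈ S := by
  rw [← vertexOf_mul_twist e]
  refine and_congr_right fun _ => ⟨?_, fun h => ⟨_, ⟨g, rfl, rfl⟩, h⟩⟩
  rintro ⟨q', h1, h2⟩
  rw [hC.bonded_iff] at h1
  rwa [h1] at h2

theorem HasShape.mem_external (hC : C.HasShape N m) (e : Pairing) (S : Set Vertex) (g : Flag) :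
    (QuotientGroup.mk g : C.Qubit) ∈ C.external e S ↔
      vertexOf g ∈ S ∧ vertexOf (g * r 0) ∉ S := by
  rw [external, Set.mem_sdiff, hC.mem_internal]
  change vertexOf g ∈ S ∧ _ ↔ _
  tauto

theorem PairedBy.qubitPair_eq {η : Flag} (hη : C.PairedBy η) {g h : Flag} :
    C.qubitPair (QuotientGroup.mk h) = QuotientGroup.mk g ↔
      (QuotientGroup.mk h : C.Qubit) = QuotientGroup.mk g ∨
        (QuotientGroup.mk h : C.Qubit) = QuotientGroup.mk (g * η) := by
  rw [qubitPair_mk, eq_comm, QuotientGroup.eq, eq_comm (b := (QuotientGroup.mk g : C.Qubit)),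
    eq_comm (b := (QuotientGroup.mk (g * η) : C.Qubit)), QuotientGroup.eq, QuotientGroup.eq,
    mul_inv_rev, mul_assoc]
  constructor
  · exact hη.cover _
  · rintro (h1 | h1)
    · exact C.qubit_le_pair h1
    · have := mul_mem hη.mem (C.qubit_le_pair h1)
      simpa using this

/-- The pair of `g` consists of the qubits of `g` and `g * η`. Since `D` is extended by zero outside
`S`, the restriction to internal qubits disappears from the sum. -/
theorem pairSum_mk (hC : C.HasShape N m) {η : Flag} (hη : C.PairedBy η) (e : Pairing)
    (S : Set Vertex) (d : C.Qubit → Bool) {D : Flag → ZMod 2}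
    (hD : ∀ g, D g = open Classical in
      if vertexOf g ∈ S then bit (d (QuotientGroup.mk g)) else 0) (g : Flag) (hg : vertexOf g ∈ S) :
    C.pairSum e S d (QuotientGroup.mk g) = D (g * e.twist) + D (g * η * e.twist) := by
  classical
  have hne : (QuotientGroup.mk g : C.Qubit) ≠ QuotientGroup.mk (g * η) := by
    rw [Ne, QuotientGroup.eq]
    simpa using hη.notMem
  have hgη : vertexOf (g * η) ∈ S := by
    rwa [vertexOf_mul (C.logical_le_vertex (C.block_le_logical (C.pair_le_block hη.mem)))]
  have h1 : {q | q ∈ C.internal e S ∧ C.qubitPair q = QuotientGroup.mk g} =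
      (if vertexOf (g * r 0) ∈ S then {(QuotientGroup.mk g : C.Qubit)} else ∅) ∪
      (if vertexOf (g * η * r 0) ∈ S then {(QuotientGroup.mk (g * η) : C.Qubit)} else ∅) := by
    ext q
    obtain ⟨h, rfl⟩ := QuotientGroup.mk_surjective q
    rw [Set.mem_ofPred_eq, hη.qubitPair_eq]
    constructor
    · rintro ⟨h2, h3 | h3⟩
      · rw [h3, hC.mem_internal] at h2
        left; simp [h2.2, h3]
      · rw [h3, hC.mem_internal] at h2
        right; simp [h2.2, h3]
    · rintro (h2 | h2)
      · split_ifs at h2 with h3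
        · rw [Set.mem_singleton_iff] at h2
          rw [h2, hC.mem_internal]; exact ⟨⟨hg, h3⟩, Or.inl rfl⟩
        · exact absurd h2 (Set.notMem_empty _)
      · split_ifs at h2 with h3
        · rw [Set.mem_singleton_iff] at h2
          rw [h2, hC.mem_internal]; exact ⟨⟨hgη, h3⟩, Or.inr rfl⟩
        · exact absurd h2 (Set.notMem_empty _)
  have hset : ∀ g : Flag, {q' | C.Bonded e (QuotientGroup.mk g) q'} =
      {(QuotientGroup.mk (g * e.twist) : C.Qubit)} := by
    intro g; ext q; exact hC.bonded_iff e g q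
  rw [pairSum, h1, hD, hD, vertexOf_mul_twist, vertexOf_mul_twist, finsum_mem_union]
  · congr 1 <;> split_ifs
    · rw [finsum_mem_singleton, hset, finsum_mem_singleton]
    · exact finsum_mem_empty
    · rw [finsum_mem_singleton, hset, finsum_mem_singleton]
    · exact finsum_mem_empty
  · split_ifs <;> simp [hne]
  · split_ifs <;> simp
  · split_ifs <;> simp

/-- A criterion for isometry in terms of flags. -/
theorem clusterIsometry_of (hC : C.HasShape N m) (hN : 0 < N) (hm : 0 < m) {η : Flag}
    (hη : C.PairedBy η) (e : Pairing) {S : Set Vertex} (hS : S.Finite) (J : Set Leg)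
    (h1 : ∀ g, Enters S J g → ¬ Enters S J (g * η))
    (h2 : ∀ g, vertexOf g ∈ S → ∃ k ∈ C.block, ¬ Enters S J (g * k) ∧ ¬ Enters S J (g * k * η))
    (h3 : ∀ D : Flag → ZMod 2, (∀ g, vertexOf g ∉ S → D g = 0) →
      (∀ g, ∀ k ∈ C.pair, D (g * k) = D g) → (∀ g, Leaves S J g → D g = 0) →
      (∀ g, vertexOf g ∈ S → ∀ k ∈ C.block, ¬ Enters S J g → ¬ Enters S J (g * η) →
        ¬ Enters S J (g * k) → ¬ Enters S J (g * k * η) →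
        D (g * e.twist) + D (g * η * e.twist) = D (g * k * e.twist) + D (g * k * η * e.twist)) →
      ∀ g, D g = 0) :
    C.ClusterIsometry e S J := by
  classical
  have hI : ∀ g : Flag, (QuotientGroup.mk g : C.Qubit) ∈
      {q | q ∈ C.external e S ∧ C.qubitLeg q ∈ J} ↔ Enters S J g := by
    intro g
    rw [Set.mem_ofPred_eq, hC.mem_external, qubitLeg_mk, Enters, and_assoc]
  have hO : ∀ g : Flag, (QuotientGroup.mk g : C.Qubit) ∈
      {q | q ∈ C.external e S ∧ C.qubitLeg q ∉ J} ↔ Leaves S J g := by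
    intro g
    rw [Set.mem_ofPred_eq, hC.mem_external, qubitLeg_mk, Leaves, and_assoc]
  have hpv : ∀ k ∈ C.pair, k ∈ vertexStab := fun k hk =>
    C.logical_le_vertex (C.block_le_logical (C.pair_le_block hk))
  refine isIsometry_network hC hN hm e hS ?_ (fun q hq => hq.1.1) (fun q hq => hq.1.1)
    (fun q hq => hq.1.2) (fun q hq h => h.2 hq.2) (fun q hq => hq.1.2) ?_ ?_ ?_
  · intro q hq
    by_cases h : q ∈ C.internal e S
    · exact Or.inl h
    · by_cases h' : C.qubitLeg q ∈ J
      · exact Or.inr (Or.inr ⟨⟨hq, h⟩, h'⟩)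
      · exact Or.inr (Or.inl ⟨⟨hq, h⟩, h'⟩)
  · intro q hq q' hq' hqq
    obtain ⟨g, rfl⟩ := QuotientGroup.mk_surjective q
    obtain ⟨g', rfl⟩ := QuotientGroup.mk_surjective q'
    rcases hη.qubitPair_eq.1 hqq with h | h
    · exact h
    · have h4 := (hI g').1 hq'
      rw [h, hI] at hq
      exact absurd hq (h1 g' h4)
  · intro b hb
    obtain ⟨g, rfl⟩ := QuotientGroup.mk_surjective b
    obtain ⟨k, hk, h4, h5⟩ := h2 g hb
    refine ⟨QuotientGroup.mk (g * k), ?_, fun q hq hqp => ?_⟩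
    · rw [pairBlock_mk, QuotientGroup.eq]
      simpa using inv_mem hk
    · obtain ⟨g', rfl⟩ := QuotientGroup.mk_surjective q
      rcases hη.qubitPair_eq.1 hqp with h | h
      · rw [h, hI] at hq; exact h4 hq
      · rw [h, hI] at hq; exact h5 hq
  · intro d hd hdO hsum
    set D : Flag → ZMod 2 := fun g => if vertexOf g ∈ S then bit (d (QuotientGroup.mk g)) else 0
      with hD
    have hzero : ∀ g, D g = 0 := by
      refine h3 D (fun g hg => if_neg hg) (fun g k hk => ?_) (fun g hg => ?_) ?_
      · simp only [hD, vertexOf_mul (hpv k hk)]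
        split_ifs with h
        · rw [hd (QuotientGroup.mk (g * k)) (QuotientGroup.mk g)]
          · rwa [qubitVertex_mk, vertexOf_mul (hpv k hk)]
          · rw [qubitPair_mk, qubitPair_mk, QuotientGroup.eq]
            simpa using inv_mem hk
        · rfl
      · simp only [hD]
        rw [if_pos hg.1, hdO _ ((hO g).2 hg)]
        rfl
      · intro g hg k hk h4 h5 h6 h7
        have hgk : vertexOf (g * k) ∈ S := by
          rwa [vertexOf_mul (C.logical_le_vertex (C.block_le_logical hk))]
        rw [← pairSum_mk hC hη e S d (fun _ => rfl) g hg,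
          ← pairSum_mk hC hη e S d (fun _ => rfl) (g * k) hgk]
        refine hsum _ _ ?_ hg fun q hq => ?_
        · rw [pairBlock_mk, pairBlock_mk, QuotientGroup.eq]
          simpa using hk
        · obtain ⟨g', rfl⟩ := QuotientGroup.mk_surjective q
          rw [Ne, Ne, hη.qubitPair_eq, hη.qubitPair_eq]
          constructor
          · rintro (h | h) <;> rw [h, hI] at hq
            exacts [h4 hq, h5 hq]
          · rintro (h | h) <;> rw [h, hI] at hq
            exacts [h6 hq, h7 hq]
    intro q hq
    obtain ⟨g, rfl⟩ := QuotientGroup.mk_surjective q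
    rw [qubitVertex_mk] at hq
    have := hzero g
    simp only [hD] at this
    rw [if_pos hq] at this
    exact bit_injective this

theorem network_singleton (hC : C.HasShape N m) (e : Pairing) (v : Vertex) :
    C.network e {v} = C.vertexTensor v := by
  have hJ : C.internal e {v} = ∅ := by
    ext q
    simp only [internal, Set.mem_ofPred_eq, Set.mem_singleton_iff, Set.mem_empty_iff_false,
      iff_false]
    rintro ⟨h1, q', h2, h3⟩
    exact (hC.2.2.2.2 e q q' h2).2 (h1.trans h3.symm)
  have hB : C.bonds e {v} = ∅ := by
    ext s
    simp only [bonds, Set.mem_ofPred_eq, Set.mem_singleton_iff, Set.mem_empty_iff_false, iff_false]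
    rintro ⟨⟨q, q', h1, rfl⟩, h2⟩
    exact (hC.2.2.2.2 e q q' h1).2 ((h2 q (by simp)).trans (h2 q' (by simp)).symm)
  have : IsEmpty (C.internal e {v}) := by rw [hJ]; infer_instance
  funext a l
  rw [network, finsum_unique, hB]
  have h : ∀ f : C.internal e {v} → Bool, Function.extend Subtype.val f a = a := by
    intro f
    funext q
    exact Function.extend_apply' _ _ _ (by rintro ⟨y, -⟩; exact this.false y)
  rw [h]
  simp only [finprod_mem_singleton, finprod_mem_empty, mul_one]

theorem HasShape.vertexOf_ne (hC : C.HasShape N m) (g : Flag) :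
    vertexOf (g * r 0) ≠ vertexOf g := by
  have := (hC.2.2.2.2 Pairing.mirror (QuotientGroup.mk g) (QuotientGroup.mk (g * r 0))
    ⟨g, rfl, rfl⟩).2
  exact this.symm

/-- A criterion for uniformity of a vertex tensor. -/
theorem vertexIsometry_of (hC : C.HasShape N m) (hN : 0 < N) (hm : 0 < m) {η : Flag}
    (hη : C.PairedBy η) (v : Vertex) (K : Finset Leg)
    (h1 : ∀ g, vertexOf g = v → legOf g ∈ K → legOf (g * η) ∉ K)
    (h2 : ∀ g, vertexOf g = v → ∃ k ∈ C.block, legOf (g * k) ∉ K ∧ legOf (g * k * η) ∉ K) :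
    C.VertexIsometry v K := by
  have hext : ∀ q, q ∈ C.external Pairing.mirror {v} ↔ C.qubitVertex q = v := by
    intro q
    obtain ⟨g, rfl⟩ := QuotientGroup.mk_surjective q
    rw [hC.mem_external, qubitVertex_mk]
    constructor
    · exact fun h => h.1
    · rintro rfl; exact ⟨rfl, hC.vertexOf_ne g⟩
  have hη' : η ∈ vertexStab := C.logical_le_vertex (C.block_le_logical (C.pair_le_block hη.mem))
  -- The choice of the pairing is immaterial, because a single vertex has no internal bonds.
  have h : C.ClusterIsometry Pairing.mirror {v} (K : Set Leg) := by
    refine clusterIsometry_of hC hN hm hη _ (Set.finite_singleton v) _ ?_ ?_ ?_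
    · rintro g ⟨h4, -, h5⟩ ⟨h6, -, h7⟩
      exact h1 g h4 h5 h7
    · intro g hg
      obtain ⟨k, hk, h4, h5⟩ := h2 g hg
      exact ⟨k, hk, fun h => h4 h.2.2, fun h => h5 h.2.2⟩
    · intro D hD0 hDp hDO _ g
      by_cases hg : vertexOf g = v
      · have hl : ∀ g, vertexOf g = v → legOf g ∉ K → D g = 0 := by
          rintro g rfl h
          exact hDO g ⟨rfl, hC.vertexOf_ne g, h⟩
        by_cases h5 : legOf g ∈ K
        · rw [← hDp g η hη.mem]
          exact hl _ ((vertexOf_mul hη' g).trans hg) (h1 g hg h5)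
        · exact hl g hg h5
      · exact hD0 g hg
  rw [ClusterIsometry, network_singleton hC] at h
  simp only [hext, Set.mem_singleton_iff] at h
  exact h

end Construction

end Honeycomb

namespace Honeycomb

/-! ### The faces of the dodecahedron and normal forms of galleries -/

abbrev Face : Type := Fin 12

/-- Adjacency of the faces of the dodecahedron. -/
def adj (a b : Face) : Bool :=
  -- The entry at `a` is the bit mask of the five neighbours of the face `a`; the faces 0, 1, 2 meet
  -- at a vertex.
  Nat.testBit ([230, 397, 339, 2946, 1860, 3265, 1077, 2091, 542, 3352, 2672, 1704].getD a 0) b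

theorem adj_comm : ∀ a b : Face, adj a b = adj b a := by decide +kernel

theorem adj_irrefl : ∀ a : Face, adj a a = false := by decide +kernel

theorem adj_ne {a b : Face} (h : adj a b) : a ≠ b := by
  rintro rfl; simp [adj_irrefl] at h

/-- A stack of cliques of faces, the last clique first. The faces in `T` fix the empty stack. -/
abbrev Stack : Type := List (Finset Face)

variable (T : Finset Face)

/-- The face `a` can be pushed without increasing the length of the stack. -/
def Absorbs (a : Face) : Stack → Prop
  | [] => a ∈ T
  | V :: _ => a ∈ V ∨ ∀ f ∈ V, adj a f

instance (a : Face) : (s : Stack) → Decidable (Absorbs T a s)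
  | [] => inferInstanceAs (Decidable (a ∈ T))
  | V :: _ => inferInstanceAs (Decidable (a ∈ V ∨ ∀ f ∈ V, adj a f))

/-- Crossing the wall of type `a`. -/
def push (a : Face) : Stack → Stack
  | [] => if a ∈ T then [] else [{a}]
  | V :: s =>
    if a ∈ V then (if V = {a} then s else V.erase a :: s)
    else if ∀ f ∈ V, adj a f then (if Absorbs T a s then V :: push a s else insert a V :: s)
    else {a} :: V :: s

def IsClique (V : Finset Face) : Prop := ∀ a ∈ V, ∀ b ∈ V, a ≠ b → adj a b

/-- Cartier–Foata normal form: every face of a clique is kept from sinking further, since it neither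
belongs to the preceding clique nor commutes with all of it (nor, at the bottom, lies in `T`). -/
def Valid : Stack → Prop
  | [] => True
  | V :: s => V.Nonempty ∧ IsClique V ∧ (∀ a ∈ V, ¬ Absorbs T a s) ∧ Valid s

variable {T} {a b : Face} {V : Finset Face} {s : Stack}

theorem push_pop : push T a ({a} :: s) = s := by simp [push]

theorem push_erase (h : a ∈ V) (h' : V ≠ {a}) : push T a (V :: s) = V.erase a :: s := by
  simp [push, h, h']

theorem push_deep (h : a ∉ V) (h' : ∀ f ∈ V, adj a f) (h2 : Absorbs T a s) :
    push T a (V :: s) = V :: push T a s := by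
  simp only [push, h, if_false, if_pos h', h2, if_true]

theorem push_insert (h : a ∉ V) (h' : ∀ f ∈ V, adj a f) (h2 : ¬ Absorbs T a s) :
    push T a (V :: s) = insert a V :: s := by
  simp only [push, h, if_false, if_pos h', h2]

theorem push_of_not_absorbs (h : ¬ Absorbs T a s) : push T a s = {a} :: s := by
  cases s with
  | nil => simpa [push, Absorbs] using h
  | cons V s =>
    simp only [Absorbs, not_or] at h
    simp only [push, h.1, if_false, if_neg h.2]

theorem IsClique.erase (h : IsClique V) : IsClique (V.erase a) := fun x hx y hy =>
  h x (Finset.mem_of_mem_erase hx) y (Finset.mem_of_mem_erase hy)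

theorem IsClique.insert (h : IsClique V) (h' : ∀ f ∈ V, adj a f) : IsClique (insert a V) := by
  intro x hx y hy hxy
  rw [Finset.mem_insert] at hx hy
  rcases hx with rfl | hx <;> rcases hy with rfl | hy
  · exact absurd rfl hxy
  · exact h' y hy
  · rw [adj_comm]; exact h' x hx
  · exact h x hx y hy hxy

theorem erase_nonempty (h : a ∈ V) (h' : V ≠ {a}) : (V.erase a).Nonempty := by
  rw [Finset.nonempty_iff_ne_empty, Ne, Finset.erase_eq_empty_iff]
  rintro (rfl | h2)
  · simp at h
  · exact h' h2

/-- A face commuting with everything involved stays unabsorbed when another one is pushed. -/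
theorem not_absorbs_push (hab : adj a b) (ha : Absorbs T a s) (hb : ¬ Absorbs T b s) :
    ¬ Absorbs T b (push T a s) := by
  cases s with
  | nil =>
    have : a ∈ T := ha
    simpa [push, this] using hb
  | cons W u =>
    simp only [Absorbs, not_or, not_forall] at hb
    obtain ⟨hbW, w, hw, hbw⟩ := hb
    have hwa : w ≠ a := by
      rintro rfl
      exact hbw (by rw [adj_comm]; exact hab)
    have hba : b ≠ a := (adj_ne hab).symm
    have key : ∀ W' : Finset Face, w ∈ W' → b ∉ W' → ∀ u', ¬ Absorbs T b (W' :: u') := by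
      intro W' h1 h2 u' h3
      rcases h3 with h3 | h3
      · exact h2 h3
      · exact hbw (h3 w h1)
    by_cases haW : a ∈ W
    · have hW : W ≠ {a} := by
        rintro rfl
        exact hwa (by simpa using hw)
      rw [push_erase haW hW]
      exact key _ (Finset.mem_erase.2 ⟨hwa, hw⟩) (fun h => hbW (Finset.mem_of_mem_erase h)) _
    · have h' : ∀ f ∈ W, adj a f := ha.resolve_left haW
      by_cases h2 : Absorbs T a u
      · rw [push_deep haW h' h2]; exact key _ hw hbW _
      · rw [push_insert haW h' h2]
        exact key _ (Finset.mem_insert_of_mem hw) (by simp [hba, hbW]) _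

/-- The neighbour `x` of `a` that is not absorbed shows that the last clique is not `{a}`. Pushing
`a` then changes the last clique at most in `a`, which is adjacent to `b`. -/
theorem absorbs_push (hab : adj a b) (hs : ∃ x, adj a x ∧ ¬ Absorbs T x s)
    (ha : Absorbs T a s) (hb : Absorbs T b s) :
    Absorbs T b (push T a s) := by
  cases s with
  | nil =>
    have : a ∈ T := ha
    simpa [push, this] using hb
  | cons W u =>
    obtain ⟨x, hax, hx⟩ := hs
    simp only [Absorbs, not_or, not_forall] at hx
    obtain ⟨hxW, w, hw, hxw⟩ := hx
    have hwa : w ≠ a := by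
      rintro rfl
      exact hxw (by rw [adj_comm]; exact hax)
    have hba : b ≠ a := (adj_ne hab).symm
    by_cases haW : a ∈ W
    · have hW : W ≠ {a} := by
        rintro rfl
        exact hwa (by simpa using hw)
      rw [push_erase haW hW]
      rcases hb with hb | hb
      · exact Or.inl (Finset.mem_erase.2 ⟨hba, hb⟩)
      · exact Or.inr fun f hf => hb f (Finset.mem_of_mem_erase hf)
    · have h' : ∀ f ∈ W, adj a f := ha.resolve_left haW
      by_cases h2 : Absorbs T a u
      · rw [push_deep haW h' h2]; exact hb
      · rw [push_insert haW h' h2]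
        rcases hb with hb | hb
        · exact Or.inl (Finset.mem_insert_of_mem hb)
        · refine Or.inr fun f hf => ?_
          rcases Finset.mem_insert.1 hf with rfl | hf
          · rw [adj_comm]; exact hab
          · exact hb f hf

/-- An absorbed face, adjacent to all of a clique that is not absorbed, stays absorbed after having
been pushed. -/
theorem absorbs_push_self (hs : ∃ x, adj a x ∧ ¬ Absorbs T x s) (hv : Valid T s)
    (ha : Absorbs T a s) : Absorbs T a (push T a s) := by
  cases s with
  | nil =>
    have : a ∈ T := ha
    simpa [push, this] using ha
  | cons W u =>
    obtain ⟨x, hax, hx⟩ := hs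
    simp only [Absorbs, not_or, not_forall] at hx
    obtain ⟨hxW, w, hw, hxw⟩ := hx
    have hwa : w ≠ a := by
      rintro rfl
      exact hxw (by rw [adj_comm]; exact hax)
    by_cases haW : a ∈ W
    · have hW : W ≠ {a} := by
        rintro rfl
        exact hwa (by simpa using hw)
      rw [push_erase haW hW]
      exact Or.inr fun f hf => hv.2.1 a haW f (Finset.mem_of_mem_erase hf)
        (Finset.ne_of_mem_erase hf).symm
    · have h' : ∀ f ∈ W, adj a f := ha.resolve_left haW
      by_cases h2 : Absorbs T a u
      · rw [push_deep haW h' h2]; exact ha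
      · rw [push_insert haW h' h2]; exact Or.inl (Finset.mem_insert_self _ _)

theorem Valid.exists_not_absorbs (hv : Valid T (V :: s)) (h' : ∀ f ∈ V, adj a f) :
    ∃ x, adj a x ∧ ¬ Absorbs T x s := by
  obtain ⟨x, hx⟩ := hv.1
  exact ⟨x, h' x hx, hv.2.2.1 x hx⟩

theorem Valid.push (hv : Valid T s) (a : Face) : Valid T (push T a s) := by
  induction s with
  | nil =>
    by_cases h : a ∈ T
    · simp [Honeycomb.push, h, Valid]
    · simp [Honeycomb.push, h, Valid, IsClique, Absorbs]
  | cons V s ih =>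
    by_cases haV : a ∈ V
    · by_cases hV : V = {a}
      · subst hV; rw [push_pop]; exact hv.2.2.2
      · rw [push_erase haV hV]
        exact ⟨erase_nonempty haV hV, hv.2.1.erase,
          fun x hx => hv.2.2.1 x (Finset.mem_of_mem_erase hx), hv.2.2.2⟩
    by_cases h' : ∀ f ∈ V, adj a f
    · by_cases h2 : Absorbs T a s
      · rw [push_deep haV h' h2]
        exact ⟨hv.1, hv.2.1, fun x hx => not_absorbs_push (h' x hx) h2 (hv.2.2.1 x hx),
          ih hv.2.2.2⟩
      · rw [push_insert haV h' h2]
        refine ⟨Finset.insert_nonempty _ _, hv.2.1.insert h', ?_, hv.2.2.2⟩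
        intro x hx
        rcases Finset.mem_insert.1 hx with rfl | hx
        · exact h2
        · exact hv.2.2.1 x hx
    · have h3 : ¬ Absorbs T a (V :: s) := by rintro (h | h); exacts [haV h, h' h]
      rw [push_of_not_absorbs h3]
      exact ⟨Finset.singleton_nonempty _, by simp [IsClique], by simpa using h3, hv⟩

theorem push_push (hv : Valid T s) (a : Face) : push T a (push T a s) = s := by
  induction s with
  | nil =>
    by_cases h : a ∈ T
    · simp [push, h]
    · simp [push, h]
  | cons V s ih =>
    by_cases haV : a ∈ V
    · by_cases hV : V = {a}
      · subst hV; rw [push_pop]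
        exact push_of_not_absorbs (hv.2.2.1 a (by simp))
      · rw [push_erase haV hV, push_insert (by simp) _ (hv.2.2.1 a haV), Finset.insert_erase haV]
        intro f hf
        exact hv.2.1 a haV f (Finset.mem_of_mem_erase hf) (Finset.ne_of_mem_erase hf).symm
    by_cases h' : ∀ f ∈ V, adj a f
    · by_cases h2 : Absorbs T a s
      · rw [push_deep haV h' h2, push_deep haV h', ih hv.2.2.2]
        exact absorbs_push_self (hv.exists_not_absorbs h') hv.2.2.2 h2
      · rw [push_insert haV h' h2, push_erase (by simp), Finset.erase_insert haV]
        intro h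
        obtain ⟨x, hx⟩ := hv.1
        have : x ∈ ({a} : Finset Face) := h ▸ Finset.mem_insert_of_mem hx
        rw [Finset.mem_singleton] at this
        exact haV (this ▸ hx)
    · have h3 : ¬ Absorbs T a (V :: s) := by rintro (h | h); exacts [haV h, h' h]
      rw [push_of_not_absorbs h3, push_pop]

/-- The face `b` opens a new clique, and `a`, which commutes with `b`, passes underneath it. -/
theorem push_comm_aux (hab : adj a b) (ha : ∀ f ∈ V, f ≠ a → adj a f)
    (hb : b ∉ V) (hb' : ¬ ∀ f ∈ V, adj b f) :
    push T a (push T b (V :: s)) = push T b (push T a (V :: s)) := by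
  have hnb : ¬ Absorbs T b (V :: s) := by rintro (h | h); exacts [hb h, hb' h]
  have haa : Absorbs T a (V :: s) := by
    by_cases h : a ∈ V
    · exact Or.inl h
    · exact Or.inr fun f hf => ha f hf (by rintro rfl; exact h hf)
  have hab' := (adj_ne hab)
  rw [push_of_not_absorbs hnb, push_deep (by simpa using hab') (by simpa using hab) haa,
    push_of_not_absorbs (not_absorbs_push hab haa hnb)]

/-- Apart from cancellations and insertions in the last clique, the only recursive case is that both
faces pass below it; absorption of each one is then unaffected by the other, and induction applies
to the tail. -/
theorem push_comm (hv : Valid T s) (hab : adj a b) :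
    push T a (push T b s) = push T b (push T a s) := by
  have hba : adj b a := by rw [adj_comm]; exact hab
  have hne := adj_ne hab
  induction s generalizing a b with
  | nil =>
    by_cases h : a ∈ T <;> by_cases h2 : b ∈ T <;>
      simp [push, h, h2, hab, hba, hne, hne.symm, Absorbs, Finset.pair_comm]
  | cons V s ih =>
    have hcl := hv.2.1
    have clique : ∀ {x}, x ∈ V → ∀ f ∈ V, f ≠ x → adj x f := fun hx f hf h => hcl _ hx f hf h.symm
    by_cases haV : a ∈ V
    · by_cases hbV : b ∈ V
      · have hVa : V ≠ {a} := by rintro rfl; exact hne (by simpa using hbV : b = a).symm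
        have hVb : V ≠ {b} := by rintro rfl; exact hne (by simpa using haV)
        rw [push_erase haV hVa, push_erase hbV hVb]
        by_cases h : V.erase b = {a}
        · have h2 : V.erase a = {b} := by
            ext x
            have := Finset.ext_iff.1 h x
            simp only [Finset.mem_erase, Finset.mem_singleton] at this ⊢
            constructor
            · rintro ⟨h1, h2⟩
              by_contra h3
              exact h1 (this.1 ⟨h3, h2⟩)
            · rintro rfl; exact ⟨hne.symm, hbV⟩
          rw [h, h2, push_pop, push_pop]
        · have h2 : V.erase a ≠ {b} := by
            intro h2
            apply h
            ext x
            have := Finset.ext_iff.1 h2 x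
            simp only [Finset.mem_erase, Finset.mem_singleton] at this ⊢
            constructor
            · rintro ⟨h1, h2⟩
              by_contra h3
              exact h1 (this.1 ⟨h3, h2⟩)
            · rintro rfl; exact ⟨hne, haV⟩
          rw [push_erase (Finset.mem_erase.2 ⟨hne, haV⟩) h,
            push_erase (Finset.mem_erase.2 ⟨hne.symm, hbV⟩) h2, Finset.erase_right_comm]
      · by_cases hb' : ∀ f ∈ V, adj b f
        · by_cases hb2 : Absorbs T b s
          · rw [push_deep hbV hb' hb2]
            by_cases hV : V = {a}
            · subst hV; rw [push_pop, push_pop]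
            · rw [push_erase haV hV, push_erase haV hV, push_deep _ _ hb2]
              · simp [hbV]
              · exact fun f hf => hb' f (Finset.mem_of_mem_erase hf)
          · rw [push_insert hbV hb' hb2, push_erase (Finset.mem_insert_of_mem haV)]
            · by_cases hV : V = {a}
              · subst hV
                rw [push_pop, push_of_not_absorbs hb2]
                congr 1
                ext x
                simp only [Finset.mem_erase, Finset.mem_insert, Finset.mem_singleton]
                constructor
                · rintro ⟨h1, h2 | h2⟩ <;> [exact h2; exact absurd h2 h1]
                · rintro rfl; exact ⟨hne.symm, Or.inl rfl⟩
              · rw [push_erase haV hV, push_insert _ _ hb2, Finset.erase_insert_of_ne hne.symm]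
                · simp [hbV]
                · exact fun f hf => hb' f (Finset.mem_of_mem_erase hf)
            · intro h
              have : b ∈ ({a} : Finset Face) := h ▸ Finset.mem_insert_self _ _
              exact hne (by simpa using this : b = a).symm
        · exact push_comm_aux hab (clique haV) hbV hb'
    by_cases ha' : ∀ f ∈ V, adj a f
    swap
    · by_cases h : ∀ f ∈ V, f ≠ b → adj b f
      · exact (push_comm_aux hba h haV ha').symm
      · have hbV : b ∉ V := fun h2 => h (clique h2)
        have hb' : ¬ ∀ f ∈ V, adj b f := fun h2 => h fun f hf _ => h2 f hf
        have h3 : ¬ Absorbs T a (V :: s) := by rintro (h | h); exacts [haV h, ha' h]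
        have h4 : ¬ Absorbs T b (V :: s) := by rintro (h | h); exacts [hbV h, hb' h]
        rw [push_of_not_absorbs h3, push_of_not_absorbs h4,
          push_insert (by simpa using hne) (by simpa using hab) h3,
          push_insert (by simpa using hne.symm) (by simpa using hba) h4, Finset.pair_comm]
    by_cases hbV : b ∈ V
    · by_cases ha2 : Absorbs T a s
      · rw [push_deep haV ha' ha2]
        by_cases hV : V = {b}
        · subst hV; rw [push_pop, push_pop]
        · rw [push_erase hbV hV, push_erase hbV hV, push_deep _ _ ha2]
          · simp [haV]
          · exact fun f hf => ha' f (Finset.mem_of_mem_erase hf)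
      · rw [push_insert haV ha' ha2, push_erase (Finset.mem_insert_of_mem hbV)]
        · by_cases hV : V = {b}
          · subst hV
            rw [push_pop, push_of_not_absorbs ha2]
            congr 1
            ext x
            simp only [Finset.mem_erase, Finset.mem_insert, Finset.mem_singleton]
            constructor
            · rintro rfl; exact ⟨hne, Or.inl rfl⟩
            · rintro ⟨h1, h2 | h2⟩ <;> [exact h2; exact absurd h2 h1]
          · rw [push_erase hbV hV, push_insert _ _ ha2, Finset.erase_insert_of_ne hne]
            · simp [haV]
            · exact fun f hf => ha' f (Finset.mem_of_mem_erase hf)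
        · intro h
          have : a ∈ ({b} : Finset Face) := h ▸ Finset.mem_insert_self _ _
          exact hne (by simpa using this)
    by_cases hb' : ∀ f ∈ V, adj b f
    swap
    · exact push_comm_aux hab (fun f hf _ => ha' f hf) hbV hb'
    have hex := hv.exists_not_absorbs ha'
    have hex' := hv.exists_not_absorbs hb'
    by_cases ha2 : Absorbs T a s <;> by_cases hb2 : Absorbs T b s
    · rw [push_deep haV ha' ha2, push_deep hbV hb' hb2,
        push_deep haV ha' (absorbs_push hba hex' hb2 ha2),
        push_deep hbV hb' (absorbs_push hab hex ha2 hb2), ih hv.2.2.2 hab hba hne]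
    · rw [push_deep haV ha' ha2, push_insert hbV hb' hb2,
        push_insert hbV hb' (not_absorbs_push hab ha2 hb2), push_deep _ _ ha2]
      · simp [hne, haV]
      · simpa [hab] using ha'
    · rw [push_deep hbV hb' hb2, push_insert haV ha' ha2,
        push_insert haV ha' (not_absorbs_push hba hb2 ha2), push_deep _ _ hb2]
      · simp [hne.symm, hbV]
      · simpa [hba] using hb'
    · rw [push_insert haV ha' ha2, push_insert hbV hb' hb2, push_insert _ _ ha2,
        push_insert _ _ hb2, Finset.insert_comm]
      · simp [hne.symm, hbV]
      · simpa [hba] using hb'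
      · simp [hne, haV]
      · simpa [hab] using ha'

end Honeycomb

namespace Honeycomb

/-! ### Flags of the dodecahedron and the action on normal forms -/

/-- The third face at the other end of the edge between the faces `a` and `b`. -/
def other (a b c : Face) : Face :=
  ((List.finRange 12).find? fun d => adj a d && adj b d && (d != c)).getD 0

/-- A flag of the dodecahedron: the face `a`, its edge with `b` and the vertex on `a`, `b`, `c`. -/
abbrev Tri : Type :=
  {t : Face × Face × Face // adj t.1 t.2.1 && adj t.1 t.2.2 && adj t.2.1 t.2.2}

theorem tri_other : ∀ a b c : Face, adj a b → adj a c → adj b c →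
    adj a (other a b c) = true ∧ adj b (other a b c) = true ∧ other a b (other a b c) = c ∧
      other a b c ≠ c ∧ adj c (other a b c) = false := by
  decide +kernel

namespace Tri

def a (t : Tri) : Face := t.1.1
def b (t : Tri) : Face := t.1.2.1
def c (t : Tri) : Face := t.1.2.2

theorem ab (t : Tri) : adj t.a t.b := by
  have := t.2; simp only [Bool.and_eq_true] at this; exact this.1.1

theorem ac (t : Tri) : adj t.a t.c := by
  have := t.2; simp only [Bool.and_eq_true] at this; exact this.1.2

theorem bc (t : Tri) : adj t.b t.c := by
  have := t.2; simp only [Bool.and_eq_true] at this; exact this.2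

/-- The adjacent flags inside one dodecahedron. The last generator does nothing here, because a
neighbouring cell is labelled through the reflection in the common wall. -/
def flip (t : Tri) : Fin 4 → Tri
  | 0 => ⟨(t.a, t.b, other t.a t.b t.c), by
      have := tri_other _ _ _ t.ab t.ac t.bc
      simp [this, t.ab]⟩
  | 1 => ⟨(t.a, t.c, t.b), by simp [t.ab, t.ac, adj_comm t.c t.b, t.bc]⟩
  | 2 => ⟨(t.b, t.a, t.c), by simp [adj_comm t.b t.a, t.ab, t.ac, t.bc]⟩
  | 3 => t

def base : Tri := ⟨(0, 1, 2), by decide⟩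

end Tri

theorem flip_flip : ∀ (i : Fin 4) (t : Tri), (t.flip i).flip i = t := by decide +kernel

theorem flip_rel : ∀ (i j : Fin 4) (t : Tri),
    (fun x : Tri => (x.flip j).flip i)^[schlaefli.M i j] t = t := by
  decide +kernel

variable (T : Finset Face)

/-- The action of the generators on normal forms and flags of the dodecahedron. -/
def gen (i : Fin 4) : Equiv.Perm ({s : Stack // Valid T s} × Tri) :=
  Function.Involutive.toPerm
    (fun x => (if i = 3 then ⟨push T x.2.a x.1.1, x.1.2.push _⟩ else x.1, x.2.flip i)) (by
      rintro ⟨⟨s, hs⟩, t⟩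
      by_cases h : i = 3
      · subst h
        simp [Tri.flip, push_push hs]
      · simp [h, flip_flip])

theorem gen_apply (i : Fin 4) (x : {s : Stack // Valid T s} × Tri) :
    gen T i x = (if i = 3 then ⟨push T x.2.a x.1.1, x.1.2.push _⟩ else x.1, x.2.flip i) := rfl

theorem gen_mul_pow (i j : Fin 4) (hi : i ≠ 3) (hj : j ≠ 3) : (gen T i * gen T j) ^ schlaefli.M i j = 1 := by
  ext1 x
  have : ∀ n : ℕ, ((gen T i * gen T j) ^ n) x = (x.1, (fun y : Tri => (y.flip j).flip i)^[n] x.2) := by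
    intro n
    induction n with
    | zero => rfl
    | succ n ih =>
      rw [pow_succ', Equiv.Perm.mul_apply, ih, Function.iterate_succ_apply', Equiv.Perm.mul_apply,
        gen_apply, gen_apply]
      simp [hi, hj]
  rw [this, flip_rel]; rfl

theorem gen_sq (i : Fin 4) : gen T i * gen T i = 1 := by
  ext1 x
  exact Function.Involutive.toPerm_involutive _ x

/-- Relations without the last generator are finite checks on the flags of the dodecahedron. Those
with it follow from `push_push`, and the relation of order four also needs `push_comm`. -/
theorem gen_liftable : schlaefli.IsLiftable (gen T) := by
  have key : ∀ i j : Fin 4, i ≤ j → (gen T i * gen T j) ^ schlaefli.M i j = 1 := by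
    intro i j hij
    by_cases hj : j = 3
    swap
    · exact gen_mul_pow T i j (by rintro rfl; omega) hj
    subst hj
    ext1 ⟨⟨s, hs⟩, t⟩
    have hab := t.ab
    fin_cases i
    · have : schlaefli.M 0 3 = 2 := rfl
      simp [this, pow_succ, gen_apply, Tri.flip, push_push hs, Tri.a, Tri.b, Tri.c]
      have := congrArg Subtype.val (flip_flip 0 t)
      exact Subtype.ext this
    · have : schlaefli.M 1 3 = 2 := rfl
      simp [this, pow_succ, gen_apply, Tri.flip, push_push hs, Tri.a, Tri.b, Tri.c]
    · have : schlaefli.M 2 3 = 4 := rfl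
      simp [this, pow_succ, gen_apply, Tri.flip, Tri.a, Tri.b, Tri.c]
      change push T t.b (push T t.a (push T t.b (push T t.a s))) = s
      rw [← push_comm hs hab, push_push (hs.push t.b), push_push hs]
    · change ((gen T 3 * gen T 3) ^ 1) _ = _
      rw [pow_one]
      exact DFunLike.congr_fun (gen_sq T 3) _
  intro i j
  rcases le_total i j with h | h
  · exact key i j h
  · have h1 := key j i h
    rw [schlaefli.symmetric] at h1
    have h2 : gen T i * gen T j = (gen T j * gen T i)⁻¹ := by
      rw [mul_inv_rev]
      congr 1
    rw [h2, inv_pow, h1, inv_one]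

def actHom : Flag →* Equiv.Perm ({s : Stack // Valid T s} × Tri) :=
  schlaefli.toCoxeterSystem.lift ⟨gen T, gen_liftable T⟩

theorem r_sq (i : Fin 4) : r i * r i = 1 := schlaefli.toCoxeterSystem.simple_mul_simple_self i

theorem r_inv (i : Fin 4) : (r i)⁻¹ = r i := schlaefli.toCoxeterSystem.inv_simple i

theorem actHom_r (i : Fin 4) : actHom T (r i) = gen T i :=
  schlaefli.toCoxeterSystem.lift_apply_simple _ i

/-- The state of a flag relative to the base flag. -/
def state (g : Flag) : {s : Stack // Valid T s} × Tri :=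
  -- The inverse makes right multiplication of `g` by a generator act on the state as that
  -- generator.
  actHom T g⁻¹ (⟨[], trivial⟩, Tri.base)

/-- The normal form of the cell of a flag. -/
def st (g : Flag) : Stack := (state T g).1.1

theorem st_valid (g : Flag) : Valid T (st T g) := (state T g).1.2

theorem state_mul_r (g : Flag) (i : Fin 4) : state T (g * r i) = gen T i (state T g) := by
  rw [state, mul_inv_rev, r_inv, map_mul, actHom_r]; rfl

theorem state_snd (g : Flag) : (state T g).2 = (state ∅ g).2 := by
  refine schlaefli.toCoxeterSystem.simple_induction_right (p := fun g => (state T g).2 = (state ∅ g).2)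
    g ?_ ?_
  · simp [state]
  · intro g i h
    have := state_mul_r T g i
    have := state_mul_r ∅ g i
    simp only [r] at *
    simp only [schlaefli.toCoxeterSystem_simple, *, gen_apply]

/-- The flag of the dodecahedron that corresponds to a flag. -/
def tr (g : Flag) : Tri := (state ∅ g).2

theorem st_one : st T 1 = [] := by simp [st, state]

theorem tr_one : tr 1 = Tri.base := by simp [tr, state]

theorem tr_mul_r (g : Flag) (i : Fin 4) : tr (g * r i) = (tr g).flip i := by
  rw [tr, state_mul_r]; rfl

theorem st_mul_r (g : Flag) {i : Fin 4} (hi : i ≠ 3) : st T (g * r i) = st T g := by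
  rw [st, state_mul_r, gen_apply]; simp [hi, st]

theorem st_mul_r3 (g : Flag) : st T (g * r 3) = push T (tr g).a (st T g) := by
  rw [st, state_mul_r, gen_apply, state_snd]; simp [tr, st]

theorem flag_induction {p : Flag → Prop} (g : Flag) (one : p 1) (mul : ∀ g i, p g → p (g * r i)) :
    p g :=
  schlaefli.toCoxeterSystem.simple_induction_right g one mul

end Honeycomb

namespace Honeycomb

/-! ### Words in the generators -/

abbrev Word : Type := List (Fin 4)

/-- The product of a word. -/
def wd (w : Word) : Flag := (w.map r).prod

theorem wd_nil : wd [] = 1 := rfl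

theorem wd_cons (i : Fin 4) (w : Word) : wd (i :: w) = r i * wd w := List.prod_cons

theorem wd_append (v w : Word) : wd (v ++ w) = wd v * wd w := by simp [wd]

theorem wd_singleton (i : Fin 4) : wd [i] = r i := by simp [wd]

theorem wd_reverse (w : Word) : wd w.reverse = (wd w)⁻¹ := by
  induction w with
  | nil => simp [wd]
  | cons i w ih => rw [List.reverse_cons, wd_append, ih, wd_singleton, wd_cons, mul_inv_rev, r_inv]

/-- The action of a word on states. -/
def run (T : Finset Face) (x : Stack × Tri) (w : Word) : Stack × Tri :=
  w.foldl (fun x i => (if i = 3 then push T x.2.a x.1 else x.1, x.2.flip i)) x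

theorem st_tr_mul_wd (T : Finset Face) (g : Flag) (w : Word) :
    (st T (g * wd w), tr (g * wd w)) = run T (st T g, tr g) w := by
  induction w generalizing g with
  | nil => simp [wd_nil, run]
  | cons i w ih =>
    rw [wd_cons, ← mul_assoc, ih, run, run, List.foldl_cons, tr_mul_r]
    congr 2
    by_cases hi : i = 3
    · subst hi; simp [st_mul_r3]
    · simp [hi, st_mul_r T g hi]

theorem st_mul_wd (T : Finset Face) (g : Flag) (w : Word) :
    st T (g * wd w) = (run T (st T g, tr g) w).1 := by rw [← st_tr_mul_wd]

theorem tr_mul_wd (g : Flag) (w : Word) : tr (g * wd w) = w.foldl Tri.flip (tr g) := by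
  induction w generalizing g with
  | nil => simp [wd_nil]
  | cons i w ih => rw [wd_cons, ← mul_assoc, ih, tr_mul_r, List.foldl_cons]

/-- A set of words closed under multiplication by generators exhausts the subgroup. -/
theorem closure_words {s : Set Flag} (G L : List Word) (hs : ∀ y ∈ s, ∃ x ∈ G, y = wd x)
    (h1 : [] ∈ L) (hL : ∀ w ∈ L, ∀ x ∈ G, ∃ w' ∈ L, wd (w ++ x) = wd w')
    (hL' : ∀ w ∈ L, ∀ x ∈ G, ∃ w' ∈ L, wd (w ++ x.reverse) = wd w')
    {k : Flag} (hk : k ∈ Subgroup.closure s) : ∃ w ∈ L, k = wd w := by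
  induction hk using Subgroup.closure_induction_right with
  | one => exact ⟨[], h1, rfl⟩
  | mul_right x hx y hy ih =>
    obtain ⟨w, hw, rfl⟩ := ih
    obtain ⟨z, hz, rfl⟩ := hs y hy
    obtain ⟨w', hw', h⟩ := hL w hw z hz
    exact ⟨w', hw', by rw [← h, wd_append]⟩
  | mul_inv_cancel x hx y hy ih =>
    obtain ⟨w, hw, rfl⟩ := ih
    obtain ⟨z, hz, rfl⟩ := hs y hy
    obtain ⟨w', hw', h⟩ := hL' w hw z hz
    exact ⟨w', hw', by rw [← h, wd_append, wd_reverse]⟩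

theorem wd_pow (v : Word) (n : ℕ) : wd (List.replicate n v).flatten = wd v ^ n := by
  induction n with
  | zero => simp [wd]
  | succ n ih => rw [List.replicate_succ, List.flatten_cons, wd_append, ih, pow_succ']

theorem r_mul_pow (i j : Fin 4) : (r i * r j) ^ schlaefli.M i j = 1 :=
  schlaefli.toCoxeterSystem.simple_mul_simple_pow i j

theorem wd_braid {i j : Fin 4} : ∀ {v w : Word}, w ++ v.reverse =
    (List.replicate (schlaefli.M i j) [i, j]).flatten → wd w = wd v := by
  intro v w h
  have h1 := wd_pow [i, j] (schlaefli.M i j)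
  rw [← h, wd_append, wd_reverse] at h1
  have h2 : wd [i, j] = r i * r j := by simp [wd]
  rw [h2, r_mul_pow] at h1
  exact mul_inv_eq_one.1 h1

/-! ### The stabilizer of a cell -/

/-- A complete rewriting system for the symmetry group of the dodecahedron. -/
def rules : List (Word × Word) :=
  [([0, 0], []), ([1, 1], []), ([2, 2], []), ([2, 0], [0, 2]), ([2, 1, 2], [1, 2, 1]),
   ([2, 1, 0, 2], [1, 2, 1, 0]), ([1, 0, 1, 0, 1], [0, 1, 0, 1, 0]),
   ([2, 1, 0, 1, 2, 1], [1, 2, 1, 0, 1, 2]),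
   ([2, 1, 0, 1, 0, 2, 1, 0, 1, 0], [1, 2, 1, 0, 1, 0, 2, 1, 0, 1])]

theorem wd_congr (w x : Word) {u v : Word} (h : wd u = wd v) :
    wd (w ++ (u ++ x)) = wd (w ++ (v ++ x)) := by
  simp [wd_append, h]

/-- Three of the rules are not Coxeter relations; they are derived from them by explicit chains of
replacements. -/
theorem rules_sound : ∀ p ∈ rules, wd p.1 = wd p.2 := by
  have h20 : wd [2, 0] = wd [0, 2] := wd_braid (i := 2) (j := 0) (by decide)
  have h212 : wd [2, 1, 2] = wd [1, 2, 1] := wd_braid (i := 2) (j := 1) (by decide)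
  have h10 : wd [1, 0, 1, 0, 1] = wd [0, 1, 0, 1, 0] := wd_braid (i := 1) (j := 0) (by decide)
  have h00 : wd [0, 0] = wd [] := by simp [wd, r_sq]
  have h2102 : wd [2, 1, 0, 2] = wd [1, 2, 1, 0] :=
    ((wd_congr [2, 1] [] h20.symm :)).trans ((wd_congr [] [0] h212 :))
  simp only [rules, List.forall_mem_cons, List.not_mem_nil, false_imp_iff, implies_true, and_true]
  refine ⟨h00, by simp [wd, r_sq], by simp [wd, r_sq], h20, h212, h2102, h10, ?_, ?_⟩
  · exact ((wd_congr [2, 1, 0] [] h212.symm :)).trans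
      ((wd_congr [] [1, 2] h2102 :))
  · calc wd [2, 1, 0, 1, 0, 2, 1, 0, 1, 0]
        = wd [2, 1, 0, 1, 0, 2, 0, 0, 1, 0, 1, 0] :=
          (wd_congr [2, 1, 0, 1, 0, 2] [1, 0, 1, 0] h00.symm :)
      _ = wd [2, 1, 0, 1, 0, 2, 0, 1, 0, 1, 0, 1] :=
          (wd_congr [2, 1, 0, 1, 0, 2, 0] [] h10.symm :)
      _ = wd [2, 1, 0, 1, 0, 0, 2, 1, 0, 1, 0, 1] :=
          (wd_congr [2, 1, 0, 1, 0] [1, 0, 1, 0, 1] h20 :)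
      _ = wd [2, 1, 0, 1, 2, 1, 0, 1, 0, 1] :=
          (wd_congr [2, 1, 0, 1] [2, 1, 0, 1, 0, 1] h00 :)
      _ = wd [2, 1, 0, 2, 1, 2, 0, 1, 0, 1] :=
          (wd_congr [2, 1, 0] [0, 1, 0, 1] h212.symm :)
      _ = wd [1, 2, 1, 0, 1, 2, 0, 1, 0, 1] :=
          (wd_congr [] [1, 2, 0, 1, 0, 1] h2102 :)
      _ = wd [1, 2, 1, 0, 1, 0, 2, 1, 0, 1] :=
          (wd_congr [1, 2, 1, 0, 1] [1, 0, 1] h20 :)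

/-- Apply the first applicable rule. -/
def rewriteStep : Word → Word
  | [] => []
  | i :: w =>
    match rules.find? fun p => p.1.isPrefixOf (i :: w) with
    | some p => p.2 ++ (i :: w).drop p.1.length
    | none => i :: rewriteStep w

theorem wd_rewriteStep (w : Word) : wd (rewriteStep w) = wd w := by
  induction w with
  | nil => rfl
  | cons i w ih =>
    rw [rewriteStep]
    split
    · next p hp =>
      have h1 := List.mem_of_find?_eq_some hp
      have h2 := List.find?_some hp
      obtain ⟨x, hx⟩ := List.isPrefixOf_iff_prefix.1 h2
      rw [← hx, List.drop_left, wd_append, wd_append, rules_sound p h1]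
    · rw [wd_cons, ih, wd_cons]

theorem wd_iterate_rewriteStep (n : ℕ) (w : Word) : wd (rewriteStep^[n] w) = wd w := by
  induction n with
  | zero => rfl
  | succ n ih => rw [Function.iterate_succ_apply', wd_rewriteStep, ih]

/-- The 120 elements of the symmetry group of the dodecahedron. -/
def cellWords : List Word :=
  [[], [0], [1], [0, 1], [1, 0], [0, 1, 0], [1, 0, 1], [0, 1, 0, 1], [1, 0, 1, 0],
    [0, 1, 0, 1, 0]].flatMap fun u =>
  [[], [2], [2, 1], [2, 1, 0], [2, 1, 0, 1], [2, 1, 0, 1, 0], [2, 1, 0, 1, 2], [2, 1, 0, 1, 0, 2],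
    [2, 1, 0, 1, 0, 2, 1], [2, 1, 0, 1, 0, 2, 1, 0], [2, 1, 0, 1, 0, 2, 1, 0, 1],
    [2, 1, 0, 1, 0, 2, 1, 0, 1, 2]].map fun v => u ++ v

/-- Eight rounds of rewriting bring every extended word back into the list. This bounds the
stabilizer from above before its elements are known to be distinct. -/
theorem cellWords_closed : ∀ w ∈ cellWords, ∀ x ∈ [[0], [1], [2]],
    (rewriteStep^[8] (w ++ x)) ∈ cellWords := by
  decide +kernel

theorem mem_cellStab {g : Flag} (hg : g ∈ cellStab) : ∃ w ∈ cellWords, g = wd w := by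
  have hc : ∀ w ∈ cellWords, ∀ x ∈ [[0], [1], [2]], ∃ w' ∈ cellWords, wd (w ++ x) = wd w' :=
    fun w hw x hx => ⟨_, cellWords_closed w hw x hx, (wd_iterate_rewriteStep _ _).symm⟩
  refine closure_words [[0], [1], [2]] cellWords ?_ (by decide) hc ?_ hg
  · rintro y (rfl | rfl | rfl)
    exacts [⟨[0], by simp, (wd_singleton 0).symm⟩, ⟨[1], by simp, (wd_singleton 1).symm⟩,
      ⟨[2], by simp, (wd_singleton 2).symm⟩]
  · intro w hw x hx
    refine hc w hw _ ?_
    simp only [List.mem_cons, List.not_mem_nil, or_false] at hx ⊢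
    rcases hx with rfl | rfl | rfl <;> simp

theorem cellWords_free : ∀ w ∈ cellWords, w.foldl Tri.flip Tri.base = Tri.base → w = [] := by
  decide +kernel

theorem tr_mul_left (g h : Flag) : tr (g * h) = (actHom ∅ h⁻¹ (⟨[], trivial⟩, tr g)).2 := by
  induction h using flag_induction with
  | one => simp [tr]
  | mul h i ih =>
    rw [← mul_assoc, tr_mul_r, ih, mul_inv_rev, r_inv, map_mul, actHom_r, Equiv.Perm.mul_apply,
      gen_apply]

/-- The flag of a product depends on the first factor only through its own flag, so it suffices that
no nontrivial element of the stabilizer fixes the base flag; this is inspected on the 120 words. -/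
theorem tr_inj {g h : Flag} (hg : g ∈ cellStab) (hh : h ∈ cellStab) (e : tr g = tr h) : g = h := by
  have h1 : tr (g * h⁻¹) = tr (h * h⁻¹) := by rw [tr_mul_left, tr_mul_left, e]
  rw [mul_inv_cancel, tr_one] at h1
  obtain ⟨w, hw, hw'⟩ := mem_cellStab (mul_mem hg (inv_mem hh))
  rw [hw', ← one_mul (wd w), tr_mul_wd, tr_one] at h1
  rw [cellWords_free w hw h1, wd_nil] at hw'
  exact mul_inv_eq_one.1 hw'

theorem exists_tr : ∀ t : Tri, ∃ w ∈ cellWords, w.foldl Tri.flip Tri.base = t := by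
  decide +kernel

end Honeycomb

namespace Honeycomb

/-! ### Faithfulness of the normal form -/

/-- The symmetry of the base cell that moves the base flag to a given one. -/
def cellElt (t : Tri) : Flag := wd (exists_tr t).choose

theorem tr_cellElt (t : Tri) : tr (cellElt t) = t := by
  rw [cellElt, ← one_mul (wd _), tr_mul_wd, tr_one]
  exact (exists_tr t).choose_spec.2

theorem cellWords_letters : ∀ w ∈ cellWords, ∀ i ∈ w, i ≠ 3 := by decide +kernel

theorem r_mem_cellStab {i : Fin 4} (hi : i ≠ 3) : r i ∈ cellStab := by
  refine r_mem ?_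
  fin_cases i <;> simp_all

theorem wd_mem_cellStab {w : Word} (h : ∀ i ∈ w, i ≠ 3) : wd w ∈ cellStab := by
  induction w with
  | nil => exact one_mem _
  | cons i w ih =>
    rw [wd_cons]
    exact mul_mem (r_mem_cellStab (h i (by simp))) (ih fun j hj => h j (by simp [hj]))

theorem cellElt_mem (t : Tri) : cellElt t ∈ cellStab :=
  wd_mem_cellStab (cellWords_letters _ (exists_tr t).choose_spec.1)

theorem cellElt_tr {g : Flag} (hg : g ∈ cellStab) : cellElt (tr g) = g :=
  tr_inj (cellElt_mem _) hg (tr_cellElt _)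

theorem cellElt_mul_r (t : Tri) {i : Fin 4} (hi : i ≠ 3) :
    cellElt t * r i = cellElt (t.flip i) := by
  rw [← cellElt_tr (mul_mem (cellElt_mem t) (r_mem_cellStab hi)), tr_mul_r, tr_cellElt]

theorem cellElt_mul_wd (t : Tri) {w : Word} (h : ∀ i ∈ w, i ≠ 3) :
    cellElt t * wd w = cellElt (w.foldl Tri.flip t) := by
  rw [← cellElt_tr (mul_mem (cellElt_mem t) (wd_mem_cellStab h)), tr_mul_wd, tr_cellElt]

theorem cellElt_base : cellElt Tri.base = 1 := by
  rw [← tr_one, cellElt_tr (one_mem _)]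

theorem r_comm_of_eq_two {i j : Fin 4} (h : schlaefli.M i j = 2) : r i * r j = r j * r i := by
  have h1 := r_mul_pow i j
  rw [h, pow_two] at h1
  rw [eq_inv_of_mul_eq_one_left h1, mul_inv_rev, r_inv, r_inv]

theorem wd_comm_r3 {w : Word} (h : ∀ i ∈ w, i = 0 ∨ i = 1) : wd w * r 3 = r 3 * wd w := by
  induction w with
  | nil => simp [wd_nil]
  | cons i w ih =>
    have hi : r i * r 3 = r 3 * r i := by
      rcases h i (by simp) with rfl | rfl <;> exact r_comm_of_eq_two rfl
    rw [wd_cons, mul_assoc, ih fun j hj => h j (by simp [hj]), ← mul_assoc, hi, mul_assoc]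

theorem exists_word_of_a_eq : ∀ t t' : Tri, t.a = t'.a →
    ∃ w ∈ ([[], [0], [1], [0, 1], [1, 0], [0, 1, 0], [1, 0, 1], [0, 1, 0, 1], [1, 0, 1, 0],
      [0, 1, 0, 1, 0]] : List Word), w.foldl Tri.flip t = t' := by
  decide +kernel

theorem exists_tri : ∀ a : Face, ∃ t : Tri, t.a = a := by decide +kernel

/-- The reflection in a wall of the base cell. -/
def wall (a : Face) : Flag :=
  cellElt (exists_tri a).choose * r 3 * (cellElt (exists_tri a).choose)⁻¹

/-- Flags with the same face differ by the generators 0 and 1, which commute with `r 3`; the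
conjugate therefore depends on the face alone. -/
theorem wall_a (t : Tri) : wall t.a = cellElt t * r 3 * (cellElt t)⁻¹ := by
  obtain ⟨w, hw, h⟩ := exists_word_of_a_eq t _ (exists_tri t.a).choose_spec.symm
  have hl : ∀ i ∈ w, i = 0 ∨ i = 1 := by
    have : ∀ w ∈ ([[], [0], [1], [0, 1], [1, 0], [0, 1, 0], [1, 0, 1], [0, 1, 0, 1], [1, 0, 1, 0],
      [0, 1, 0, 1, 0]] : List Word), ∀ i ∈ w, i = 0 ∨ i = 1 := by decide
    exact this w hw
  have h3 : ∀ i ∈ w, i ≠ 3 := by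
    intro i hi
    rcases hl i hi with rfl | rfl <;> decide
  rw [wall, ← h, ← cellElt_mul_wd t h3, mul_inv_rev, mul_assoc (cellElt t), wd_comm_r3 hl]
  group

theorem wall_mul_cellElt (t : Tri) : wall t.a * cellElt t = cellElt t * r 3 := by
  rw [wall_a]; group

theorem wall_sq (a : Face) : wall a * wall a = 1 := by
  rw [wall]
  simp [mul_assoc, r_sq, ← mul_assoc (r 3) (r 3)]

theorem exists_tri_of_adj : ∀ a b : Face, adj a b → ∃ t : Tri, t.a = a ∧ t.b = b := by
  decide +kernel

/-- Right dihedral angles: `r 3` and its conjugate by `r 2` commute because `r 3 * r 2` has fourth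
power one. -/
theorem wall_comm {a b : Face} (h : adj a b) : wall a * wall b = wall b * wall a := by
  obtain ⟨t, rfl, rfl⟩ := exists_tri_of_adj a b h
  have hb : wall t.b = cellElt t * (r 2 * r 3 * r 2) * (cellElt t)⁻¹ := by
    change wall (t.flip 2).a = _
    rw [wall_a, ← cellElt_mul_r t (by decide), mul_inv_rev, r_inv]
    group
  have h4 := r_mul_pow 3 2
  rw [show schlaefli.M 3 2 = 4 from rfl] at h4
  have h5 : r 3 * (r 2 * r 3 * r 2) * (r 3 * (r 2 * r 3 * r 2)) = 1 := by
    rw [← h4]; simp only [pow_succ, pow_zero, one_mul, mul_assoc]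
  have h6 : r 3 * (r 2 * r 3 * r 2) = (r 2 * r 3 * r 2) * r 3 := by
    rw [eq_inv_of_mul_eq_one_left h5]
    simp only [mul_inv_rev, r_inv, mul_assoc]
  calc wall t.a * wall t.b = cellElt t * (r 3 * (r 2 * r 3 * r 2)) * (cellElt t)⁻¹ := by
        rw [wall_a, hb]; group
    _ = wall t.b * wall t.a := by rw [h6, wall_a, hb]; group

/-- The product of the reflections in the walls of a clique. -/
def cliqueProd (V : Finset Face) : Flag :=
  ((List.finRange 12).map fun a => if a ∈ V then wall a else 1).prod

theorem prod_map_mul_of_commute {G : Type*} [Monoid G] {l : List Face} (hl : l.Nodup)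
    {f f' : Face → G} {a : Face} {x : G} (ha : a ∈ l) (h1 : f' a = f a * x)
    (h2 : ∀ b ≠ a, f' b = f b) (h3 : ∀ b ≠ a, Commute (f b) x) :
    (l.map f').prod = (l.map f).prod * x := by
  induction l with
  | nil => simp at ha
  | cons b l ih =>
    rw [List.nodup_cons] at hl
    rw [List.map_cons, List.prod_cons, List.map_cons, List.prod_cons]
    rcases List.mem_cons.1 ha with rfl | ha
    · have h4 : l.map f' = l.map f := List.map_congr_left fun b hb =>
        h2 b (by rintro rfl; exact hl.1 hb)
      have h5 : Commute (l.map f).prod x := Commute.list_prod_left _ _ fun y hy => by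
        obtain ⟨b, hb, rfl⟩ := List.mem_map.1 hy
        exact h3 b (by rintro rfl; exact hl.1 hb)
      rw [h4, h1, mul_assoc, mul_assoc, h5.eq]
    · have hb : b ≠ a := by rintro rfl; exact hl.1 ha
      rw [h2 b hb, ih hl.2 ha, mul_assoc]

theorem cliqueProd_insert {V : Finset Face} {a : Face} (ha : a ∉ V) (h : ∀ f ∈ V, adj a f) :
    cliqueProd (insert a V) = cliqueProd V * wall a := by
  refine prod_map_mul_of_commute (List.nodup_finRange _) (List.mem_finRange a) (by simp [ha])
    (fun b hb => by simp [hb]) fun b hb => ?_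
  by_cases hbV : b ∈ V
  · simp only [hbV, if_true]
    exact (wall_comm (h b hbV)).symm
  · simp [hbV]

theorem cliqueProd_empty : cliqueProd ∅ = 1 := by
  simp [cliqueProd]

theorem cliqueProd_singleton (a : Face) : cliqueProd {a} = wall a := by
  rw [← insert_empty_eq, cliqueProd_insert (by simp) (by simp), cliqueProd_empty, one_mul]

theorem cliqueProd_erase {V : Finset Face} {a : Face} (ha : a ∈ V) (h : IsClique V) :
    cliqueProd V * wall a = cliqueProd (V.erase a) := by
  have h1 := cliqueProd_insert (V := V.erase a) (a := a) (by simp) fun f hf =>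
    h a ha f (Finset.mem_of_mem_erase hf) (Finset.ne_of_mem_erase hf).symm
  rw [Finset.insert_erase ha] at h1
  rw [h1, mul_assoc, wall_sq, mul_one]

theorem cliqueProd_comm {V : Finset Face} {a : Face} (h : ∀ f ∈ V, adj a f) :
    cliqueProd V * wall a = wall a * cliqueProd V := by
  refine (Commute.list_prod_left _ _ fun y hy => ?_).eq
  obtain ⟨b, -, rfl⟩ := List.mem_map.1 hy
  by_cases hb : b ∈ V
  · simp only [hb, if_true]
    exact (wall_comm (h b hb)).symm
  · simp [hb]

/-- The product of the reflections along a stack. -/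
def stackProd : Stack → Flag
  | [] => 1
  | V :: s => stackProd s * cliqueProd V

variable (T : Finset Face)

/-- The group generated by the reflections of types in `T`. -/
def wallGroup : Subgroup Flag := Subgroup.closure (wall '' T)

/-- Each case of `push` is a cancellation or a commutation of reflections. A left factor arises only
when a face of `T` sinks to the bottom of the stack. -/
theorem stackProd_mul_wall {s : Stack} (hs : Valid T s) (a : Face) :
    ∃ u ∈ wallGroup T, stackProd s * wall a = u * stackProd (push T a s) := by
  induction s with
  | nil =>
    by_cases h : a ∈ T
    · exact ⟨wall a, Subgroup.subset_closure ⟨a, h, rfl⟩, by simp [push, h, stackProd]⟩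
    · exact ⟨1, one_mem _, by simp [push, h, stackProd, cliqueProd_singleton]⟩
  | cons V s ih =>
    by_cases haV : a ∈ V
    · refine ⟨1, one_mem _, ?_⟩
      by_cases hV : V = {a}
      · subst hV
        rw [push_pop, stackProd, cliqueProd_singleton, mul_assoc, wall_sq]; simp
      · rw [push_erase haV hV, stackProd, mul_assoc, cliqueProd_erase haV hs.2.1, one_mul]
        rfl
    by_cases h' : ∀ f ∈ V, adj a f
    · by_cases h2 : Absorbs T a s
      · obtain ⟨u, hu, h⟩ := ih hs.2.2.2
        refine ⟨u, hu, ?_⟩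
        rw [push_deep haV h' h2, stackProd, stackProd, mul_assoc, cliqueProd_comm h', ← mul_assoc, h,
          mul_assoc]
      · refine ⟨1, one_mem _, ?_⟩
        rw [push_insert haV h' h2, stackProd, stackProd, cliqueProd_insert haV h', one_mul,
          mul_assoc]
    · refine ⟨1, one_mem _, ?_⟩
      have h3 : ¬ Absorbs T a (V :: s) := by rintro (h | h); exacts [haV h, h' h]
      rw [push_of_not_absorbs h3, one_mul, ← cliqueProd_singleton a]
      rfl

/-- The decomposition into wall reflections and a symmetry of the base cell. It shows that the state
determines a flag up to left multiplication by `wallGroup T`. -/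
theorem exists_eq_mul_stackProd (g : Flag) :
    ∃ u ∈ wallGroup T, g = u * stackProd (st T g) * cellElt (tr g) := by
  induction g using flag_induction with
  | one => exact ⟨1, one_mem _, by simp [st_one, tr_one, stackProd, cellElt_base]⟩
  | mul g i ih =>
    obtain ⟨u, hu, h⟩ := ih
    by_cases hi : i = 3
    · subst hi
      obtain ⟨v, hv, h2⟩ := stackProd_mul_wall T (st_valid T g) (tr g).a
      refine ⟨u * v, mul_mem hu hv, ?_⟩
      have h3 : (tr g).flip 3 = tr g := rfl
      rw [st_mul_r3, tr_mul_r, h3, mul_assoc u, ← h2, mul_assoc, mul_assoc, wall_mul_cellElt,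
        ← mul_assoc, ← mul_assoc, ← h]
    · refine ⟨u, hu, ?_⟩
      rw [st_mul_r T g hi, tr_mul_r, ← cellElt_mul_r _ hi, ← mul_assoc, ← h]

theorem st_tr_injective {g h : Flag} (h1 : st ∅ g = st ∅ h) (h2 : tr g = tr h) : g = h := by
  have h0 : wallGroup ∅ = ⊥ := by simp [wallGroup]
  obtain ⟨u, hu, hg⟩ := exists_eq_mul_stackProd ∅ g
  obtain ⟨v, hv, hh⟩ := exists_eq_mul_stackProd ∅ h
  rw [h0, Subgroup.mem_bot] at hu hv
  rw [hg, hh, hu, hv, h1, h2]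

/-- The code of a word determines its product. -/
def code (w : Word) : Stack × Tri := run ∅ ([], Tri.base) w

theorem code_eq (w : Word) : (st ∅ (wd w), tr (wd w)) = code w := by
  have := st_tr_mul_wd ∅ 1 w
  rwa [one_mul, st_one, tr_one] at this

/-- This solves the word problem of the group, so that incidences between explicitly given flags can
be decided by evaluation. -/
theorem wd_eq_iff {v w : Word} : wd v = wd w ↔ code v = code w := by
  rw [← code_eq, ← code_eq]
  constructor
  · intro h; rw [h]
  · intro h
    rw [Prod.mk.injEq] at h
    exact st_tr_injective h.1 h.2

end Honeycomb

namespace Honeycomb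

/-! ### Subgroups of the stabilizer of a vertex -/

/-- The products of the words of two lists. -/
def mulWords (A B : List Word) : List Word := A.flatMap fun u => B.map fun v => u ++ v

/-- A list of words is closed under right multiplication by the words of `G`. -/
def closedUnder (G L : List Word) : Bool :=
  let K := L.map code
  K.contains (code []) && L.all fun w => G.all fun x =>
    K.contains (code (w ++ x)) && K.contains (code (w ++ x.reverse))

theorem exists_word_of_closedUnder {s : Set Flag} (G L : List Word)
    (hs : ∀ y ∈ s, ∃ x ∈ G, y = wd x) (hL : closedUnder G L = true) {k : Flag}
    (hk : k ∈ Subgroup.closure s) : ∃ w ∈ L, k = wd w := by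
  have hmem : ∀ w, (L.map code).contains (code w) = true → ∃ w' ∈ L, wd w = wd w' := by
    intro w hw
    rw [List.contains_iff_mem, List.mem_map] at hw
    obtain ⟨w', h1, h2⟩ := hw
    exact ⟨w', h1, wd_eq_iff.2 h2.symm⟩
  simp only [closedUnder, Bool.and_eq_true, List.all_eq_true] at hL
  induction hk using Subgroup.closure_induction_right with
  | one => obtain ⟨w, h, h'⟩ := hmem _ hL.1; exact ⟨w, h, h'⟩
  | mul_right x hx y hy ih =>
    obtain ⟨w, hw, rfl⟩ := ih
    obtain ⟨z, hz, rfl⟩ := hs y hy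
    obtain ⟨w', hw', h⟩ := hmem _ (hL.2 w hw z hz).1
    exact ⟨w', hw', by rw [← h, wd_append]⟩
  | mul_inv_cancel x hx y hy ih =>
    obtain ⟨w, hw, rfl⟩ := ih
    obtain ⟨z, hz, rfl⟩ := hs y hy
    obtain ⟨w', hw', h⟩ := hmem _ (hL.2 w hw z hz).2
    exact ⟨w', hw', by rw [← h, wd_append, wd_reverse]⟩

theorem ncard_fiber {H K : Subgroup Flag} (f : Flag ⧸ H → Flag ⧸ K)
    (hf : ∀ g : Flag, f (QuotientGroup.mk g) = QuotientGroup.mk g) {LH LK : List Word}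
    (R : List Word) (hH : ∀ k ∈ H, ∃ w ∈ LH, k = wd w) (hK : ∀ k ∈ K, ∃ w ∈ LK, k = wd w)
    (hH' : ∀ w ∈ LH, wd w ∈ H) (hR' : ∀ w ∈ R, wd w ∈ K)
    (h1 : (LK.all fun k => R.any fun w => (LH.map code).contains (code (w.reverse ++ k))) = true)
    (h2 : (R.Pairwise fun v w => ¬ (LH.map code).contains (code (v.reverse ++ w)) = true))
    (v : Flag ⧸ K) : {b | f b = v}.ncard = R.length := by
  classical
  obtain ⟨g, rfl⟩ := QuotientGroup.mk_surjective v
  have h3 : {b | f b = QuotientGroup.mk g} =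
      ((R.map fun w => (QuotientGroup.mk (g * wd w) : Flag ⧸ H)).toFinset : Set (Flag ⧸ H)) := by
    ext b
    obtain ⟨x, rfl⟩ := QuotientGroup.mk_surjective b
    simp only [Set.mem_ofPred_eq, hf, List.coe_toFinset, List.mem_map]
    constructor
    · intro h
      rw [eq_comm, QuotientGroup.eq] at h
      obtain ⟨k, hk, hkx⟩ := hK _ h
      rw [List.all_eq_true] at h1
      obtain ⟨w, hw, hwk⟩ := List.any_eq_true.1 (h1 k hk)
      refine ⟨w, hw, ?_⟩
      rw [List.contains_iff_mem, List.mem_map] at hwk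
      obtain ⟨y, hy, hyk⟩ := hwk
      rw [← wd_eq_iff, wd_append, wd_reverse, ← hkx] at hyk
      rw [QuotientGroup.eq]
      have := hH' y hy
      rw [hyk] at this
      simpa [mul_assoc] using this
    · rintro ⟨w, hw, h⟩
      rw [← hf x, ← h, hf, QuotientGroup.eq]
      simpa using inv_mem (hR' w hw)
  rw [h3, Set.ncard_coe_finset, List.toFinset_card_of_nodup, List.length_map]
  refine List.Pairwise.map _ (fun a b hab => ?_) h2
  intro h
  apply hab
  rw [QuotientGroup.eq] at h
  obtain ⟨y, hy, hyk⟩ := hH _ h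
  rw [List.contains_iff_mem, List.mem_map]
  refine ⟨y, hy, ?_⟩
  rw [← wd_eq_iff, ← hyk, wd_append, wd_reverse]
  group

abbrev antipodeWord : Word := [1, 2, 3, 1, 2, 3, 1, 2, 3]

theorem antipode_eq : antipode = wd antipodeWord := by
  simp [antipode, wd, pow_succ, mul_assoc]

theorem hexAntipode_eq : hexAntipode = wd [1, 2, 1] := by
  simp [hexAntipode, wd, mul_assoc]

def hexWords : List Word := [[], [1], [2], [1, 2], [2, 1], [1, 2, 1]]

def legWords : List Word := mulWords [[], [2]] (mulWords [[], [3]] [[], [2, 3, 2]])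

/-- The 48 symmetries of the octahedron: the eight products of the three commuting reflections in
the walls at the vertex, times the six permutations of these walls. -/
def vertexWords : List Word :=
  mulWords (mulWords [[], [3]] (mulWords [[], [2, 3, 2]] [[], [1, 2, 3, 2, 1]])) hexWords

theorem mem_vertexStab {k : Flag} (hk : k ∈ vertexStab) : ∃ w ∈ vertexWords, k = wd w := by
  refine exists_word_of_closedUnder [[1], [2], [3]] _ ?_ (by decide +kernel) hk
  rintro y (rfl | rfl | rfl)
  exacts [⟨[1], by simp, by simp [wd]⟩, ⟨[2], by simp, by simp [wd]⟩, ⟨[3], by simp, by simp [wd]⟩]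

theorem mem_legStab {k : Flag} (hk : k ∈ legStab) : ∃ w ∈ legWords, k = wd w := by
  refine exists_word_of_closedUnder [[2], [3]] _ ?_ (by decide +kernel) hk
  rintro y (rfl | rfl)
  exacts [⟨[2], by simp, by simp [wd]⟩, ⟨[3], by simp, by simp [wd]⟩]

end Honeycomb

/-! ### Twists, and the shapes of the five constructions -/

namespace Honeycomb

theorem legStab_comm_r0 {k : Flag} (hk : k ∈ legStab) : k * r 0 = r 0 * k := by
  have h : legStab ≤ Subgroup.centralizer {r 0} := by
    rw [legStab, Subgroup.closure_le]
    rintro x (rfl | rfl) <;> rw [SetLike.mem_coe, Subgroup.mem_centralizer_singleton_iff]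
    · exact r_comm_of_eq_two rfl
    · exact r_comm_of_eq_two rfl
  exact Subgroup.mem_centralizer_singleton_iff.1 (h hk)

theorem Pairing.twist_eq (e : Pairing) :
    e.twist = wd (match e with
      | .mirror => [0]
      | .inversion => [0, 2, 3, 2, 3]) := by
  cases e <;> simp [Pairing.twist, wd, pow_succ, mul_assoc]

theorem Pairing.twist_mul_twist (e : Pairing) : e.twist * e.twist = 1 := by
  cases e <;> rw [Pairing.twist_eq, ← wd_append, ← wd_nil, wd_eq_iff] <;> decide +kernel

/-- This makes the matching of qubits across an edge independent of the flag that represents the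
qubit. -/
theorem legStab_comm_twist (e : Pairing) {k : Flag} (hk : k ∈ legStab) :
    k * e.twist = e.twist * k := by
  have h : legStab ≤ Subgroup.centralizer {e.twist} := by
    rw [legStab, Subgroup.closure_le]
    rintro x (rfl | rfl) <;> rw [SetLike.mem_coe, Subgroup.mem_centralizer_singleton_iff]
    · cases e <;> rw [Pairing.twist_eq, ← wd_singleton, ← wd_append, ← wd_append, wd_eq_iff] <;>
        decide +kernel
    · cases e <;> rw [Pairing.twist_eq, ← wd_singleton, ← wd_append, ← wd_append, wd_eq_iff] <;>
        decide +kernel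
  exact Subgroup.mem_centralizer_singleton_iff.1 (h hk)

theorem r0_notMem : r 0 ∉ vertexStab := by
  intro h
  obtain ⟨w, hw, h⟩ := mem_vertexStab h
  rw [← wd_singleton, wd_eq_iff] at h
  have : ∀ w ∈ vertexWords, code [0] ≠ code w := by decide +kernel
  exact this w hw h

theorem vertexOf_mul_r0_ne (g : Flag) : vertexOf (g * r 0) ≠ vertexOf g := by
  rw [vertexOf, vertexOf, Ne, eq_comm, QuotientGroup.eq]
  simpa using r0_notMem

theorem wd_mem_mulWords {H : Subgroup Flag} {A B : List Word} (hA : ∀ w ∈ A, wd w ∈ H)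
    (hB : ∀ w ∈ B, wd w ∈ H) : ∀ w ∈ mulWords A B, wd w ∈ H := by
  intro w hw
  simp only [mulWords, List.mem_flatMap, List.mem_map] at hw
  obtain ⟨u, hu, v, hv, rfl⟩ := hw
  rw [wd_append]
  exact mul_mem (hA u hu) (hB v hv)

theorem wd_mem_pair {H : Subgroup Flag} {w : Word} (h : wd w ∈ H) :
    ∀ x ∈ [[], w], wd x ∈ H := by
  intro x hx
  simp only [List.mem_cons, List.not_mem_nil, or_false] at hx
  rcases hx with rfl | rfl
  · exact one_mem _
  · exact h

theorem wd_mem_of_letters {H : Subgroup Flag} (G : List (Fin 4)) (hG : ∀ i ∈ G, r i ∈ H)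
    {L : List Word} (hL : ∀ w ∈ L, ∀ i ∈ w, i ∈ G) : ∀ w ∈ L, wd w ∈ H := by
  intro w hw
  have : ∀ i ∈ w, r i ∈ H := fun i hi => hG i (hL w hw i hi)
  clear hw
  induction w with
  | nil => exact one_mem _
  | cons i w ih =>
    rw [wd_cons]
    exact mul_mem (this i (by simp)) (ih fun j hj => this j (by simp [hj]))

theorem wd_mem_vertexStab : ∀ w ∈ vertexWords, wd w ∈ vertexStab :=
  wd_mem_of_letters [1, 2, 3] (by
    intro i hi
    simp only [List.mem_cons, List.not_mem_nil, or_false] at hi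
    rcases hi with rfl | rfl | rfl <;> exact r_mem (by simp)) (by decide +kernel)

/-- The words of `R` represent the cosets of the words of `LH` in the words of `LK`. -/
def isTransversal (LH LK R : List Word) : Bool :=
  (R.all fun w => LK.contains w) &&
  (LK.all fun k => R.any fun w => (LH.map code).contains (code (w.reverse ++ k))) &&
  decide (R.Pairwise fun v w => ¬ (LH.map code).contains (code (v.reverse ++ w)) = true)

theorem ncard_fiber_of_isTransversal {H K : Subgroup Flag} (f : Flag ⧸ H → Flag ⧸ K)
    (hf : ∀ g : Flag, f (QuotientGroup.mk g) = QuotientGroup.mk g) {LH LK : List Word}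
    (R : List Word) (hH : ∀ k ∈ H, ∃ w ∈ LH, k = wd w) (hK : ∀ k ∈ K, ∃ w ∈ LK, k = wd w)
    (hH' : ∀ w ∈ LH, wd w ∈ H) (hK' : ∀ w ∈ LK, wd w ∈ K) (hR : isTransversal LH LK R = true)
    (v : Flag ⧸ K) : {b | f b = v}.ncard = R.length := by
  simp only [isTransversal, Bool.and_eq_true, decide_eq_true_eq] at hR
  refine ncard_fiber f hf R hH hK hH' (fun w hw => hK' w ?_) hR.1.2 hR.2 v
  exact List.contains_iff_mem.1 (List.all_eq_true.1 hR.1.1 w hw)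

namespace Construction

variable {C : Construction}

theorem hasShape_of {LQ LP LB : List Word} (RB RP RQ : List Word)
    (hQ : ∀ k ∈ C.qubit, ∃ w ∈ LQ, k = wd w) (hQ' : ∀ w ∈ LQ, wd w ∈ C.qubit)
    (hP : ∀ k ∈ C.pair, ∃ w ∈ LP, k = wd w) (hP' : ∀ w ∈ LP, wd w ∈ C.pair)
    (hB : ∀ k ∈ C.block, ∃ w ∈ LB, k = wd w) (hB' : ∀ w ∈ LB, wd w ∈ C.block)
    (h1 : isTransversal LB vertexWords RB = true) (h2 : isTransversal LP LB RP = true)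
    (h3 : isTransversal LQ LP RQ = true) (hRQ : RQ.length = 2) :
    C.HasShape RB.length RP.length := by
  refine ⟨ncard_fiber_of_isTransversal _ (fun _ => rfl) RB hB (fun k => mem_vertexStab) hB'
      wd_mem_vertexStab h1, ncard_fiber_of_isTransversal _ (fun _ => rfl) RP hP hB hP' hB' h2,
    fun p => (ncard_fiber_of_isTransversal _ (fun _ => rfl) RQ hQ hP hQ' hP' h3 p).trans hRQ,
    fun e q => ?_, ?_⟩
  · obtain ⟨g, rfl⟩ := QuotientGroup.mk_surjective q
    refine ⟨QuotientGroup.mk (g * e.twist), ⟨g, rfl, rfl⟩, ?_⟩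
    rintro q' ⟨g', h, rfl⟩
    rw [QuotientGroup.eq] at h ⊢
    have h4 := legStab_comm_twist e (C.qubit_le_leg (inv_mem h))
    have h5 : (g' * e.twist)⁻¹ * (g * e.twist) = (g⁻¹ * g')⁻¹ := by
      calc (g' * e.twist)⁻¹ * (g * e.twist) = (e.twist)⁻¹ * ((g⁻¹ * g')⁻¹ * e.twist) := by group
        _ = (g⁻¹ * g')⁻¹ := by rw [h4]; group
    rw [h5]
    exact inv_mem h
  · rintro e q q' ⟨g, rfl, rfl⟩
    refine ⟨⟨g * e.twist, rfl, ?_⟩, ?_⟩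
    · rw [mul_assoc, e.twist_mul_twist, mul_one]
    · rw [qubitVertex_mk, qubitVertex_mk, vertexOf_mul_twist]
      exact (vertexOf_mul_r0_ne g).symm

theorem pairedBy_of {LQ LP : List Word} {η : Word} (hη : wd η ∈ C.pair)
    (hQ : ∀ k ∈ C.qubit, ∃ w ∈ LQ, k = wd w) (hQ' : ∀ w ∈ LQ, wd w ∈ C.qubit)
    (hP : ∀ k ∈ C.pair, ∃ w ∈ LP, k = wd w)
    (h1 : (LQ.map code).contains (code η) = false)
    (h2 : (LP.all fun k => (LQ.map code).contains (code k) ||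
      (LQ.map code).contains (code (η.reverse ++ k))) = true) : C.PairedBy (wd η) := by
  have hmem : ∀ w, (LQ.map code).contains (code w) = true → wd w ∈ C.qubit := by
    intro w hw
    rw [List.contains_iff_mem, List.mem_map] at hw
    obtain ⟨w', h1, h2⟩ := hw
    rw [← wd_eq_iff.2 h2]
    exact hQ' w' h1
  refine ⟨hη, fun h => ?_, fun k hk => ?_⟩
  · obtain ⟨w, hw, h⟩ := hQ _ h
    rw [wd_eq_iff] at h
    have : (LQ.map code).contains (code η) = true := by
      rw [List.contains_iff_mem, List.mem_map]
      exact ⟨w, hw, h.symm⟩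
    rw [h1] at this
    exact Bool.false_ne_true this
  · obtain ⟨w, hw, rfl⟩ := hP k hk
    rw [List.all_eq_true] at h2
    have := h2 w hw
    rw [Bool.or_eq_true] at this
    refine this.imp (hmem _) fun h => ?_
    have := hmem _ h
    rwa [wd_append, wd_reverse] at this

end Construction

/-! The five constructions. -/

abbrev antipodeWords : List Word := [[], antipodeWord]

theorem wd_mem_antipodeWords {H : Subgroup Flag} (h : antipode ∈ H) :
    ∀ w ∈ antipodeWords, wd w ∈ H :=
  wd_mem_pair (antipode_eq ▸ h)

theorem antipode_mem_closure {s : Set Flag} (h : antipode ∈ s) : antipode ∈ Subgroup.closure s :=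
  Subgroup.subset_closure h

theorem wd_mem_r {H : Subgroup Flag} (i : Fin 4) (h : r i ∈ H) : ∀ w ∈ [[], [i]], wd w ∈ H :=
  wd_mem_pair (by rwa [wd_singleton])

def legPairWords : List Word := mulWords legWords antipodeWords

theorem mem_octahedron_pair {k : Flag} (hk : k ∈ octahedron.pair) :
    ∃ w ∈ legPairWords, k = wd w := by
  refine exists_word_of_closedUnder [[2], [3], antipodeWord] _ ?_ (by decide +kernel) hk
  rintro y (rfl | rfl | rfl)
  exacts [⟨[2], by simp, by simp [wd]⟩, ⟨[3], by simp, by simp [wd]⟩,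
    ⟨_, by simp, antipode_eq⟩]

theorem wd_mem_legStab : ∀ w ∈ legWords, wd w ∈ legStab :=
  wd_mem_of_letters [2, 3] (by
    intro i hi
    simp only [List.mem_cons, List.not_mem_nil, or_false] at hi
    rcases hi with rfl | rfl <;> exact r_mem (by simp)) (by decide +kernel)

theorem wd_mem_octahedron_pair : ∀ w ∈ legPairWords, wd w ∈ octahedron.pair :=
  wd_mem_mulWords (fun w hw => octahedron.qubit_le_pair (wd_mem_legStab w hw))
    (wd_mem_antipodeWords (antipode_mem_closure (by simp)))

theorem octahedron_hasShape : octahedron.HasShape 1 3 :=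
  Construction.hasShape_of [[]] [[], [1], [2, 1]] antipodeWords
    (fun _ => mem_legStab) wd_mem_legStab (fun _ => mem_octahedron_pair) wd_mem_octahedron_pair
    (fun _ => mem_vertexStab) wd_mem_vertexStab (by decide +kernel) (by decide +kernel)
    (by decide +kernel) rfl

theorem octahedron_pairedBy : octahedron.PairedBy antipode := by
  rw [antipode_eq]
  exact Construction.pairedBy_of (antipode_eq ▸ antipode_mem_closure (by simp))
    (fun _ => mem_legStab) wd_mem_legStab (fun _ => mem_octahedron_pair) (by decide +kernel)
    (by decide +kernel)

def edgePairWords : List Word := mulWords [[], [3]] antipodeWords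
def edgeWords : List Word := mulWords [[], [1]] edgePairWords

theorem mem_truncated_qubit {k : Flag} (hk : k ∈ truncated.qubit) :
    ∃ w ∈ [[], [3]], k = wd w := by
  refine exists_word_of_closedUnder [[3]] _ ?_ (by decide +kernel) hk
  rintro y rfl
  exact ⟨[3], by simp, by simp [wd]⟩

theorem mem_truncated_pair {k : Flag} (hk : k ∈ truncated.pair) :
    ∃ w ∈ edgePairWords, k = wd w := by
  refine exists_word_of_closedUnder [[3], antipodeWord] _ ?_ (by decide +kernel) hk
  rintro y (rfl | rfl)
  exacts [⟨[3], by simp, by simp [wd]⟩, ⟨_, by simp, antipode_eq⟩]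

theorem mem_truncated_block {k : Flag} (hk : k ∈ truncated.block) :
    ∃ w ∈ edgeWords, k = wd w := by
  refine exists_word_of_closedUnder [[1], [3], antipodeWord] _ ?_ (by decide +kernel) hk
  rintro y (rfl | rfl | rfl)
  exacts [⟨[1], by simp, by simp [wd]⟩, ⟨[3], by simp, by simp [wd]⟩, ⟨_, by simp, antipode_eq⟩]

theorem wd_mem_truncated_qubit : ∀ w ∈ [[], [3]], wd w ∈ truncated.qubit :=
  wd_mem_r 3 (r_mem (by simp))

theorem wd_mem_truncated_pair : ∀ w ∈ edgePairWords, wd w ∈ truncated.pair :=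
  wd_mem_mulWords (wd_mem_r 3 (r_mem (by simp)))
    (wd_mem_antipodeWords (antipode_mem_closure (by simp)))

theorem wd_mem_truncated_block : ∀ w ∈ edgeWords, wd w ∈ truncated.block :=
  wd_mem_mulWords (wd_mem_r 1 (r_mem (by simp)))
    fun w hw => truncated.pair_le_block (wd_mem_truncated_pair w hw)

theorem truncated_hasShape : truncated.HasShape 6 2 :=
  Construction.hasShape_of [[], [2], [1, 2], [1, 2, 3, 2, 1], [1, 2, 3, 2, 1, 2], [2, 3, 2, 1, 2]]
    [[], [1]] antipodeWords
    (fun _ => mem_truncated_qubit) wd_mem_truncated_qubit (fun _ => mem_truncated_pair)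
    wd_mem_truncated_pair (fun _ => mem_truncated_block) wd_mem_truncated_block (by decide +kernel)
    (by decide +kernel) (by decide +kernel) rfl

theorem truncatedGHZ_hasShape : truncatedGHZ.HasShape 6 2 :=
  Construction.hasShape_of [[], [2], [1, 2], [1, 2, 3, 2, 1], [1, 2, 3, 2, 1, 2], [2, 3, 2, 1, 2]]
    [[], [1]] antipodeWords
    (fun _ => mem_truncated_qubit) wd_mem_truncated_qubit (fun _ => mem_truncated_pair)
    wd_mem_truncated_pair (fun _ => mem_truncated_block) wd_mem_truncated_block (by decide +kernel)
    (by decide +kernel) (by decide +kernel) rfl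

theorem truncated_pairedBy : truncated.PairedBy antipode := by
  rw [antipode_eq]
  exact Construction.pairedBy_of (antipode_eq ▸ antipode_mem_closure (by simp))
    (fun _ => mem_truncated_qubit) wd_mem_truncated_qubit (fun _ => mem_truncated_pair)
    (by decide +kernel) (by decide +kernel)

theorem truncatedGHZ_pairedBy : truncatedGHZ.PairedBy antipode :=
  ⟨truncated_pairedBy.mem, truncated_pairedBy.notMem, truncated_pairedBy.cover⟩

def trianglePairWords : List Word := mulWords [[], [2]] antipodeWords
def triangleWords : List Word := mulWords hexWords antipodeWords

theorem mem_cantellated_qubit {k : Flag} (hk : k ∈ cantellated.qubit) :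
    ∃ w ∈ [[], [2]], k = wd w := by
  refine exists_word_of_closedUnder [[2]] _ ?_ (by decide +kernel) hk
  rintro y rfl
  exact ⟨[2], by simp, by simp [wd]⟩

theorem mem_cantellated_pair {k : Flag} (hk : k ∈ cantellated.pair) :
    ∃ w ∈ trianglePairWords, k = wd w := by
  refine exists_word_of_closedUnder [[2], antipodeWord] _ ?_ (by decide +kernel) hk
  rintro y (rfl | rfl)
  exacts [⟨[2], by simp, by simp [wd]⟩, ⟨_, by simp, antipode_eq⟩]

theorem mem_cantellated_block {k : Flag} (hk : k ∈ cantellated.block) :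
    ∃ w ∈ triangleWords, k = wd w := by
  refine exists_word_of_closedUnder [[1], [2], antipodeWord] _ ?_ (by decide +kernel) hk
  rintro y (rfl | rfl | rfl)
  exacts [⟨[1], by simp, by simp [wd]⟩, ⟨[2], by simp, by simp [wd]⟩, ⟨_, by simp, antipode_eq⟩]

theorem wd_mem_hexWords {H : Subgroup Flag} (h1 : r 1 ∈ H) (h2 : r 2 ∈ H) :
    ∀ w ∈ hexWords, wd w ∈ H :=
  wd_mem_of_letters [1, 2] (by
    intro i hi
    simp only [List.mem_cons, List.not_mem_nil, or_false] at hi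
    rcases hi with rfl | rfl
    exacts [h1, h2]) (by decide +kernel)

theorem wd_mem_cantellated_qubit : ∀ w ∈ [[], [2]], wd w ∈ cantellated.qubit :=
  wd_mem_r 2 (r_mem (by simp))

theorem wd_mem_cantellated_pair : ∀ w ∈ trianglePairWords, wd w ∈ cantellated.pair :=
  wd_mem_mulWords (wd_mem_r 2 (r_mem (by simp)))
    (wd_mem_antipodeWords (antipode_mem_closure (by simp)))

theorem wd_mem_cantellated_block : ∀ w ∈ triangleWords, wd w ∈ cantellated.block :=
  wd_mem_mulWords (wd_mem_hexWords (r_mem (by simp)) (r_mem (by simp)))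
    (wd_mem_antipodeWords (antipode_mem_closure (by simp)))

theorem cantellated_hasShape : cantellated.HasShape 4 3 :=
  Construction.hasShape_of [[], [1, 2, 3, 2, 1], [2, 3, 2], [2, 3, 2, 1, 2, 3, 2, 1]]
    [[], [1], [2, 1]] antipodeWords
    (fun _ => mem_cantellated_qubit) wd_mem_cantellated_qubit (fun _ => mem_cantellated_pair)
    wd_mem_cantellated_pair (fun _ => mem_cantellated_block) wd_mem_cantellated_block
    (by decide +kernel) (by decide +kernel) (by decide +kernel) rfl

theorem cantellated_pairedBy : cantellated.PairedBy antipode := by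
  rw [antipode_eq]
  exact Construction.pairedBy_of (antipode_eq ▸ antipode_mem_closure (by simp))
    (fun _ => mem_cantellated_qubit) wd_mem_cantellated_qubit (fun _ => mem_cantellated_pair)
    (by decide +kernel) (by decide +kernel)

theorem mem_omnitruncated_qubit {k : Flag} (hk : k ∈ omnitruncated.qubit) :
    ∃ w ∈ [[]], k = wd w :=
  ⟨[], by simp, (Subgroup.mem_bot.1 hk).trans wd_nil.symm⟩

theorem mem_omnitruncated_pair {k : Flag} (hk : k ∈ omnitruncated.pair) :
    ∃ w ∈ [[], [1, 2, 1]], k = wd w := by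
  refine exists_word_of_closedUnder [[1, 2, 1]] _ ?_ (by decide +kernel) hk
  rintro y rfl
  exact ⟨_, by simp, hexAntipode_eq⟩

theorem mem_omnitruncated_block {k : Flag} (hk : k ∈ omnitruncated.block) :
    ∃ w ∈ hexWords, k = wd w := by
  refine exists_word_of_closedUnder [[1], [2]] _ ?_ (by decide +kernel) hk
  rintro y (rfl | rfl)
  exacts [⟨[1], by simp, by simp [wd]⟩, ⟨[2], by simp, by simp [wd]⟩]

theorem wd_mem_omnitruncated_qubit : ∀ w ∈ [[]], wd w ∈ omnitruncated.qubit := by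
  intro w hw
  rw [List.mem_singleton.1 hw]
  exact one_mem _

theorem wd_mem_omnitruncated_pair : ∀ w ∈ [[], [1, 2, 1]], wd w ∈ omnitruncated.pair :=
  wd_mem_pair (hexAntipode_eq ▸ Subgroup.subset_closure (by simp))

theorem omnitruncated_hasShape : omnitruncated.HasShape 8 3 :=
  Construction.hasShape_of [[], [1, 2, 3, 2, 1], [2, 3, 2], [2, 3, 2, 1, 2, 3, 2, 1], [3],
      [3, 1, 2, 3, 2, 1], [3, 2, 3, 2], [3, 2, 3, 2, 1, 2, 3, 2, 1]]
    [[], [1], [2]] [[], [1, 2, 1]]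
    (fun _ => mem_omnitruncated_qubit) wd_mem_omnitruncated_qubit (fun _ => mem_omnitruncated_pair)
    wd_mem_omnitruncated_pair (fun _ => mem_omnitruncated_block)
    (wd_mem_hexWords (r_mem (by simp)) (r_mem (by simp)))
    (by decide +kernel) (by decide +kernel) (by decide +kernel) rfl

theorem omnitruncated_pairedBy : omnitruncated.PairedBy hexAntipode := by
  rw [hexAntipode_eq]
  exact Construction.pairedBy_of (hexAntipode_eq ▸ Subgroup.subset_closure (by simp))
    (fun _ => mem_omnitruncated_qubit) wd_mem_omnitruncated_qubit (fun _ => mem_omnitruncated_pair)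
    (by decide +kernel) (by decide +kernel)

end Honeycomb

namespace Honeycomb

/-! ### Legs at a vertex, and uniformity of the vertex tensors -/

theorem eq_of_vertexOf_eq {g h : Flag} (e : vertexOf h = vertexOf g) :
    ∃ w ∈ vertexWords, h = g * wd w := by
  rw [vertexOf, vertexOf, eq_comm, QuotientGroup.eq] at e
  obtain ⟨w, hw, h1⟩ := mem_vertexStab e
  exact ⟨w, hw, by rw [← h1]; group⟩

theorem eq_of_legOf_eq {g h : Flag} (e : legOf h = legOf g) :
    ∃ w ∈ legWords, h = g * wd w := by
  rw [legOf, legOf, eq_comm, QuotientGroup.eq] at e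
  obtain ⟨w, hw, h1⟩ := mem_legStab e
  exact ⟨w, hw, by rw [← h1]; group⟩

theorem legOf_ne (g : Flag) {v w : Word}
    (h : (legWords.map code).contains (code (v.reverse ++ w)) = false) :
    legOf (g * wd v) ≠ legOf (g * wd w) := by
  intro e
  obtain ⟨x, hx, h1⟩ := eq_of_legOf_eq e.symm
  rw [mul_assoc, mul_right_inj] at h1
  have : (legWords.map code).contains (code (v.reverse ++ w)) = true := by
    rw [List.contains_iff_mem, List.mem_map]
    refine ⟨x, hx, ?_⟩
    rw [← wd_eq_iff, wd_append, wd_reverse, h1]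
    group
  rw [h] at this
  exact Bool.false_ne_true this

theorem st_of_mem_cellStab (T : Finset Face) {k : Flag} (hk : k ∈ cellStab) (g : Flag) :
    st T (g * k) = st T g := by
  induction hk using Subgroup.closure_induction generalizing g with
  | mem x hx => rcases hx with rfl | rfl | rfl <;> exact st_mul_r T g (by decide)
  | one => rw [mul_one]
  | mul x y _ _ h1 h2 => rw [← mul_assoc, h2, h1]
  | inv x _ h => have := h (g * x⁻¹); rw [inv_mul_cancel_right] at this; exact this.symm

theorem cellOf_mul {k : Flag} (hk : k ∈ cellStab) (g : Flag) : cellOf (g * k) = cellOf g := by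
  rw [cellOf, cellOf, QuotientGroup.eq]
  simpa using inv_mem hk

/-- Antipodal vertices of the octahedron lie on no common triangle: between flags on antipodal legs
the stack is never empty. -/
theorem not_antipode_of_cellOf_eq {g x y : Flag} (hx : legOf x = legOf g)
    (hy : legOf y = legOf (g * antipode)) : cellOf x ≠ cellOf y := by
  intro h
  obtain ⟨v, hv, rfl⟩ := eq_of_legOf_eq hx
  obtain ⟨w, hw, rfl⟩ := eq_of_legOf_eq hy
  rw [cellOf, cellOf, QuotientGroup.eq] at h
  have h1 : (g * wd v)⁻¹ * (g * antipode * wd w) = wd (v.reverse ++ (antipodeWord ++ w)) := by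
    rw [wd_append, wd_append, wd_reverse, antipode_eq]; group
  rw [h1] at h
  have h2 := st_of_mem_cellStab ∅ h 1
  rw [one_mul, st_one] at h2
  have h3 : ∀ v ∈ legWords, ∀ w ∈ legWords, (code (v.reverse ++ (antipodeWord ++ w))).1 ≠ [] := by
    decide +kernel
  refine h3 v hv w hw ?_
  rw [← code_eq]
  exact h2

namespace Construction

variable {C : Construction} {N m : ℕ}

/-- No axis carries two incoming legs, by `not_antipode_of_cellOf_eq`. The words in `R` give more
than `k` disjoint axes of the block, so by the pigeonhole principle one of them is free. -/
theorem angularUniform_of (hC : C.HasShape N m) (hN : 0 < N) (hm : 0 < m)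
    (hη : C.PairedBy antipode) (R : List Word) (hR : ∀ w ∈ R, wd w ∈ C.block)
    (h : R.Pairwise fun v w => ∀ x ∈ antipodeWords, ∀ y ∈ antipodeWords,
      (legWords.map code).contains (code ((v ++ x).reverse ++ (w ++ y))) = false)
    {k : ℕ} (hk : k < R.length) : C.AngularUniform k := by
  intro v c K hK hKc
  refine vertexIsometry_of hC hN hm hη v K ?_ ?_
  · intro g _ h1 h2
    obtain ⟨x, hx, -, hxc⟩ := hKc _ h1
    obtain ⟨y, hy, -, hyc⟩ := hKc _ h2
    exact not_antipode_of_cellOf_eq hx hy (hxc.trans hyc.symm)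
  · intro g _
    by_contra hcon
    push Not at hcon
    have h1 : ∀ i : Fin R.length, ∃ z ∈ K, ∃ x ∈ antipodeWords, z = legOf (g * wd (R[i] ++ x)) := by
      intro i
      by_cases h2 : legOf (g * wd R[i]) ∈ K
      · exact ⟨_, h2, [], by simp, by simp⟩
      · refine ⟨_, hcon _ (hR _ (List.getElem_mem _)) h2, antipodeWord, by simp, ?_⟩
        rw [wd_append, antipode_eq, mul_assoc]
        rfl
    choose f hf x hx hfx using h1
    have hlt : K.card < (Finset.univ : Finset (Fin R.length)).card := by
      rw [Finset.card_univ, Fintype.card_fin]; omega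
    obtain ⟨i, -, j, -, hij, hfij⟩ :=
      Finset.exists_ne_map_eq_of_card_lt_of_maps_to hlt (f := f) (fun i _ => hf i)
    wlog hlt : i < j generalizing i j
    · exact this j i hij.symm hfij.symm (lt_of_le_of_ne (not_lt.1 hlt) hij.symm)
    rw [hfx, hfx] at hfij
    exact legOf_ne g (List.pairwise_iff_getElem.1 h i j i.2 j.2 hlt _ (hx i) _ (hx j)) hfij

end Construction

theorem octahedron_angularUniform : octahedron.AngularUniform 2 :=
  Construction.angularUniform_of octahedron_hasShape (by simp) (by simp) octahedron_pairedBy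
    [[], [1], [2, 1]] (fun w hw => wd_mem_vertexStab w (by revert w; decide))
    (by decide +kernel) (by simp)

theorem truncated_angularUniform : truncated.AngularUniform 1 :=
  Construction.angularUniform_of truncated_hasShape (by simp) (by simp) truncated_pairedBy
    [[], [1]] (wd_mem_r 1 (r_mem (by simp))) (by decide +kernel) (by simp)

theorem truncatedGHZ_angularUniform : truncatedGHZ.AngularUniform 1 :=
  Construction.angularUniform_of truncatedGHZ_hasShape (by simp) (by simp) truncatedGHZ_pairedBy
    [[], [1]] (wd_mem_r 1 (r_mem (by simp))) (by decide +kernel) (by simp)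

theorem cantellated_angularUniform : cantellated.AngularUniform 2 :=
  Construction.angularUniform_of cantellated_hasShape (by simp) (by simp) cantellated_pairedBy
    [[], [1], [2, 1]]
    (fun w hw => wd_mem_hexWords (r_mem (by simp)) (r_mem (by simp)) w (by revert w; decide))
    (by decide +kernel) (by simp)

/-- A hexagon lies in one cell and meets three legs, two neighbouring corners on each; opposite
corners lie on different legs. The only incoming leg that is possible meets two of the three pairs
and spares the third. -/
theorem omnitruncated_multiAngularUniform : omnitruncated.MultiAngularUniform 1 := by
  intro v K _ hK
  have huniq : ∀ g x y, x ∈ cellStab → y ∈ cellStab → legOf (g * x) ∈ K → legOf (g * y) ∈ K →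
      legOf (g * x) = legOf (g * y) := by
    intro g x y hx hy h1 h2
    refine (Set.ncard_le_one (K.finite_toSet.subset fun z hz => hz.1)).1 (hK (cellOf g)) _ ?_ _ ?_
    · exact ⟨h1, g * x, rfl, cellOf_mul hx g⟩
    · exact ⟨h2, g * y, rfl, cellOf_mul hy g⟩
  have hc : ∀ w ∈ hexWords, wd w ∈ cellStab :=
    wd_mem_hexWords (r_mem (by simp)) (r_mem (by simp))
  have hb : ∀ w ∈ hexWords, wd w ∈ omnitruncated.block :=
    wd_mem_hexWords (r_mem (by simp)) (r_mem (by simp))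
  have hu : ∀ g, ∀ v ∈ hexWords, ∀ w ∈ hexWords,
      (legWords.map code).contains (code (v.reverse ++ w)) = false →
      legOf (g * wd v) ∈ K → legOf (g * wd w) ∉ K := fun g v hv w hw hvw h1 h2 =>
    legOf_ne g hvw (huniq g _ _ (hc v hv) (hc w hw) h1 h2)
  have hl : ∀ g, ∀ v w : Word, (legWords.map code).contains (code (v.reverse ++ w)) = true →
      legOf (g * wd v) = legOf (g * wd w) := by
    intro g v w h
    rw [List.contains_iff_mem, List.mem_map] at h
    obtain ⟨x, hx, h1⟩ := h
    rw [← wd_eq_iff, wd_append, wd_reverse] at h1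
    have h2 := wd_mem_legStab x hx
    rw [h1] at h2
    rw [legOf, legOf, QuotientGroup.eq]
    simpa [mul_assoc] using h2
  refine Construction.vertexIsometry_of omnitruncated_hasShape (by simp) (by simp)
    omnitruncated_pairedBy v K ?_ ?_
  · intro g _ h1
    rw [hexAntipode_eq]
    refine hu g [] (by decide) [1, 2, 1] (by decide) (by decide +kernel) ?_
    rwa [wd_nil, mul_one]
  · intro g _
    by_cases h1 : legOf (g * wd []) ∈ K
    · refine ⟨wd [1], hb _ (by decide), hu g [] (by decide) [1] (by decide) (by decide +kernel) h1,
        ?_⟩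
      rw [hexAntipode_eq, mul_assoc, ← wd_append, hl g _ [2, 1] (by decide +kernel)]
      exact hu g [] (by decide) [2, 1] (by decide) (by decide +kernel) h1
    by_cases h2 : legOf (g * wd [1]) ∈ K
    · refine ⟨wd [], hb _ (by decide), h1, ?_⟩
      rw [hexAntipode_eq, mul_assoc, ← wd_append]
      exact hu g [1] (by decide) _ (by decide) (by decide +kernel) h2
    · refine ⟨wd [2], hb _ (by decide), ?_, ?_⟩
      · rwa [hl g [2] [] (by decide +kernel)]
      · rwa [hexAntipode_eq, mul_assoc, ← wd_append, hl g _ [1] (by decide +kernel)]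

end Honeycomb

namespace Honeycomb

/-! ### Two adjacent vertices -/

/-- The vertices of the edge of a flag. -/
def edgeVertices (g : Flag) : Set Vertex := {vertexOf g, vertexOf (g * r 0)}

/-- The other legs of the two vertices of the edge of a flag that lie in its pentagon. -/
def edgeLegs (g : Flag) : Set Leg := {legOf (g * r 1), legOf (g * r 0 * r 1)}

theorem edgeVertices_mul (g : Flag) : edgeVertices (g * r 0) = edgeVertices g := by
  rw [edgeVertices, mul_assoc, r_sq, mul_one, edgeVertices, Set.pair_comm]

theorem edgeLegs_mul (g : Flag) : edgeLegs (g * r 0) = edgeLegs g := by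
  rw [edgeLegs, mul_assoc g (r 0) (r 0), r_sq, mul_one, edgeLegs, Set.pair_comm]

/-- The product of the word is in the stabilizer of the base leg. -/
def inLeg (w : Word) : Bool := (legWords.map code).contains (code w)

theorem wd_mem_of_inLeg {w : Word} (h : inLeg w = true) : wd w ∈ legStab := by
  rw [inLeg, List.contains_iff_mem, List.mem_map] at h
  obtain ⟨x, hx, h1⟩ := h
  rw [← wd_eq_iff.2 h1]
  exact wd_mem_legStab x hx

theorem inLeg_of_legOf_eq {g : Flag} {v w : Word} (h : legOf (g * wd v) = legOf (g * wd w)) :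
    inLeg (v.reverse ++ w) = true := by
  by_contra h1
  exact legOf_ne g (Bool.eq_false_iff.2 h1) h

theorem vertexOf_wd {w : Word} (hw : w ∈ vertexWords) (g : Flag) :
    vertexOf (g * wd w) = vertexOf g :=
  vertexOf_mul (wd_mem_vertexStab w hw) g

/-- An edge is determined by its two end vertices, and no edge is a loop. -/
theorem notMem_edgeVertices (g : Flag) {w : Word} (hw : w ∈ vertexWords) (h : inLeg w = false) :
    vertexOf (g * wd w * r 0) ∉ edgeVertices g := by
  rintro (h1 | h1)
  · have := vertexOf_mul_r0_ne (g * wd w)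
    rw [vertexOf_wd hw] at this
    exact this h1
  · obtain ⟨x, hx, h2⟩ := eq_of_vertexOf_eq h1
    have h3 : wd (0 :: (w ++ [0])) = wd x := by
      rw [wd_cons, wd_append, wd_singleton]
      calc r 0 * (wd w * r 0) = (g * r 0)⁻¹ * (g * wd w * r 0) := by
            rw [mul_inv_rev, r_inv]; group
        _ = wd x := by rw [h2]; group
    have key : ∀ w ∈ vertexWords, (vertexWords.map code).contains (code (0 :: (w ++ [0]))) = true →
        inLeg w = true := by decide +kernel
    rw [key w hw] at h
    · exact Bool.false_ne_true h.symm
    · rw [List.contains_iff_mem, List.mem_map]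
      exact ⟨x, hx, (wd_eq_iff.1 h3).symm⟩

theorem inLeg_of_enters {g : Flag} {w : Word} (hw : w ∈ vertexWords)
    (h : Enters (edgeVertices g) (edgeLegs g) (g * wd w)) : inLeg (1 :: w) = true := by
  rcases h.2.2 with h1 | h1
  · rw [← wd_singleton] at h1
    exact inLeg_of_legOf_eq (v := [1]) h1.symm
  · obtain ⟨x, hx, h2⟩ := eq_of_legOf_eq h1
    have h3 := vertexOf_wd hw g
    rw [h2, vertexOf_mul (legStab_le (wd_mem_legStab x hx)), vertexOf_mul (r_mem (by simp))] at h3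
    exact absurd h3 (vertexOf_mul_r0_ne g)

theorem leaves_of_inLeg {g : Flag} {w : Word} (hw : w ∈ vertexWords) (h : inLeg w = false)
    (h' : inLeg (1 :: w) = false) : Leaves (edgeVertices g) (edgeLegs g) (g * wd w) := by
  refine ⟨Or.inl (vertexOf_wd hw g), notMem_edgeVertices g hw h, ?_⟩
  rintro (h1 | h1)
  · rw [← wd_singleton] at h1
    have := inLeg_of_legOf_eq (v := [1]) h1.symm
    exact absurd this (Bool.eq_false_iff.1 h')
  · obtain ⟨x, hx, h2⟩ := eq_of_legOf_eq h1
    have h3 := vertexOf_wd hw g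
    rw [h2, vertexOf_mul (legStab_le (wd_mem_legStab x hx)), vertexOf_mul (r_mem (by simp))] at h3
    exact absurd h3 (vertexOf_mul_r0_ne g)

/-- The flags of one of the two vertices can be taken to belong to the first one. -/
theorem edge_induction {p : Flag → Prop} (g : Flag)
    (h : ∀ g', edgeVertices g' = edgeVertices g → edgeLegs g' = edgeLegs g →
      ∀ w ∈ vertexWords, p (g' * wd w)) (x : Flag) (hx : vertexOf x ∈ edgeVertices g) : p x := by
  rcases hx with hx | hx
  · obtain ⟨w, hw, rfl⟩ := eq_of_vertexOf_eq hx
    exact h g rfl rfl w hw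
  · obtain ⟨w, hw, rfl⟩ := eq_of_vertexOf_eq hx
    exact h (g * r 0) (edgeVertices_mul g) (edgeLegs_mul g) w hw

/-- A word for an element of the stabilizer of a vertex from the standard list. -/
theorem exists_vertexWord {w : Word} (h : ∀ i ∈ w, i ≠ 0) :
    ∃ w' ∈ vertexWords, wd w = wd w' := by
  refine mem_vertexStab (wd_mem_of_letters (H := vertexStab) [1, 2, 3] ?_ (L := [w]) ?_ w (by simp))
  · intro i hi
    simp only [List.mem_cons, List.not_mem_nil, or_false] at hi
    rcases hi with rfl | rfl | rfl <;> exact r_mem (by simp)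
  · intro v hv i hi
    rw [List.mem_singleton.1 hv] at hi
    have := h i hi
    fin_cases i <;> simp_all

theorem inLeg_congr {v w : Word} (h : wd v = wd w) : inLeg v = inLeg w := by
  rw [inLeg, inLeg, wd_eq_iff.1 h]

theorem vertexWords_letters : ∀ w ∈ vertexWords, ∀ i ∈ w, i ≠ 0 := by decide +kernel

theorem inLeg_of_enters' {g : Flag} {w : Word} (hw : ∀ i ∈ w, i ≠ 0)
    (h : Enters (edgeVertices g) (edgeLegs g) (g * wd w)) : inLeg (1 :: w) = true := by
  obtain ⟨w', hw', h1⟩ := exists_vertexWord hw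
  rw [h1] at h
  have h2 := inLeg_of_enters hw' h
  rwa [inLeg_congr (w := 1 :: w')]
  rw [wd_cons, wd_cons, h1]

theorem leaves_of_inLeg' {g : Flag} {w : Word} (hw : ∀ i ∈ w, i ≠ 0) (h : inLeg w = false)
    (h' : inLeg (1 :: w) = false) : Leaves (edgeVertices g) (edgeLegs g) (g * wd w) := by
  obtain ⟨w', hw', h1⟩ := exists_vertexWord hw
  rw [h1]
  refine leaves_of_inLeg hw' (by rwa [← inLeg_congr h1]) ?_
  rwa [← inLeg_congr (v := 1 :: w)]
  rw [wd_cons, wd_cons, h1]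

theorem notMem_edgeVertices' (g : Flag) {w : Word} (hw : ∀ i ∈ w, i ≠ 0) (h : inLeg w = false) :
    vertexOf (g * wd w * r 0) ∉ edgeVertices g := by
  obtain ⟨w', hw', h1⟩ := exists_vertexWord hw
  rw [h1]
  exact notMem_edgeVertices g hw' (by rwa [← inLeg_congr h1])

theorem letters_append {v w : Word} (hv : ∀ i ∈ v, i ≠ 0) (hw : ∀ i ∈ w, i ≠ 0) :
    ∀ i ∈ v ++ w, i ≠ 0 := by
  intro i hi
  rcases List.mem_append.1 hi with h | h
  exacts [hv i h, hw i h]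

namespace Construction

variable {C : Construction} {N m : ℕ}

theorem edge_enters (g : Flag) {η : Word} (hη : ∀ i ∈ η, i ≠ 0)
    (h : ∀ w ∈ vertexWords, inLeg (1 :: w) = true → inLeg (1 :: (w ++ η)) = false)
    (x : Flag) (hx : Enters (edgeVertices g) (edgeLegs g) x) :
    ¬ Enters (edgeVertices g) (edgeLegs g) (x * wd η) := by
  refine edge_induction (p := fun x => Enters (edgeVertices g) (edgeLegs g) x →
    ¬ Enters (edgeVertices g) (edgeLegs g) (x * wd η)) g ?_ x hx.1 hx
  intro g' h1 h2 w hw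
  rw [← h1, ← h2, mul_assoc, ← wd_append]
  intro h3 h4
  have h5 := inLeg_of_enters' (letters_append (vertexWords_letters w hw) hη) h4
  rw [h w hw (inLeg_of_enters hw h3)] at h5
  exact Bool.false_ne_true h5

theorem edge_exists_block (g : Flag) {η : Word} (hη : ∀ i ∈ η, i ≠ 0) (R : List Word)
    (hR : ∀ w ∈ R, wd w ∈ C.block) (hR0 : ∀ w ∈ R, ∀ i ∈ w, i ≠ 0)
    (h : ∀ w ∈ vertexWords, ∃ v ∈ R, inLeg (1 :: (w ++ v)) = false ∧
      inLeg (1 :: (w ++ (v ++ η))) = false)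
    (x : Flag) (hx : vertexOf x ∈ edgeVertices g) :
    ∃ k ∈ C.block, ¬ Enters (edgeVertices g) (edgeLegs g) (x * k) ∧
      ¬ Enters (edgeVertices g) (edgeLegs g) (x * k * wd η) := by
  refine edge_induction (p := fun x => ∃ k ∈ C.block,
    ¬ Enters (edgeVertices g) (edgeLegs g) (x * k) ∧
      ¬ Enters (edgeVertices g) (edgeLegs g) (x * k * wd η)) g ?_ x hx
  intro g' h1 h2 w hw
  obtain ⟨v, hv, h3, h4⟩ := h w hw
  refine ⟨wd v, hR v hv, ?_, ?_⟩
  · rw [← h1, ← h2, mul_assoc, ← wd_append]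
    intro h5
    have h6 := inLeg_of_enters' (letters_append (vertexWords_letters w hw) (hR0 v hv)) h5
    rw [h3] at h6
    exact Bool.false_ne_true h6
  · rw [← h1, ← h2, mul_assoc, mul_assoc, ← wd_append, ← wd_append]
    intro h5
    have h6 := inLeg_of_enters' (letters_append (vertexWords_letters w hw)
      (letters_append (hR0 v hv) hη)) h5
    rw [h4] at h6
    exact Bool.false_ne_true h6

/-- The common edge and the incoming leg are not antipodal, so of two antipodal legs at least one
leaves. Pairing then kills `D` without any block equation. -/
theorem edge_isometry_antipode (hC : C.HasShape N m) (hN : 0 < N) (hm : 0 < m)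
    (hη : C.PairedBy antipode) (h1 : r 1 ∈ C.block) (e : Pairing) (g : Flag) :
    C.ClusterIsometry e (edgeVertices g) (edgeLegs g) := by
  have h0 : ∀ i ∈ antipodeWord, i ≠ 0 := by decide
  refine clusterIsometry_of hC hN hm hη e (by simp [edgeVertices]) _ ?_ ?_ ?_
  · rw [antipode_eq]
    exact edge_enters g h0 (by decide +kernel)
  · rw [antipode_eq]
    exact edge_exists_block g h0 [[], [1]] (wd_mem_r 1 h1) (by decide) (by decide +kernel)
  · intro D hD0 hDp hDO _ x
    by_cases hx : vertexOf x ∈ edgeVertices g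
    · refine edge_induction (p := fun x => D x = 0) g ?_ x hx
      intro g' h2 h3 w hw
      by_cases h4 : inLeg w = false ∧ inLeg (1 :: w) = false
      · exact hDO _ (h2 ▸ h3 ▸ leaves_of_inLeg hw h4.1 h4.2)
      · have h5 : ∀ w ∈ vertexWords, inLeg w = false ∧ inLeg (1 :: w) = false ∨
            inLeg (w ++ antipodeWord) = false ∧ inLeg (1 :: (w ++ antipodeWord)) = false := by
          decide +kernel
        obtain ⟨h6, h7⟩ := (h5 w hw).resolve_left h4
        rw [← hDp _ antipode hη.mem, antipode_eq, mul_assoc, ← wd_append]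
        exact hDO _ (h2 ▸ h3 ▸ leaves_of_inLeg'
          (letters_append (vertexWords_letters w hw) h0) h6 h7)
    · exact hD0 x hx

end Construction

/-- The only pairs not reached by a leaving qubit join the common edge to the incoming leg. Their
partner under inversion lies on the far side of the edge, where the block equation is available and
its three other terms sit outside the two vertices. The mirror image would again be paired with an
incoming qubit. -/
theorem edge_isometry_omnitruncated (g : Flag) :
    omnitruncated.ClusterIsometry Pairing.inversion (edgeVertices g) (edgeLegs g) := by
  have h0 : ∀ i ∈ ([1, 2, 1] : Word), i ≠ 0 := by decide
  have hr1 : r 1 ∈ omnitruncated.block := r_mem (by simp)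
  have hr2 : r 2 ∈ omnitruncated.block := r_mem (by simp)
  refine Construction.clusterIsometry_of omnitruncated_hasShape (by simp) (by simp)
    omnitruncated_pairedBy _ (by simp [edgeVertices]) _ ?_ ?_ ?_
  · rw [hexAntipode_eq]
    exact Construction.edge_enters g h0 (by decide +kernel)
  · rw [hexAntipode_eq]
    exact Construction.edge_exists_block g h0 [[], [1], [2]] (fun w hw =>
      wd_mem_hexWords hr1 hr2 w (by revert w; decide)) (by decide) (by decide +kernel)
  · intro D hD0 hDp hDO hD x
    have hp := omnitruncated_pairedBy.mem
    rw [hexAntipode_eq] at hp hD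
    have hleg : ∀ g', edgeVertices g' = edgeVertices g → edgeLegs g' = edgeLegs g →
        ∀ w ∈ legWords, inLeg (1 :: (w ++ [1, 2, 1])) = true → D (g' * wd w) = 0 := by
      intro g' h2 h3 w hw hw1
      -- The flag matched with `g' * wd w`, as seen from the other end of the edge.
      set w' : Word := [2, 3, 2, 3] ++ w with hw'
      have hwl := wd_mem_legStab w hw
      have h4 : g' * wd w * Pairing.inversion.twist = g' * r 0 * wd w' := by
        rw [mul_assoc, legStab_comm_twist _ hwl, Pairing.twist_eq, hw', wd_append, wd_cons]
        simp only [mul_assoc]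
      have h5 : g' * r 0 * wd w' * Pairing.inversion.twist = g' * wd w := by
        rw [← h4, mul_assoc, Pairing.twist_mul_twist, mul_one]
      have hl0 : ∀ w ∈ legWords, ∀ i ∈ w, i ≠ 0 := by decide +kernel
      have hl : ∀ i ∈ w', i ≠ 0 := letters_append (by decide) (hl0 w hw)
      have hS : edgeVertices (g' * r 0) = edgeVertices g := (edgeVertices_mul g').trans h2
      have hJ : edgeLegs (g' * r 0) = edgeLegs g := (edgeLegs_mul g').trans h3
      have hen : ∀ v : Word, (∀ i ∈ v, i ≠ 0) → inLeg (1 :: (w' ++ v)) = false →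
          ¬ Enters (edgeVertices g) (edgeLegs g) (g' * r 0 * wd w' * wd v) := by
        intro v hv h6 h7
        rw [← hS, ← hJ, mul_assoc, ← wd_append] at h7
        rw [inLeg_of_enters' (letters_append hl hv) h7] at h6
        exact Bool.false_ne_true h6.symm
      have hz : ∀ v : Word, (∀ i ∈ v, i ≠ 0) → inLeg (w' ++ v) = false →
          D (g' * r 0 * wd w' * wd v * Pairing.inversion.twist) = 0 := by
        intro v hv h6
        refine hD0 _ ?_
        rw [vertexOf_mul_twist, mul_assoc (g' * r 0), ← wd_append, ← hS]
        exact notMem_edgeVertices' _ (letters_append hl hv) h6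
      have key : ∀ w ∈ legWords, inLeg (1 :: (w ++ [1, 2, 1])) = true →
          (inLeg (1 :: (([2, 3, 2, 3] ++ w) ++ [])) = false ∧
          inLeg (1 :: (([2, 3, 2, 3] ++ w) ++ [1, 2, 1])) = false ∧
          inLeg (1 :: (([2, 3, 2, 3] ++ w) ++ [1])) = false ∧
          inLeg (1 :: (([2, 3, 2, 3] ++ w) ++ [1, 1, 2, 1])) = false) ∧
          inLeg (([2, 3, 2, 3] ++ w) ++ [1, 2, 1]) = false ∧
          inLeg (([2, 3, 2, 3] ++ w) ++ [1]) = false ∧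
          inLeg (([2, 3, 2, 3] ++ w) ++ [1, 1, 2, 1]) = false := by decide +kernel
      obtain ⟨⟨e1, e2, e3, e4⟩, e5, e6, e7⟩ := key w hw hw1
      have e8 : g' * r 0 * wd w' * wd [1] * wd [1, 2, 1] =
          g' * r 0 * wd w' * wd [1, 1, 2, 1] := by
        rw [mul_assoc _ (wd [1]), ← wd_append]; rfl
      have := hD (g' * r 0 * wd w') ?_ (wd [1]) (by rwa [wd_singleton]) ?_ ?_ ?_ ?_
      · rw [h5, hz [1, 2, 1] (by decide) e5, hz [1] (by decide) e6, e8,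
          hz [1, 1, 2, 1] (by decide) e7] at this
        simpa using this
      · obtain ⟨v, hv, h8⟩ := exists_vertexWord hl
        rw [h8, vertexOf_wd hv, ← hS]
        exact Or.inl rfl
      · have := hen [] (by simp) e1
        rwa [wd_nil, mul_one] at this
      · exact hen _ (by decide) e2
      · exact hen _ (by decide) e3
      · rw [e8]
        exact hen _ (by decide) e4
    by_cases hx : vertexOf x ∈ edgeVertices g
    · refine edge_induction (p := fun x => D x = 0) g ?_ x hx
      intro g' h2 h3 w hw
      -- Either one member of the pair leaves, or the pair joins the common edge to the incoming
      -- leg, in one of the two orders.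
      have h5 : ∀ w ∈ vertexWords, inLeg w = false ∧ inLeg (1 :: w) = false ∨
          inLeg (w ++ [1, 2, 1]) = false ∧ inLeg (1 :: (w ++ [1, 2, 1])) = false ∨
          inLeg w = true ∧ inLeg (1 :: (w ++ [1, 2, 1])) = true ∨
          inLeg (w ++ [1, 2, 1]) = true ∧ inLeg (1 :: (w ++ [1, 2, 1] ++ [1, 2, 1])) = true := by
        decide +kernel
      have hall : ∀ w : Word, inLeg w = true → inLeg (1 :: (w ++ [1, 2, 1])) = true →
          D (g' * wd w) = 0 := by
        intro w h6 h7
        obtain ⟨v, hv, h8⟩ := mem_legStab (wd_mem_of_inLeg h6)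
        rw [h8]
        refine hleg g' h2 h3 v hv ?_
        rwa [← inLeg_congr (v := 1 :: (w ++ [1, 2, 1]))]
        rw [wd_cons, wd_append, h8, ← wd_append, ← wd_cons]
      rcases h5 w hw with h6 | h6 | h6 | h6
      · exact hDO _ (h2 ▸ h3 ▸ leaves_of_inLeg hw h6.1 h6.2)
      · rw [← hDp _ _ hp, mul_assoc, ← wd_append]
        exact hDO _ (h2 ▸ h3 ▸ leaves_of_inLeg'
          (letters_append (vertexWords_letters w hw) h0) h6.1 h6.2)
      · exact hall w h6.1 h6.2
      · rw [← hDp _ _ hp, mul_assoc, ← wd_append]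
        exact hall _ h6.1 h6.2
    · exact hD0 x hx

end Honeycomb

namespace Honeycomb

/-! ### The levels of the cells at a vertex -/

/-- The faces of the base cell at its vertex. -/
def Tri.faces (t : Tri) : Finset Face := {t.a, t.b, t.c}

theorem Tri.faces_flip (t : Tri) {i : Fin 4} (hi : i ≠ 0) : (t.flip i).faces = t.faces := by
  ext x
  fin_cases i
  · exact absurd rfl hi
  all_goals simp [faces, flip, Tri.a, Tri.b, Tri.c]
  all_goals tauto

theorem Tri.adj_of_mem (t : Tri) {x y : Face} (hx : x ∈ t.faces) (hy : y ∈ t.faces) (h : x ≠ y) :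
    adj x y := by
  have h1 := t.ab
  have h2 := t.ac
  have h3 := t.bc
  simp only [faces, Finset.mem_insert, Finset.mem_singleton] at hx hy
  rcases hx with rfl | rfl | rfl <;> rcases hy with rfl | rfl | rfl <;>
    first | exact absurd rfl h | assumption | (rw [adj_comm]; assumption)

variable {T : Finset Face} {a f : Face} {V : Finset Face} {s u : Stack}

/-- The length drops only if the last clique reached is `{a}`, but then the neighbour `f` of `a`
would have been absorbed there. On the way down the faces of the cliques passed take over the role
of `f`. -/
theorem length_push_of_absorbs (hs : Valid T s) (ha : Absorbs T a s) (haf : adj a f)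
    (hf : ¬ Absorbs T f s) : (push T a s).length = s.length := by
  induction s generalizing f with
  | nil =>
    have ha' : a ∈ T := ha
    simp [push, ha']
  | cons W s ih =>
    by_cases haW : a ∈ W
    · by_cases hW : W = {a}
      · subst hW
        refine absurd (Or.inr ?_) hf
        intro x hx
        rw [Finset.mem_singleton.1 hx, adj_comm]
        exact haf
      · rw [push_erase haW hW]; rfl
    · have h' : ∀ x ∈ W, adj a x := ha.resolve_left haW
      by_cases h2 : Absorbs T a s
      · obtain ⟨x, hx⟩ := hs.1
        rw [push_deep haW h' h2, List.length_cons, ih hs.2.2.2 h2 (h' x hx) (hs.2.2.1 x hx)]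
        rfl
      · rw [push_insert haW h' h2]; rfl

/-- The stack has length `n` or `n + 1`, and its clique at height `n` contains `f`. -/
def Anchored (f : Face) (n : ℕ) (A : Finset Face) (s : Stack) : Prop :=
  ∃ V u, f ∈ V ∧ u.length + 1 = n ∧ (s = V :: u ∨ ∃ W ⊆ A, s = W :: V :: u)

theorem Anchored.le_length {f : Face} {n : ℕ} {A : Finset Face} (h : Anchored f n A s) :
    n ≤ s.length ∧ s.length ≤ n + 1 := by
  obtain ⟨V, u, -, hn, rfl | ⟨W, -, rfl⟩⟩ := h <;> simp <;> omega

theorem Anchored.push_aux (hs : Valid T (V :: u)) (hf : f ∈ V) (haf : a ≠ f)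
    (ha : Absorbs T a (V :: u)) :
    ∃ V' u', f ∈ V' ∧ u'.length = u.length ∧ push T a (V :: u) = V' :: u' := by
  by_cases haV : a ∈ V
  · have hV : V ≠ {a} := by
      rintro rfl
      exact haf (Finset.mem_singleton.1 hf).symm
    exact ⟨_, _, Finset.mem_erase.2 ⟨haf.symm, hf⟩, rfl, push_erase haV hV⟩
  · have h' : ∀ x ∈ V, adj a x := ha.resolve_left haV
    by_cases h2 : Absorbs T a u
    · exact ⟨_, _, hf, length_push_of_absorbs hs.2.2.2 h2 (h' f hf) (hs.2.2.1 f hf),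
        push_deep haV h' h2⟩
    · exact ⟨_, _, Finset.mem_insert_of_mem hf, rfl, push_insert haV h' h2⟩

/-- Only walls in `A` are crossed and `f` is not one of them, so the clique containing `f` never
disappears: a push changes the at most one clique above it, or passes below without changing the
length. -/
theorem Anchored.push {n : ℕ} {A : Finset Face} (hs : Valid T s)
    (hA : ∀ x ∈ A, x ≠ a → adj a x) (ha : a ∈ A) (hf : f ∉ A) (h : Anchored f n A s) :
    Anchored f n A (push T a s) := by
  have haf : a ≠ f := by rintro rfl; exact hf ha
  obtain ⟨V, u, hfV, hn, rfl | ⟨W, hW, rfl⟩⟩ := h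
  · by_cases h1 : Absorbs T a (V :: u)
    · obtain ⟨V', u', h2, h3, h4⟩ := Anchored.push_aux hs hfV haf h1
      exact ⟨V', u', h2, by omega, Or.inl h4⟩
    · exact ⟨V, u, hfV, hn, Or.inr ⟨{a}, by simpa using ha, push_of_not_absorbs h1⟩⟩
  · by_cases haW : a ∈ W
    · by_cases hWa : W = {a}
      · subst hWa
        exact ⟨V, u, hfV, hn, Or.inl push_pop⟩
      · exact ⟨V, u, hfV, hn, Or.inr ⟨_, (Finset.erase_subset _ _).trans hW, push_erase haW hWa⟩⟩
    · have h' : ∀ x ∈ W, adj a x := fun x hx => hA x (hW hx) (by rintro rfl; exact haW hx)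
      by_cases h1 : Absorbs T a (V :: u)
      · obtain ⟨V', u', h2, h3, h4⟩ := Anchored.push_aux hs.2.2.2 hfV haf h1
        exact ⟨V', u', h2, by omega, Or.inr ⟨W, hW, by rw [push_deep haW h' h1, h4]⟩⟩
      · exact ⟨V, u, hfV, hn, Or.inr ⟨_, Finset.insert_subset ha hW, push_insert haW h' h1⟩⟩

theorem tri_faces_mul {k : Flag} (hk : k ∈ vertexStab) (g : Flag) :
    (tr (g * k)).faces = (tr g).faces := by
  induction hk using Subgroup.closure_induction generalizing g with
  | mem x hx =>
    rcases hx with rfl | rfl | rfl <;> rw [tr_mul_r] <;> exact Tri.faces_flip _ (by decide)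
  | one => rw [mul_one]
  | mul x y _ _ h1 h2 => rw [← mul_assoc, h2, h1]
  | inv x _ h => have := h (g * x⁻¹); rw [inv_mul_cancel_right] at this; exact this.symm

/-- An induction over the flags at a vertex. -/
theorem vertex_induction {p : Flag → Prop} (g : Flag) (h0 : p g)
    (h : ∀ k ∈ vertexStab, ∀ i : Fin 4, i ≠ 0 → p (g * k) → p (g * k * r i)) {k : Flag}
    (hk : k ∈ vertexStab) : p (g * k) := by
  have hgen : ∀ x ∈ ({r 1, r 2, r 3} : Set Flag), ∃ i : Fin 4, i ≠ 0 ∧ x = r i := by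
    rintro x (rfl | rfl | rfl)
    exacts [⟨1, by decide, rfl⟩, ⟨2, by decide, rfl⟩, ⟨3, by decide, rfl⟩]
  induction hk using Subgroup.closure_induction_right with
  | one => rwa [mul_one]
  | mul_right x hx y hy ih =>
    obtain ⟨i, hi, rfl⟩ := hgen y hy
    rw [← mul_assoc]
    exact h x hx i hi ih
  | mul_inv_cancel x hx y hy ih =>
    obtain ⟨i, hi, rfl⟩ := hgen y hy
    rw [r_inv, ← mul_assoc]
    exact h x hx i hi ih

theorem anchored_st {n : ℕ} {g : Flag} (hf : f ∉ (tr g).faces)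
    (h : Anchored f n (tr g).faces (st T g)) {k : Flag} (hk : k ∈ vertexStab) :
    Anchored f n (tr g).faces (st T (g * k)) := by
  refine vertex_induction (p := fun x => Anchored f n (tr g).faces (st T x)) g h ?_ hk
  intro k hk i hi ih
  by_cases h3 : i = 3
  · subst h3
    rw [st_mul_r3]
    have hm : (tr (g * k)).a ∈ (tr g).faces := by
      rw [← tri_faces_mul hk]; simp [Tri.faces]
    exact ih.push (st_valid T _) (fun x hx hxa => (tr g).adj_of_mem hm hx hxa.symm) hm hf
  · rwa [st_mul_r T _ h3]

/-- If the last clique is not contained in the faces at a vertex, then no cell at that vertex has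
lower level. -/
theorem length_le_of_not_subset {g : Flag} (hs : st T g = V :: u) (h : ¬ V ⊆ (tr g).faces)
    {k : Flag} (hk : k ∈ vertexStab) :
    (st T g).length ≤ (st T (g * k)).length ∧
      (st T (g * k)).length ≤ (st T g).length + 1 := by
  obtain ⟨f, hf, hf'⟩ := Finset.not_subset.1 h
  exact (anchored_st hf' ⟨V, u, hf, by rw [hs]; rfl, Or.inl hs⟩ hk).le_length

theorem exists_hexWord_a (t : Tri) {x : Face} (hx : x ∈ t.faces) :
    ∃ w ∈ hexWords, (w.foldl Tri.flip t).a = x := by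
  simp only [Tri.faces, Finset.mem_insert, Finset.mem_singleton] at hx
  rcases hx with rfl | rfl | rfl
  · exact ⟨[], by decide, rfl⟩
  · exact ⟨[2], by decide, rfl⟩
  · exact ⟨[1, 2], by decide, rfl⟩

theorem hexWords_mem : ∀ w ∈ hexWords, wd w ∈ vertexStab ∧ wd w ∈ cellStab := fun w hw =>
  ⟨wd_mem_hexWords (r_mem (by simp)) (r_mem (by simp)) w hw,
    wd_mem_hexWords (r_mem (by simp)) (r_mem (by simp)) w hw⟩

/-- If the last clique is contained in the faces at a vertex, then it can be removed. -/
theorem exists_st_eq_tail {g : Flag} (hs : st T g = V :: u) (h : V ⊆ (tr g).faces) :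
    ∃ k ∈ vertexStab, st T (g * k) = u := by
  induction hn : V.card generalizing V g with
  | zero =>
    have := (st_valid T g)
    rw [hs] at this
    exact absurd this.1 (by simp [Finset.card_eq_zero.1 hn])
  | succ n ih =>
    have hv := st_valid T g
    rw [hs] at hv
    obtain ⟨x, hx⟩ := hv.1
    obtain ⟨w, hw, hwx⟩ := exists_hexWord_a (tr g) (h hx)
    obtain ⟨hw1, hw2⟩ := hexWords_mem w hw
    have hk : wd w * r 3 ∈ vertexStab := mul_mem hw1 (r_mem (by simp))
    have h1 : st T (g * (wd w * r 3)) = push T x (V :: u) := by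
      rw [← mul_assoc, st_mul_r3, tr_mul_wd, hwx, st_of_mem_cellStab T hw2, hs]
    by_cases hV : V = {x}
    · subst hV
      exact ⟨_, hk, by rw [h1, push_pop]⟩
    · rw [push_erase hx hV] at h1
      obtain ⟨k, hk', h2⟩ := ih h1 (by
        rw [tri_faces_mul hk]; exact (Finset.erase_subset _ _).trans h)
        (by rw [Finset.card_erase_of_mem hx, hn]; rfl)
      exact ⟨_, mul_mem hk hk', by rw [← mul_assoc, h2]⟩

/-- The levels of the cells at a vertex differ by at most one. -/
theorem length_le_succ (g : Flag) {k : Flag} (hk : k ∈ vertexStab) :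
    (st T (g * k)).length ≤ (st T g).length + 1 := by
  have hg : ∀ x : Flag, x = (x * k) * k⁻¹ := fun x => by group
  rcases hs : st T (g * k) with _ | ⟨V, u⟩
  · simp
  by_cases hV : V ⊆ (tr (g * k)).faces
  · obtain ⟨k', hk', h1⟩ := exists_st_eq_tail hs hV
    rcases u with _ | ⟨W, u⟩
    · simp
    -- If the next clique were contained in the faces at the vertex as well, a face of the removed
    -- clique would have been absorbed by it.
    have hW : ¬ W ⊆ (tr (g * k * k')).faces := by
      intro hW
      have hv := st_valid T (g * k)
      rw [hs] at hv
      obtain ⟨x, hx⟩ := hv.1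
      have hxa := hv.2.2.1 x hx
      have hxm := hV hx
      rw [tri_faces_mul hk'] at hW
      refine hxa ?_
      by_cases hxW : x ∈ W
      · exact Or.inl hxW
      · exact Or.inr fun y hy => Tri.adj_of_mem _ hxm (hW hy) (by rintro rfl; exact hxW hy)
    have h2 := (length_le_of_not_subset h1 hW (k := (k * k')⁻¹)
      (inv_mem (mul_mem hk hk'))).1
    rw [h1, show g * k * k' * (k * k')⁻¹ = g by group] at h2
    simp only [List.length_cons] at *
    omega
  · have h2 := (length_le_of_not_subset hs hV (k := k⁻¹) (inv_mem hk)).1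
    rw [← hg, hs] at h2
    omega

end Honeycomb

/-! ### The last clique of a cell -/

namespace Honeycomb

variable {T : Finset Face} {V : Finset Face} {s u : Stack}

/-- The last clique of a stack. -/
def top (T : Finset Face) : Stack → Finset Face
  | [] => T
  | V :: _ => V

theorem base_faces : Tri.base.faces = {0, 1, 2} := by decide

/-- The types of the walls of the base cell that contain the seed: a cell or a vertex. -/
def IsSeed (T : Finset Face) : Prop := T = ∅ ∨ T = {0, 1, 2}

theorem IsSeed.isClique (hT : IsSeed T) : IsClique T := by
  rcases hT with rfl | rfl
  · intro a ha; simp at ha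
  · unfold IsClique; decide

theorem IsSeed.exists_not_adj (hT : IsSeed T) (hne : T.Nonempty) :
    ∀ x ∉ T, ∃ f ∈ T, f ≠ x ∧ adj x f = false := by
  rcases hT with rfl | rfl
  · simp at hne
  · decide

theorem Absorbs.adj (hT : IsSeed T) (hs : Valid T s) {x f : Face} (hx : Absorbs T x s)
    (hf : f ∈ top T s) (hfx : f ≠ x) : adj x f := by
  cases s with
  | nil => exact hT.isClique x hx f hf hfx.symm
  | cons V s =>
    rcases hx with hx | hx
    · exact hs.2.1 x hx f hf hfx.symm
    · exact hx f hf

theorem exists_not_adj_of_not_absorbs (hT : IsSeed T) {x : Face} (hx : ¬ Absorbs T x s)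
    (hne : (top T s).Nonempty) : ∃ f ∈ top T s, f ≠ x ∧ adj x f = false := by
  cases s with
  | nil => exact hT.exists_not_adj hne x hx
  | cons V s =>
    simp only [Absorbs, not_or, not_forall, Bool.not_eq_true] at hx
    obtain ⟨h1, f, hf, h2⟩ := hx
    exact ⟨f, hf, fun h => h1 (h ▸ hf), h2⟩

theorem Absorbs.top_nonempty (hs : Valid T s) {x : Face} (hx : Absorbs T x s) :
    (top T s).Nonempty := by
  cases s with
  | nil => exact ⟨x, hx⟩
  | cons V s => exact hs.1

theorem push_of_absorbs (hs : Valid T s) {a : Face} (ha : Absorbs T a s) (hne : top T s ≠ {a}) :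
    (push T a s).length = s.length ∧ ∀ f ≠ a, (f ∈ top T (push T a s) ↔ f ∈ top T s) := by
  cases s with
  | nil =>
    have ha' : a ∈ T := ha
    simp [push, ha']
  | cons V s =>
    change V ≠ {a} at hne
    by_cases haV : a ∈ V
    · rw [push_erase haV hne]
      refine ⟨rfl, fun f hf => ?_⟩
      simp [top, hf]
    · have h' : ∀ x ∈ V, Honeycomb.adj a x := ha.resolve_left haV
      by_cases h2 : Absorbs T a s
      · obtain ⟨x, hx⟩ := hs.1
        rw [push_deep haV h' h2]
        refine ⟨?_, fun f hf => Iff.rfl⟩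
        rw [List.length_cons, length_push_of_absorbs hs.2.2.2 h2 (h' x hx) (hs.2.2.1 x hx)]
        rfl
      · rw [push_insert haV h' h2]
        refine ⟨rfl, fun f hf => ?_⟩
        simp [top, hf]

/-- Two faces at distance two have exactly two common neighbours, which share the edge that joins
the two faces; opposite faces have none. -/
theorem adj_of_common : ∀ d x : Face, adj d x = false → d ≠ x → ∀ a b : Face, adj a d → adj a x →
    adj b d → adj b x → a = b ∨ adj a b := by
  decide +kernel

/-- Two faces that can be moved below the last clique are adjacent. -/
theorem adj_of_deep (hT : IsSeed T) (hs : Valid T s) {a b : Face} (ha : Absorbs T a s)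
    (hb : Absorbs T b s) (ha1 : a ∉ top T s) (hb1 : b ∉ top T s) (ha2 : a ∉ top T (push T a s))
    (hb2 : b ∉ top T (push T b s)) : a = b ∨ adj a b := by
  cases s with
  | nil => exact absurd ha ha1
  | cons V s =>
    have ha' : ∀ x ∈ V, Honeycomb.adj a x := ha.resolve_left ha1
    have hb' : ∀ x ∈ V, Honeycomb.adj b x := hb.resolve_left hb1
    have h2 : Absorbs T a s := by
      by_contra h2
      rw [push_insert (V := V) ha1 ha' h2] at ha2
      exact ha2 (Finset.mem_insert_self _ _)
    have h3 : Absorbs T b s := by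
      by_contra h3
      rw [push_insert (V := V) hb1 hb' h3] at hb2
      exact hb2 (Finset.mem_insert_self _ _)
    by_cases hab : a = b
    · exact Or.inl hab
    obtain ⟨d, hd⟩ := hs.1
    have hds := hs.2.2.1 d hd
    -- A face `d` of the last clique is not absorbed below, so it is not adjacent to some `x` of the
    -- clique before. Both `a` and `b` commute with `d` and with the whole of that earlier clique,
    -- unless they equal `x`.
    obtain ⟨x, hx, hxd, hdx⟩ := exists_not_adj_of_not_absorbs hT hds (h2.top_nonempty hs.2.2.2)
    have hv := hs.2.2.2
    by_cases hax : x = a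
    · subst hax
      exact Or.inr ((adj_comm _ _).trans (h3.adj hT hv hx hab))
    by_cases hbx : x = b
    · subst hbx
      exact Or.inr (h2.adj hT hv hx (Ne.symm hab))
    exact adj_of_common d x hdx hxd.symm a b (ha' d hd) (h2.adj hT hv hx hax) (hb' d hd)
      (h3.adj hT hv hx hbx)

/-! ### Balls -/

/-- The vertices in `X` are those with a cell of level at most `m`. -/
def IsBall (T : Finset Face) (g₀ : Flag) (X : Set Vertex) (m : ℕ) : Prop :=
  ∀ x, vertexOf (g₀ * x) ∈ X ↔ ∃ k ∈ vertexStab, (st T (x * k)).length ≤ m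

theorem no_four_clique : ∀ a b c : Face, adj a b → adj a c → adj b c → ∀ d : Face,
    adj d a → adj d b → adj d c → False := by
  decide +kernel

/-- A clique has at most three faces, and they have a common vertex; this is the vertex at which a
last clique can be removed. -/
theorem exists_tri_of_clique (hV : IsClique V) : ∃ t : Tri, V ⊆ t.faces := by
  by_cases h1 : ∃ a, a ∈ V
  swap
  · exact ⟨Tri.base, fun x hx => absurd ⟨x, hx⟩ h1⟩
  obtain ⟨a, ha⟩ := h1
  by_cases h2 : ∃ b ∈ V, a ≠ b
  swap
  · push Not at h2
    obtain ⟨t, rfl⟩ := exists_tri a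
    refine ⟨t, fun x hx => ?_⟩
    rw [← h2 x hx]; simp [Tri.faces]
  obtain ⟨b, hb, hab⟩ := h2
  by_cases h3 : ∃ c ∈ V, a ≠ c ∧ b ≠ c
  swap
  · push Not at h3
    obtain ⟨t, rfl, rfl⟩ := exists_tri_of_adj a b (hV a ha b hb hab)
    refine ⟨t, fun x hx => ?_⟩
    by_cases h4 : t.a = x
    · rw [← h4]; simp [Tri.faces]
    · rw [← h3 x hx h4]; simp [Tri.faces]
  obtain ⟨c, hc, hac, hbc⟩ := h3
  have h4 := hV a ha b hb hab
  have h5 := hV a ha c hc hac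
  have h6 := hV b hb c hc hbc
  refine ⟨⟨(a, b, c), by simp [h4, h5, h6]⟩, fun x hx => ?_⟩
  by_contra h7
  simp only [Tri.faces, Tri.a, Tri.b, Tri.c, Finset.mem_insert, Finset.mem_singleton, not_or] at h7
  exact no_four_clique a b c h4 h5 h6 x (hV x hx a ha h7.1) (hV x hx b hb h7.2.1)
    (hV x hx c hc h7.2.2)

theorem exists_tr_mul_eq (x : Flag) (t : Tri) : ∃ k ∈ cellStab, tr (x * k) = t := by
  refine ⟨(cellElt (tr x))⁻¹ * cellElt t, mul_mem (inv_mem (cellElt_mem _)) (cellElt_mem _), ?_⟩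
  rw [tr_mul_left, ← tr_cellElt (tr x), ← tr_mul_left, tr_cellElt, mul_inv_cancel_left, tr_cellElt]

theorem eq_mul_of_cellOf_eq {g h : Flag} (e : cellOf g = cellOf h) : ∃ k ∈ cellStab, h = g * k := by
  rw [cellOf, cellOf, QuotientGroup.eq] at e
  exact ⟨_, e, by group⟩

theorem eq_mul_of_vertexOf_eq {g h : Flag} (e : vertexOf g = vertexOf h) :
    ∃ k ∈ vertexStab, h = g * k := by
  rw [vertexOf, vertexOf, QuotientGroup.eq] at e
  exact ⟨_, e, by group⟩

/-- One direction is `length_le_succ`. For the other, a cell of level `m + 1` has a vertex whose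
faces contain its last clique; removing the clique there shows that this vertex belongs to the
smaller ball. -/
theorem IsBall.succ {g₀ : Flag} {seed : Set Vertex} {n m : ℕ}
    (h : IsBall T g₀ (ball seed n) m) : IsBall T g₀ (ball seed (n + 1)) (m + 1) := by
  intro x
  constructor
  · rintro ⟨g, g', h1, h2, h3⟩
    obtain ⟨y, rfl⟩ : ∃ y, g = g₀ * y := ⟨g₀⁻¹ * g, by group⟩
    obtain ⟨κ, hκ, rfl⟩ := eq_mul_of_cellOf_eq h2
    obtain ⟨k', hk', h4⟩ := eq_mul_of_vertexOf_eq h3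
    obtain ⟨k, hk, h5⟩ := (h y).1 h1
    have h6 := length_le_succ (T := T) (y * k) (inv_mem hk)
    rw [mul_inv_cancel_right] at h6
    refine ⟨k'⁻¹, inv_mem hk', ?_⟩
    have h7 : x * k'⁻¹ = y * κ := by
      rw [mul_assoc, mul_assoc, mul_right_inj] at h4
      rw [h4]; group
    rw [h7, st_of_mem_cellStab T hκ]
    omega
  · rintro ⟨k, hk, h1⟩
    by_cases h2 : (st T (x * k)).length ≤ m
    · exact ⟨g₀ * x, g₀ * x, (h x).2 ⟨k, hk, h2⟩, rfl, rfl⟩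
    · rcases hs : st T (x * k) with _ | ⟨V, u⟩
      · rw [hs] at h2; simp at h2
      have hv := st_valid T (x * k)
      rw [hs] at hv h1
      obtain ⟨t, ht⟩ := exists_tri_of_clique hv.2.1
      obtain ⟨κ, hκ, rfl⟩ := exists_tr_mul_eq (x * k) t
      obtain ⟨k', hk', h3⟩ := exists_st_eq_tail (T := T) (g := x * k * κ)
        (by rw [st_of_mem_cellStab T hκ, hs]) ht
      refine ⟨g₀ * (x * k * κ), g₀ * (x * k), (h _).2 ⟨k', hk', ?_⟩, ?_, ?_⟩
      · rw [h3]; simpa using h1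
      · rw [← mul_assoc, cellOf_mul hκ]
      · rw [← mul_assoc, vertexOf_mul hk]

theorem isBall_cell (g₀ : Flag) (n : ℕ) : IsBall ∅ g₀ (ball (cellVertices (cellOf g₀)) n) n := by
  induction n with
  | succ n ih => exact ih.succ
  | zero =>
    intro x
    constructor
    · rintro ⟨g, h1, h2⟩
      obtain ⟨κ, hκ, rfl⟩ := eq_mul_of_cellOf_eq h2.symm
      obtain ⟨k, hk, h3⟩ := eq_mul_of_vertexOf_eq h1
      rw [mul_assoc, mul_right_inj] at h3
      refine ⟨k⁻¹, inv_mem hk, ?_⟩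
      rw [h3, mul_inv_cancel_right, ← one_mul κ, st_of_mem_cellStab ∅ hκ, st_one]
      simp
    · rintro ⟨k, hk, h1⟩
      have h2 := List.length_eq_zero_iff.1 (Nat.le_zero.1 h1)
      obtain ⟨w, hw, h3⟩ := exists_eq_mul_stackProd ∅ (x * k)
      have h0 : wallGroup ∅ = ⊥ := by simp [wallGroup]
      rw [h0, Subgroup.mem_bot] at hw
      rw [h2, hw, stackProd, one_mul, one_mul] at h3
      refine ⟨g₀ * (x * k), ?_, ?_⟩
      · rw [← mul_assoc, vertexOf_mul hk]
      · rw [h3, cellOf_mul (cellElt_mem _)]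

theorem st_of_mem_vertexStab {k : Flag} (hk : k ∈ vertexStab) : st {0, 1, 2} k = [] := by
  have := vertex_induction (p := fun x => st {0, 1, 2} x = [] ∧ x ∈ vertexStab) 1
    ⟨st_one _, one_mem _⟩ ?_ hk
  · rw [one_mul] at this; exact this.1
  · rintro k hk i hi ⟨h1, h2⟩
    refine ⟨?_, mul_mem h2 (by fin_cases i <;> first | exact absurd rfl hi | exact r_mem (by simp))⟩
    by_cases h3 : i = 3
    · subst h3
      rw [st_mul_r3, h1]
      have h4 := tri_faces_mul h2 1
      rw [one_mul, tr_one, base_faces] at h4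
      have h5 : (tr (1 * k)).a ∈ ({0, 1, 2} : Finset Face) := by
        rw [← h4, one_mul]; simp [Tri.faces]
      simp only [push]
      rw [if_pos h5]
    · rw [st_mul_r _ _ h3, h1]

theorem wallGroup_le : wallGroup {0, 1, 2} ≤ vertexStab := by
  rw [wallGroup, Subgroup.closure_le]
  rintro _ ⟨a, ha, rfl⟩
  have ha' : a ∈ Tri.base.faces := by rw [base_faces]; exact_mod_cast ha
  obtain ⟨w, hw, rfl⟩ := exists_hexWord_a _ ha'
  have h1 : cellElt (w.foldl Tri.flip Tri.base) ∈ vertexStab := by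
    have hl : ∀ w ∈ hexWords, ∀ i ∈ w, i ≠ 3 := by decide
    rw [← cellElt_mul_wd _ (hl w hw), cellElt_base, one_mul]
    exact (hexWords_mem w hw).1
  rw [SetLike.mem_coe, wall_a]
  exact mul_mem (mul_mem h1 (r_mem (by simp))) (inv_mem h1)

theorem exists_eq_of_st_eq_nil {x : Flag} (h : st {0, 1, 2} x = []) :
    ∃ w ∈ vertexStab, x = w * cellElt (tr x) := by
  obtain ⟨w, hw, h1⟩ := exists_eq_mul_stackProd {0, 1, 2} x
  rw [h, stackProd, mul_one] at h1
  exact ⟨w, wallGroup_le hw, h1⟩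

/-- The cells at the seed vertex have level zero, so the index of the ball is one ahead of the
level. The ball of index zero is not described by levels. -/
theorem isBall_vertex (g₀ : Flag) (n : ℕ) : IsBall {0, 1, 2} g₀ (ball {vertexOf g₀} (n + 1)) n := by
  induction n with
  | succ n ih => exact ih.succ
  | zero =>
    intro x
    constructor
    · rintro ⟨g, g', h1, h2, h3⟩
      obtain ⟨k₁, hk₁, rfl⟩ := eq_mul_of_vertexOf_eq (Set.mem_singleton_iff.1 h1).symm
      obtain ⟨κ, hκ, rfl⟩ := eq_mul_of_cellOf_eq h2
      obtain ⟨k, hk, h4⟩ := eq_mul_of_vertexOf_eq h3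
      rw [mul_assoc, mul_assoc, mul_right_inj] at h4
      refine ⟨k⁻¹, inv_mem hk, ?_⟩
      rw [h4, ← mul_assoc, mul_inv_cancel_right, st_of_mem_cellStab _ hκ, st_of_mem_vertexStab hk₁]
      simp
    · rintro ⟨k, hk, h1⟩
      have h2 := List.length_eq_zero_iff.1 (Nat.le_zero.1 h1)
      obtain ⟨w, hw, h3⟩ := exists_eq_of_st_eq_nil h2
      refine ⟨g₀ * w, g₀ * (x * k), ?_, ?_, ?_⟩
      · exact vertexOf_mul hw g₀
      · rw [h3, ← mul_assoc, cellOf_mul (cellElt_mem _)]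
      · rw [← mul_assoc, vertexOf_mul hk]

theorem finite_ball {seed : Set Vertex} (h : seed.Finite) (n : ℕ) : (ball seed n).Finite := by
  induction n with
  | zero => exact h
  | succ n ih =>
    have h1 : (⋃ v ∈ ball seed n, ⋃ w ∈ {w | w ∈ vertexWords}, ⋃ x ∈ {x | x ∈ cellWords},
        ({vertexOf (v.out * wd w * wd x)} : Set Vertex)).Finite :=
      ih.biUnion fun v _ => (List.finite_toSet _).biUnion fun w _ =>
        (List.finite_toSet _).biUnion fun x _ => Set.finite_singleton _
    refine h1.subset ?_
    rintro _ ⟨g, g', h2, h3, rfl⟩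
    obtain ⟨κ, hκ, rfl⟩ := eq_mul_of_cellOf_eq h3
    obtain ⟨x, hx, rfl⟩ := mem_cellStab hκ
    have h4 : vertexOf g = vertexOf (vertexOf g).out := (Quotient.out_eq' _).symm
    obtain ⟨w, hw, h5⟩ := eq_of_vertexOf_eq h4
    simp only [Set.mem_iUnion]
    exact ⟨_, h2, w, hw, x, hx, by rw [← h5]; rfl⟩

theorem finite_cellVertices (c : Cell) : (cellVertices c).Finite := by
  have h1 : (⋃ x ∈ {x | x ∈ cellWords}, ({vertexOf (c.out * wd x)} : Set Vertex)).Finite :=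
    (List.finite_toSet _).biUnion fun x _ => Set.finite_singleton _
  refine h1.subset ?_
  rintro _ ⟨g, rfl, rfl⟩
  have h4 : cellOf (cellOf g).out = cellOf g := Quotient.out_eq' _
  obtain ⟨κ, hκ, h5⟩ := eq_mul_of_cellOf_eq h4
  obtain ⟨x, hx, rfl⟩ := mem_cellStab hκ
  simp only [Set.mem_iUnion]
  exact ⟨x, hx, by rw [← h5]; rfl⟩

end Honeycomb

namespace Honeycomb

/-! ### Layers -/

/-- What is needed to know about the vertices `S` of a layer and the vertices `B` before it. The
flags in `cell` belong to the cells of a certain level; `top g` is the last clique of the cell of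
`g`, and crossing a wall whose type is `near g` does not increase the level. -/
structure Layer (S B : Set Vertex) where
  cell : Flag → Prop
  top : Flag → Finset Face
  near : Flag → Face → Prop
  tri : Flag → Tri
  tri_mul : ∀ g i, tri (g * r i) = (tri g).flip i
  cell_mul : ∀ g, ∀ i ≠ 3, (cell (g * r i) ↔ cell g)
  top_mul : ∀ g, ∀ i ≠ 3, top (g * r i) = top g
  near_mul : ∀ g, ∀ i ≠ 3, near (g * r i) = near g
  disjoint : ∀ v ∈ S, v ∉ B
  mem_iff : ∀ g, cell g → (vertexOf g ∈ S ↔ ¬ ((top g).Nonempty ∧ top g ⊆ (tri g).faces))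
  mem_inner_iff : ∀ g, cell g → (vertexOf g ∈ B ↔ ((top g).Nonempty ∧ top g ⊆ (tri g).faces))
  exists_cell : ∀ g, vertexOf g ∈ S → ∃ k ∈ vertexStab, cell (g * k)
  -- The word reflects in the third face and then runs to the end of the leg opposite to that of
  -- `g`.
  out : ∀ g, cell g → ¬ near g (tri g).c → vertexOf (g * wd [1, 2, 3, 2, 1, 0]) ∉ S ∧
    vertexOf (g * wd [1, 2, 3, 2, 1, 0]) ∉ B
  near_adj : ∀ g x f, near g x → f ∈ top g → f ≠ x → adj x f
  exists_not_adj : ∀ g x, ¬ near g x → (top g).Nonempty → ∃ f ∈ top g, f ≠ x ∧ adj x f = false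
  near_nonempty : ∀ g x, near g x → (top g).Nonempty
  cross : ∀ g, cell g → vertexOf g ∈ S → near g (tri g).a → cell (g * r 3) ∧
    ∀ f ≠ (tri g).a, (f ∈ top (g * r 3) ↔ f ∈ top g)
  deep_adj : ∀ g, ∀ k ∈ cellStab, near g (tri g).a → (tri g).a ∉ top g →
    (tri g).a ∉ top (g * r 3) → near g (tri (g * k)).a → (tri (g * k)).a ∉ top g →
    (tri (g * k)).a ∉ top (g * k * r 3) → (tri g).a = (tri (g * k)).a ∨
      adj (tri g).a (tri (g * k)).a

variable {T : Finset Face}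

/-- The layers are described by the stacks of the cells. -/
def layerOfStacks (hT : IsSeed T) (g₀ : Flag) {S B : Set Vertex} (m : ℕ)
    (hd : ∀ v ∈ S, v ∉ B) (hSB : IsBall T g₀ (S ∪ B) m)
    (hB : ∀ x, (st T x).length = m →
      (vertexOf (g₀ * x) ∈ B ↔ (top T (st T x)).Nonempty ∧ top T (st T x) ⊆ (tr x).faces))
    (hB' : ∀ x, (st T x).length < m → vertexOf (g₀ * x) ∈ B) : Layer S B where
  cell g := (st T (g₀⁻¹ * g)).length = m
  top g := top T (st T (g₀⁻¹ * g))
  near g x := Absorbs T x (st T (g₀⁻¹ * g))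
  tri g := tr (g₀⁻¹ * g)
  tri_mul g i := by rw [← mul_assoc, tr_mul_r]
  cell_mul g i hi := by rw [← mul_assoc, st_mul_r _ _ hi]
  top_mul g i hi := by rw [← mul_assoc, st_mul_r _ _ hi]
  near_mul g i hi := by rw [← mul_assoc, st_mul_r _ _ hi]
  disjoint := hd
  mem_iff g hg := by
    have h1 := hB _ hg
    have h2 := (hSB (g₀⁻¹ * g)).2 ⟨1, one_mem _, by rw [mul_one]; exact hg.le⟩
    rw [mul_inv_cancel_left] at h1 h2
    rw [← h1]
    exact ⟨hd _, fun h => h2.resolve_right h⟩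
  mem_inner_iff g hg := by
    have h1 := hB _ hg
    rwa [mul_inv_cancel_left] at h1
  exists_cell g hg := by
    obtain ⟨k, hk, h1⟩ := (hSB (g₀⁻¹ * g)).1 (by rw [mul_inv_cancel_left]; exact Or.inl hg)
    refine ⟨k, hk, ?_⟩
    rw [← mul_assoc]
    refine le_antisymm h1 (not_lt.1 fun h2 => ?_)
    have h3 := hB' _ h2
    rw [mul_assoc, mul_inv_cancel_left, vertexOf_mul hk] at h3
    exact hd _ hg h3
  out g hg hc := by
    have h2 : st T (g₀⁻¹ * g * wd [1, 2, 3, 2, 1, 0]) =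
        {(tr (g₀⁻¹ * g)).c} :: st T (g₀⁻¹ * g) := by
      rw [st_mul_wd, ← push_of_not_absorbs hc]; rfl
    -- The far end of the leg does not lie on the wall just crossed. The new last clique cannot be
    -- removed there, so every cell at that end has level above `m`.
    have h3 : ({(tr (g₀⁻¹ * g)).c} : Finset Face) ⊆
        (tr (g₀⁻¹ * g * wd [1, 2, 3, 2, 1, 0])).faces → False := by
      rw [tr_mul_wd, Finset.singleton_subset_iff]
      generalize tr (g₀⁻¹ * g) = t
      revert t
      decide +kernel
    rw [← not_or]
    intro h4
    have h5 := (hSB (g₀⁻¹ * (g * wd [1, 2, 3, 2, 1, 0]))).1 (by rw [mul_inv_cancel_left]; exact h4)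
    obtain ⟨k, hk, h6⟩ := h5
    have h7 := (length_le_of_not_subset h2 h3 hk).1
    rw [h2, List.length_cons] at h7
    rw [← mul_assoc] at h6
    omega
  near_adj g x f hx hf hfx := hx.adj hT (st_valid T _) hf hfx
  exists_not_adj g x hx hne := exists_not_adj_of_not_absorbs hT hx hne
  near_nonempty g x hx := hx.top_nonempty (st_valid T _)
  cross g hg hS ha := by
    rw [← mul_assoc, st_mul_r3]
    -- Crossing would lower the level only if the last clique were this single face, but then the
    -- vertex would belong to an earlier layer.
    have hne : top T (st T (g₀⁻¹ * g)) ≠ {(tr (g₀⁻¹ * g)).a} := by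
      intro h
      have h1 := (hB _ hg).2 (by
        rw [h]
        exact ⟨Finset.singleton_nonempty _, by simp [Tri.faces]⟩)
      rw [mul_inv_cancel_left] at h1
      exact hd _ hS h1
    obtain ⟨h1, h2⟩ := push_of_absorbs (st_valid T _) ha hne
    exact ⟨h1.trans hg, h2⟩
  deep_adj g k hk ha ha1 ha2 hb hb1 hb2 := by
    rw [← mul_assoc] at *
    rw [st_mul_r3] at ha2
    rw [← mul_assoc, st_mul_r3, st_of_mem_cellStab T hk] at hb2
    exact adj_of_deep hT (st_valid T _) ha hb ha1 hb1 ha2 hb2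

theorem layer_union_inner (seed : Set Vertex) (n : ℕ) :
    layer seed n ∪ inner seed n = ball seed n ∪ inner seed n := Set.sdiff_union_self

theorem ball_subset_succ (seed : Set Vertex) (n : ℕ) : ball seed n ⊆ ball seed (n + 1) := by
  intro v hv
  have h : vertexOf v.out = v := Quotient.out_eq' v
  exact ⟨v.out, v.out, by rwa [h], rfl, h⟩

theorem layer_union_inner_eq (seed : Set Vertex) (n : ℕ) :
    layer seed n ∪ inner seed n = ball seed n := by
  rw [layer_union_inner, Set.union_eq_left]
  cases n with
  | zero => exact Set.empty_subset _
  | succ n => exact ball_subset_succ seed n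

theorem IsBall.mem_iff {g₀ : Flag} {X : Set Vertex} {m : ℕ} (h : IsBall T g₀ X m) {x : Flag}
    (hx : (st T x).length = m + 1) :
    vertexOf (g₀ * x) ∈ X ↔ (top T (st T x)).Nonempty ∧ top T (st T x) ⊆ (tr x).faces := by
  rcases hs : st T x with _ | ⟨V, u⟩
  · rw [hs] at hx; simp at hx
  have hv := st_valid T x
  rw [hs] at hv
  rw [h x]
  constructor
  · rintro ⟨k, hk, h1⟩
    refine ⟨hv.1, ?_⟩
    by_contra h2
    have := (length_le_of_not_subset hs h2 hk).1
    omega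
  · rintro ⟨-, h1⟩
    obtain ⟨k, hk, h2⟩ := exists_st_eq_tail hs h1
    refine ⟨k, hk, ?_⟩
    rw [hs] at hx
    rw [h2]
    simpa using hx.le

theorem IsBall.mem_of_lt {g₀ : Flag} {X : Set Vertex} {m : ℕ} (h : IsBall T g₀ X m) {x : Flag}
    (hx : (st T x).length < m + 1) : vertexOf (g₀ * x) ∈ X :=
  (h x).2 ⟨1, one_mem _, by rw [mul_one]; omega⟩

theorem exists_layer_cell (c : Cell) (n : ℕ) :
    Nonempty (Layer (layer (cellVertices c) n) (inner (cellVertices c) n)) := by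
  obtain ⟨g₀, rfl⟩ := QuotientGroup.mk_surjective c
  change Nonempty (Layer (layer (cellVertices (cellOf g₀)) n) (inner (cellVertices (cellOf g₀)) n))
  refine ⟨layerOfStacks (Or.inl rfl) g₀ n (fun v hv => hv.2) ?_ ?_ ?_⟩
  · rw [layer_union_inner_eq]; exact isBall_cell g₀ n
  · intro x hx
    cases n with
    -- For a cell as seed `top` is empty at level zero, and no vertex is inner.
    | zero =>
      rw [List.length_eq_zero_iff.1 hx]
      simp [inner, top]
    | succ n => exact (isBall_cell g₀ n).mem_iff hx
  · intro x hx
    cases n with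
    | zero => simp at hx
    | succ n => exact (isBall_cell g₀ n).mem_of_lt hx

theorem cellElt_mem_of_faces {t : Tri} (h : {0, 1, 2} ⊆ t.faces) : cellElt t ∈ vertexStab := by
  have key : ∀ t : Tri, ({0, 1, 2} : Finset Face) ⊆ t.faces →
      ∃ w ∈ hexWords, w.foldl Tri.flip Tri.base = t := by decide +kernel
  obtain ⟨w, hw, rfl⟩ := key t h
  have hl : ∀ w ∈ hexWords, ∀ i ∈ w, i ≠ 3 := by decide
  rw [← cellElt_mul_wd _ (hl w hw), cellElt_base, one_mul]
  exact (hexWords_mem w hw).1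

theorem exists_layer_vertex (v : Vertex) (n : ℕ) :
    Nonempty (Layer (layer {v} (n + 1)) (inner {v} (n + 1))) := by
  obtain ⟨g₀, rfl⟩ := QuotientGroup.mk_surjective v
  change Nonempty (Layer (layer {vertexOf g₀} (n + 1)) (inner {vertexOf g₀} (n + 1)))
  refine ⟨layerOfStacks (Or.inr rfl) g₀ n (fun v hv => hv.2) ?_ ?_ ?_⟩
  · rw [layer_union_inner_eq]; exact isBall_vertex g₀ n
  · intro x hx
    cases n with
    -- At level zero `top` consists of the three walls at the seed vertex, so the inclusion
    -- characterises the seed itself.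
    | zero =>
      have h0 := List.length_eq_zero_iff.1 hx
      rw [h0]
      change vertexOf (g₀ * x) = vertexOf g₀ ↔ ({0, 1, 2} : Finset Face).Nonempty ∧ _
      constructor
      · intro h
        obtain ⟨k, hk, h1⟩ := eq_mul_of_vertexOf_eq h.symm
        rw [mul_right_inj] at h1
        have h2 := tri_faces_mul hk 1
        rw [one_mul, tr_one, base_faces] at h2
        rw [h1, h2]
        exact ⟨⟨0, by decide⟩, subset_rfl⟩
      · rintro ⟨-, h⟩
        obtain ⟨w, hw, h1⟩ := exists_eq_of_st_eq_nil h0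
        rw [h1]
        exact vertexOf_mul (mul_mem hw (cellElt_mem_of_faces h)) g₀
    | succ n => exact (isBall_vertex g₀ n).mem_iff hx
  · intro x hx
    cases n with
    | zero => simp at hx
    | succ n => exact (isBall_vertex g₀ n).mem_of_lt hx

end Honeycomb

/-! ### Legs of a layer: leaving legs, and uniqueness of the incoming one -/

namespace Honeycomb

/-- The passage to the other side of the third face. -/
abbrev rho : Word := [1, 2, 3, 2, 1]

namespace Layer

variable {S B : Set Vertex} (Y : Layer S B) {J : Set Leg}

theorem tri_wd (g : Flag) (w : Word) : Y.tri (g * wd w) = w.foldl Tri.flip (Y.tri g) := by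
  induction w generalizing g with
  | nil => rw [wd_nil, mul_one]; rfl
  | cons i w ih => rw [wd_cons, ← mul_assoc, ih, Y.tri_mul, List.foldl_cons]

theorem cell_wd (g : Flag) {w : Word} (hw : ∀ i ∈ w, i ≠ 3) : Y.cell (g * wd w) ↔ Y.cell g := by
  induction w generalizing g with
  | nil => rw [wd_nil, mul_one]
  | cons i w ih =>
    rw [wd_cons, ← mul_assoc, ih _ fun j hj => hw j (by simp [hj]), Y.cell_mul _ _ (hw i (by simp))]

theorem top_wd (g : Flag) {w : Word} (hw : ∀ i ∈ w, i ≠ 3) : Y.top (g * wd w) = Y.top g := by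
  induction w generalizing g with
  | nil => rw [wd_nil, mul_one]
  | cons i w ih =>
    rw [wd_cons, ← mul_assoc, ih _ fun j hj => hw j (by simp [hj]), Y.top_mul _ _ (hw i (by simp))]

theorem near_wd (g : Flag) {w : Word} (hw : ∀ i ∈ w, i ≠ 3) : Y.near (g * wd w) = Y.near g := by
  induction w generalizing g with
  | nil => rw [wd_nil, mul_one]
  | cons i w ih =>
    rw [wd_cons, ← mul_assoc, ih _ fun j hj => hw j (by simp [hj]), Y.near_mul _ _ (hw i (by simp))]

/-- Crossing a face that is near. -/
theorem cross_wd {g : Flag} (hg : Y.cell g) (hS : vertexOf g ∈ S) (w : Word)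
    (hw : ∀ i ∈ w, i ≠ 3 ∧ i ≠ 0) (hn : Y.near g (Y.tri (g * wd w)).a) :
    Y.cell (g * wd (w ++ 3 :: w.reverse)) ∧ ∀ f ≠ (Y.tri (g * wd w)).a,
      (f ∈ Y.top (g * wd (w ++ 3 :: w.reverse)) ↔ f ∈ Y.top g) := by
  have h1 : ∀ i ∈ w, i ≠ 3 := fun i hi => (hw i hi).1
  have h2 : ∀ i ∈ w.reverse, i ≠ 3 := fun i hi => h1 i (List.mem_reverse.1 hi)
  have h3 : g * wd (w ++ 3 :: w.reverse) = g * wd w * r 3 * wd w.reverse := by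
    rw [wd_append, wd_cons]; simp only [mul_assoc]
  obtain ⟨v, hv, h4⟩ := exists_vertexWord fun i hi => (hw i hi).2
  obtain ⟨h5, h6⟩ := Y.cross (g * wd w) ((Y.cell_wd g h1).2 hg)
    (by rw [h4, vertexOf_wd hv]; exact hS) (by rw [Y.near_wd g h1]; exact hn)
  rw [h3, Y.cell_wd _ h2, Y.top_wd _ h2]
  rw [Y.top_wd g h1] at h6
  exact ⟨h5, h6⟩

theorem exists_mem_of_mem {g : Flag} (hg : Y.cell g) (hS : vertexOf g ∈ S)
    (hne : (Y.top g).Nonempty) : ∃ f ∈ Y.top g, f ∉ (Y.tri g).faces := by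
  have h := (Y.mem_iff g hg).1 hS
  exact Finset.not_subset.1 fun h' => h ⟨hne, h'⟩

theorem mem_of_notMem_faces {g : Flag} (hg : Y.cell g) {f : Face} (hf : f ∈ Y.top g)
    (hf' : f ∉ (Y.tri g).faces) : vertexOf g ∈ S :=
  (Y.mem_iff g hg).2 fun h => hf' (h.2 hf)

theorem vertexOf_of_legOf_eq {g h : Flag} (e : legOf g = legOf h) : vertexOf g = vertexOf h ∧
    vertexOf (g * r 0) = vertexOf (h * r 0) := by
  obtain ⟨w, hw, rfl⟩ := eq_of_legOf_eq e
  have h1 := wd_mem_legStab w hw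
  refine ⟨vertexOf_mul (legStab_le h1) h, ?_⟩
  rw [mul_assoc, legStab_comm_r0 h1, ← mul_assoc, vertexOf_mul (legStab_le h1)]

theorem leaves_congr {g h : Flag} (e : legOf g = legOf h) : Leaves S J g ↔ Leaves S J h := by
  obtain ⟨h1, h2⟩ := vertexOf_of_legOf_eq e
  rw [Leaves, Leaves, e, h1, h2]

theorem enters_congr {g h : Flag} (e : legOf g = legOf h) : Enters S J g ↔ Enters S J h := by
  obtain ⟨h1, h2⟩ := vertexOf_of_legOf_eq e
  rw [Enters, Enters, e, h1, h2]

theorem legOf_of_inLeg (g : Flag) {v w : Word} (h : inLeg (v.reverse ++ w) = true) :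
    legOf (g * wd v) = legOf (g * wd w) := by
  have h2 := wd_mem_of_inLeg h
  rw [wd_append, wd_reverse] at h2
  rw [legOf, legOf, QuotientGroup.eq]
  simpa [mul_assoc] using h2

theorem leaves_rho (hJ : ∀ g, legOf g ∈ J ↔ vertexOf (g * r 0) ∈ B)
    {g : Flag} (hg : Y.cell g) (hS : vertexOf g ∈ S)
    (hn : ¬ Y.near g (Y.tri g).c) : Leaves S J (g * wd rho) := by
  have h1 := Y.out g hg hn
  rw [show ([1, 2, 3, 2, 1, 0] : Word) = rho ++ [0] from rfl, wd_append, wd_singleton,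
    ← mul_assoc] at h1
  refine ⟨?_, h1.1, fun h => h1.2 ((hJ _).1 h)⟩
  obtain ⟨v, hv, h4⟩ := exists_vertexWord (w := rho) (by decide)
  rw [h4, vertexOf_wd hv]
  exact hS

/-- Three legs of a vertex are edges of the given cell, and the other three are their antipodes,
reached by reflection in the third face. -/
theorem exists_hexWord (g z : Flag) (h : vertexOf z = vertexOf g) : ∃ p ∈ hexWords,
    legOf z = legOf (g * wd p) ∨ legOf z = legOf (g * wd (p ++ rho)) := by
  obtain ⟨w, hw, rfl⟩ := eq_of_vertexOf_eq h
  have key : ∀ w ∈ vertexWords, ∃ p ∈ hexWords, inLeg (w.reverse ++ p) = true ∨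
      inLeg (w.reverse ++ (p ++ rho)) = true := by decide +kernel
  obtain ⟨p, hp, h1⟩ := key w hw
  exact ⟨p, hp, h1.imp (legOf_of_inLeg g) (legOf_of_inLeg g)⟩

theorem hexWords_letters : ∀ p ∈ hexWords, ∀ i ∈ p, i ≠ 3 ∧ i ≠ 0 := by decide

/-- Every leg at a vertex of the layer is a leg of a cell of the layer, or leaves. -/
theorem leaves_or_exists (hJ : ∀ g, legOf g ∈ J ↔ vertexOf (g * r 0) ∈ B)
    {z : Flag} (hz : vertexOf z ∈ S) : Leaves S J z ∨
    ∃ x, Y.cell x ∧ legOf x = legOf z := by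
  obtain ⟨k, hk, hx⟩ := Y.exists_cell z hz
  have hv := vertexOf_mul hk z
  obtain ⟨p, hp, h | h⟩ := exists_hexWord (z * k) z hv.symm
  · exact Or.inr ⟨_, (Y.cell_wd _ fun i hi => (hexWords_letters p hp i hi).1).2 hx, h.symm⟩
  · have hp3 : ∀ i ∈ p, i ≠ 3 := fun i hi => (hexWords_letters p hp i hi).1
    have hc := (Y.cell_wd (z * k) hp3).2 hx
    have hS : vertexOf (z * k * wd p) ∈ S := by
      rw [vertexOf_mul (hexWords_mem p hp).1, hv]; exact hz
    rw [wd_append, ← mul_assoc] at h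
    by_cases hn : Y.near (z * k * wd p) (Y.tri (z * k * wd p)).c
    · refine Or.inr ⟨_, (Y.cross_wd hc hS [1, 2] (by decide) ?_).1, h.symm⟩
      rw [Y.tri_wd]; exact hn
    · exact Or.inl ((leaves_congr h).2 (Y.leaves_rho hJ hc hS hn))

theorem not_enters_of_leaves {z : Flag} (h : Leaves S J z) : ¬ Enters S J z :=
  fun h' => h.2.2 h'.2.2

theorem face_other (t : Tri) : adj t.a (other t.a t.b t.c) ∧ adj t.b (other t.a t.b t.c) ∧
    other t.a t.b t.c ≠ t.c ∧ adj t.c (other t.a t.b t.c) = false := by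
  have := tri_other _ _ _ t.ab t.ac t.bc
  exact ⟨this.1, this.2.1, this.2.2.2.1, this.2.2.2.2⟩

theorem faces_hexWord : ∀ t : Tri, ∀ p ∈ hexWords, p ≠ [] → p ≠ [2] →
    other t.a t.b t.c ∉ ((p.foldl Tri.flip t).flip 0).faces ∧ other t.a t.b t.c ∉ t.faces ∧
      other t.a t.b t.c ≠ (p.foldl Tri.flip t).c := by
  decide +kernel

/-- The face at the other end of the leg of `x` belongs to the last clique, but it touches the far
end of none of the other legs along the cell, nor of those reached through a near face. Such a leg
cannot end in an earlier layer, and legs through far faces leave. -/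
theorem enters_unique_aux (hJ : ∀ g, legOf g ∈ J ↔ vertexOf (g * r 0) ∈ B)
    {x z : Flag} (hx : Y.cell x) (hS : vertexOf x ∈ S)
    (hc : other (Y.tri x).a (Y.tri x).b (Y.tri x).c ∈ Y.top x) (hv : vertexOf z = vertexOf x)
    (hz : Enters S J z) : legOf z = legOf x := by
  obtain ⟨p, hp, h⟩ := exists_hexWord x z hv
  have hp3 : ∀ i ∈ p, i ≠ 3 := fun i hi => (hexWords_letters p hp i hi).1
  have hcp := (Y.cell_wd x hp3).2 hx
  have hSp : vertexOf (x * wd p) ∈ S := by rwa [vertexOf_mul (hexWords_mem p hp).1]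
  have hB : vertexOf (z * r 0) ∈ B := (hJ z).1 hz.2.2
  have hin : ∀ y, Y.cell y → legOf z = legOf y → Y.top y ⊆ ((Y.tri y).flip 0).faces := by
    intro y hy h
    rw [(vertexOf_of_legOf_eq h).2, Y.mem_inner_iff _ ((Y.cell_mul y 0 (by decide)).2 hy),
      Y.top_mul y 0 (by decide), Y.tri_mul] at hB
    exact hB.2
  by_cases hp0 : p = [] ∨ p = [2]
  · have h2 : legOf (x * wd p) = legOf x := by
      rcases hp0 with rfl | rfl
      · rw [wd_nil, mul_one]
      · rw [wd_singleton]; exact legOf_mul (r_mem (by simp)) x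
    rcases h with h | h
    · exact h.trans h2
    · exfalso
      rw [wd_append, ← mul_assoc] at h
      have h3 : ¬ Y.near (x * wd p) (Y.tri (x * wd p)).c := by
        rw [Y.near_wd x hp3, Y.tri_wd]
        intro h3
        obtain ⟨-, -, h4, h5⟩ := face_other (Y.tri x)
        have h6 : (p.foldl Tri.flip (Y.tri x)).c = (Y.tri x).c := by
          rcases hp0 with rfl | rfl <;> rfl
        rw [h6] at h3
        have := Y.near_adj x _ _ h3 hc h4
        rw [h5] at this
        exact Bool.false_ne_true this
      exact not_enters_of_leaves ((leaves_congr h).2 (Y.leaves_rho hJ hcp hSp h3)) hz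
  · exfalso
    rw [not_or] at hp0
    obtain ⟨h1, h2, h3⟩ := faces_hexWord (Y.tri x) p hp hp0.1 hp0.2
    rcases h with h | h
    · have := hin _ hcp h
      rw [Y.top_wd x hp3, Y.tri_wd] at this
      exact h1 (this hc)
    · rw [wd_append, ← mul_assoc] at h
      by_cases hn : Y.near (x * wd p) (Y.tri (x * wd p)).c
      · obtain ⟨h4, h5⟩ := Y.cross_wd hcp hSp [1, 2] (by decide) (by rw [Y.tri_wd _ [1, 2]]; exact hn)
        have h6 := hin _ h4 h
        have h7 := (h5 (other (Y.tri x).a (Y.tri x).b (Y.tri x).c) (by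
          rw [Y.tri_wd _ [1, 2], Y.tri_wd]; exact h3)).2 (by rwa [Y.top_wd x hp3])
        have h8 := h6 h7
        rw [Y.tri_wd, Y.tri_wd] at h8
        exact h1 h8
      · exact not_enters_of_leaves ((leaves_congr h).2 (Y.leaves_rho hJ hcp hSp hn)) hz

/-- At most one leg of a vertex leads to an earlier layer. -/
theorem enters_unique (Y : Layer S B) (hJ : ∀ g, legOf g ∈ J ↔ vertexOf (g * r 0) ∈ B)
    {y z : Flag} (hy : Enters S J y) (hz : Enters S J z)
    (hv : vertexOf z = vertexOf y) : legOf z = legOf y := by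
  rcases Y.leaves_or_exists hJ hy.1 with h | ⟨x, hx, hl⟩
  · exact absurd hy (not_enters_of_leaves h)
  · obtain ⟨h1, h2⟩ := vertexOf_of_legOf_eq hl
    have hS : vertexOf x ∈ S := by rw [h1]; exact hy.1
    have hB : vertexOf (x * r 0) ∈ B := by rw [h2]; exact (hJ y).1 hy.2.2
    rw [Y.mem_inner_iff _ ((Y.cell_mul x 0 (by decide)).2 hx), Y.top_mul x 0 (by decide),
      Y.tri_mul] at hB
    rw [← hl]
    refine Y.enters_unique_aux hJ hx hS ?_ (hv.trans h1.symm) hz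
    -- The last clique fits into the faces at the far end of an incoming leg but not into those at
    -- the vertex itself; hence it contains the one new face at the far end.
    obtain ⟨f, hf, hf'⟩ := Y.exists_mem_of_mem hx hS hB.1
    have h3 := hB.2 hf
    simp only [Tri.faces, Tri.flip, Tri.a, Tri.b, Tri.c, Finset.mem_insert,
      Finset.mem_singleton] at h3 hf'
    push Not at hf'
    rcases h3 with h3 | h3 | h3
    · exact absurd h3 hf'.1
    · exact absurd h3 hf'.2.1
    · rw [h3] at hf; exact hf

end Layer

end Honeycomb

/-! ### Antipodal pairing: the equations along axes -/

namespace Honeycomb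

theorem antipode_comm {k : Flag} (hk : k ∈ legStab) : k * antipode = antipode * k := by
  obtain ⟨w, hw, rfl⟩ := mem_legStab hk
  rw [antipode_eq, ← wd_append, ← wd_append, wd_eq_iff]
  clear hk
  revert w hw
  decide +kernel

theorem legOf_mul_antipode (g : Flag) : legOf (g * antipode) = legOf (g * wd rho) := by
  rw [antipode_eq]
  exact Layer.legOf_of_inLeg g (by decide +kernel)

theorem mul_wd_wd (g : Flag) (v w : Word) : g * wd v * wd w = g * wd (v ++ w) := by
  rw [wd_append, mul_assoc]

/-- What the criterion for isometry gives for a vertex tensor whose antipodal qubits are paired. -/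
structure AxisSolution (e : Pairing) (S : Set Vertex) (J : Set Leg) (D : Flag → ZMod 2) :
    Prop where
  zero : ∀ g, vertexOf g ∉ S → D g = 0
  pair : ∀ g, D (g * antipode) = D g
  leaves : ∀ g, Leaves S J g → D g = 0
  block : ∀ g, vertexOf g ∈ S → ¬ Enters S J g → ¬ Enters S J (g * antipode) →
    ¬ Enters S J (g * r 1) → ¬ Enters S J (g * r 1 * antipode) →
    D (g * e.twist) + D (g * antipode * e.twist) =
      D (g * r 1 * e.twist) + D (g * r 1 * antipode * e.twist)

/-- `D` vanishes on the leg of `g`. -/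
def ZeroAt (D : Flag → ZMod 2) (g : Flag) : Prop := ∀ k ∈ legStab, D (g * k) = 0

/-- The leg of `g` does not enter, and `D` vanishes at its other end. -/
def Settled (S : Set Vertex) (J : Set Leg) (D : Flag → ZMod 2) (g : Flag) : Prop :=
  ¬ Enters S J g ∧ ZeroAt D (g * r 0)

namespace AxisSolution

variable {e : Pairing} {S B : Set Vertex} {J : Set Leg} {D : Flag → ZMod 2}

theorem _root_.Honeycomb.ZeroAt.congr {g h : Flag} (hz : ZeroAt D h) (hl : legOf g = legOf h) :
    ZeroAt D g := by
  obtain ⟨w, hw, rfl⟩ := eq_of_legOf_eq hl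
  intro k hk
  rw [mul_assoc]
  exact hz _ (mul_mem (wd_mem_legStab w hw) hk)

theorem _root_.Honeycomb.Settled.congr {g h : Flag} (hz : Settled S J D h)
    (hl : legOf g = legOf h) : Settled S J D g := by
  refine ⟨fun h1 => hz.1 ((Layer.enters_congr hl).1 h1), hz.2.congr ?_⟩
  obtain ⟨w, hw, rfl⟩ := eq_of_legOf_eq hl
  have h1 := wd_mem_legStab w hw
  rw [mul_assoc, legStab_comm_r0 h1, ← mul_assoc, legOf_mul h1]

theorem zeroAt_of_notMem (hD : AxisSolution e S J D) {g : Flag} (h : vertexOf g ∉ S) :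
    ZeroAt D g :=
  fun k hk => hD.zero _ (by rwa [vertexOf_mul (legStab_le hk)])

theorem zeroAt_of_leaves (hD : AxisSolution e S J D) {g : Flag} (h : Leaves S J g) :
    ZeroAt D g :=
  fun _ hk => hD.leaves _ ((Layer.leaves_congr (legOf_mul hk g)).2 h)

theorem settled_of_leaves (hD : AxisSolution e S J D) {g : Flag} (h : Leaves S J g) :
    Settled S J D g :=
  ⟨Layer.not_enters_of_leaves h, hD.zeroAt_of_notMem h.2.1⟩

theorem zeroAt_mul_antipode (hD : AxisSolution e S J D) {g : Flag}
    (h : ZeroAt D (g * antipode)) : ZeroAt D g := by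
  intro k hk
  rw [← hD.pair, mul_assoc, antipode_comm hk, ← mul_assoc]
  exact h k hk

theorem _root_.Honeycomb.Settled.twist {z : Flag} (hz : Settled S J D z) (e : Pairing) :
    D (z * e.twist) = 0 := by
  obtain ⟨k, hk, h⟩ := e.exists_twist
  rw [h, ← mul_assoc]
  exact hz.2 k hk

/-- In the block equation at the flag matched with `x * k` three terms vanish and leave `D (x * k)`.
Which perpendicular axis appears there depends on `k` and on the twist, so both are required to be
settled. -/
theorem zeroAt_of_settled (hD : AxisSolution e S J D) {x : Flag}
    (hx : ¬ Enters S J (x * r 0)) (hw : vertexOf (x * r 0) ∈ S)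
    (h0 : Settled S J D (x * r 0 * antipode))
    (h1 : Settled S J D (x * r 0 * wd [1]) ∧ Settled S J D (x * r 0 * wd [1] * antipode))
    (h2 : Settled S J D (x * r 0 * wd [2, 1]) ∧ Settled S J D (x * r 0 * wd [2, 1] * antipode)) :
    ZeroAt D x := by
  intro k hk
  obtain ⟨k', hk', ht⟩ := e.exists_twist
  obtain ⟨w, hwl, hkw⟩ := mem_legStab (mul_mem hk hk')
  have hu : x * k * e.twist = x * r 0 * wd w := by
    rw [← hkw, ht, ← mul_assoc, mul_assoc x, legStab_comm_r0 hk]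
    simp only [mul_assoc]
  have hl : legOf (x * r 0 * wd w) = legOf (x * r 0) := legOf_mul (hkw ▸ mul_mem hk hk') _
  -- After a symmetry of the leg, `r 1` leads to one of the two perpendicular axes, in one of its
  -- two directions.
  have key : ∀ w ∈ legWords, (inLeg (([1] : Word).reverse ++ (w ++ [1])) = true ∧
        inLeg (([1] ++ antipodeWord).reverse ++ (w ++ [1] ++ antipodeWord)) = true) ∨
      (inLeg (([1] ++ antipodeWord).reverse ++ (w ++ [1])) = true ∧
        inLeg (([1] : Word).reverse ++ (w ++ [1] ++ antipodeWord)) = true) ∨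
      (inLeg (([2, 1] : Word).reverse ++ (w ++ [1])) = true ∧
        inLeg (([2, 1] ++ antipodeWord).reverse ++ (w ++ [1] ++ antipodeWord)) = true) ∨
      (inLeg (([2, 1] ++ antipodeWord).reverse ++ (w ++ [1])) = true ∧
        inLeg (([2, 1] : Word).reverse ++ (w ++ [1] ++ antipodeWord)) = true) := by
    decide +kernel
  have hside : Settled S J D (x * r 0 * wd w * r 1) ∧
      Settled S J D (x * r 0 * wd w * r 1 * antipode) := by
    rw [antipode_eq, mul_wd_wd] at h1 h2
    rw [antipode_eq, ← wd_singleton 1, mul_wd_wd, mul_wd_wd]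
    rcases key w hwl with h | h | h | h
    · exact ⟨h1.1.congr (Layer.legOf_of_inLeg _ h.1).symm, h1.2.congr (Layer.legOf_of_inLeg _ h.2).symm⟩
    · exact ⟨h1.2.congr (Layer.legOf_of_inLeg _ h.1).symm, h1.1.congr (Layer.legOf_of_inLeg _ h.2).symm⟩
    · exact ⟨h2.1.congr (Layer.legOf_of_inLeg _ h.1).symm, h2.2.congr (Layer.legOf_of_inLeg _ h.2).symm⟩
    · exact ⟨h2.2.congr (Layer.legOf_of_inLeg _ h.1).symm, h2.1.congr (Layer.legOf_of_inLeg _ h.2).symm⟩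
  have hη : Settled S J D (x * r 0 * wd w * antipode) := by
    refine h0.congr ?_
    rw [mul_assoc _ (wd w), antipode_comm (wd_mem_legStab w hwl), ← mul_assoc]
    exact legOf_mul (wd_mem_legStab w hwl) _
  have := hD.block (x * r 0 * wd w) ?_ ?_ hη.1 hside.1.1 hside.2.1
  · rw [hη.twist, hside.1.twist, hside.2.twist, ← hu, mul_assoc, Pairing.twist_mul_twist,
      mul_one] at this
    simpa using this
  · rwa [vertexOf_mul (legStab_le (wd_mem_legStab w hwl))]
  · rwa [Layer.enters_congr hl]

end AxisSolution

end Honeycomb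

/-! ### Antipodal pairing: vanishing on the legs of a layer -/

namespace Honeycomb

namespace Tri

/-- The faces at the two ends of an edge are not adjacent, and their only common neighbours are the
two faces along the edge. -/
theorem antipodal_faces : ∀ (t : Tri) (f : Face), f ∉ (t.flip 0).faces →
    (f = t.c ∨ adj t.c f) → (f = (t.flip 0).c ∨ adj (t.flip 0).c f) → False := by
  decide +kernel

/-- The three faces at the other end of the third edge at the other end of the edge of `t`. -/
def next (t : Tri) : Tri := ((t.flip 0).flip 1).flip 0

theorem notMem_faces_next : ∀ (t : Tri) (f : Face), f ∉ t.faces → adj t.c f →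
    f ∉ t.next.faces := by
  decide +kernel

theorem c_notMem_faces_next : ∀ t : Tri, t.c ∉ t.next.faces ∧ t.next.c ≠ t.c ∧
    adj t.next.c t.c = false ∧ t.c ≠ t.b ∧ t.next.c ≠ t.b ∧ t.c ≠ (t.flip 0).c ∧
    adj (t.flip 0).c t.c = false := by
  decide +kernel

theorem not_adj_b : ∀ (t : Tri) (f : Face), f ∉ t.faces → adj t.c f → adj t.next.c f →
    adj t.b f = false := by
  decide +kernel

end Tri

namespace Layer

variable {e : Pairing} {S B : Set Vertex} {J : Set Leg} {D : Flag → ZMod 2}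

theorem not_enters (Y : Layer S B) (hJ : ∀ g, legOf g ∈ J ↔ vertexOf (g * r 0) ∈ B) {g : Flag}
    (hg : Y.cell g) {f : Face} (hf : f ∈ Y.top g) (hf' : f ∉ ((Y.tri g).flip 0).faces) :
    ¬ Enters S J g := by
  intro h
  have h1 := (hJ g).1 h.2.2
  rw [Y.mem_inner_iff _ ((Y.cell_mul g 0 (by decide)).2 hg), Y.top_mul g 0 (by decide),
    Y.tri_mul] at h1
  exact hf' (h1.2 hf)

/-- The antipodal leg runs through a far face and leaves; pairing transfers the vanishing. -/
theorem zeroAt_of_not_near (Y : Layer S B) (hJ : ∀ g, legOf g ∈ J ↔ vertexOf (g * r 0) ∈ B)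
    (hD : AxisSolution e S J D) {x : Flag} (hx : Y.cell x) (hn : ¬ Y.near x (Y.tri x).c) :
    ZeroAt D x := by
  by_cases hS : vertexOf x ∈ S
  · exact hD.zeroAt_mul_antipode
      ((hD.zeroAt_of_leaves (Y.leaves_rho hJ hx hS hn)).congr (legOf_mul_antipode x))
  · exact hD.zeroAt_of_notMem hS

/-- Both legs on the axis of the third edge at the other end are settled, if this holds on the
side of the cell. -/
theorem settled_axis (Y : Layer S B) (hJ : ∀ g, legOf g ∈ J ↔ vertexOf (g * r 0) ∈ B)
    (hD : AxisSolution e S J D) {x : Flag} (hx : Y.cell x) (hS : vertexOf (x * r 0) ∈ S)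
    {f : Face} (hf : f ∈ Y.top x) (hfb : f ≠ (Y.tri x).b) (hf' : f ∉ (Y.tri x).next.faces)
    (hz : ZeroAt D (x * wd [0, 1] * r 0))
    (hn : ∀ z, Y.cell z → Y.tri z = Y.tri (x * wd [0, 1]) → f ∈ Y.top z →
      Y.near x (Y.tri x).b → ZeroAt D (z * r 0)) :
    Settled S J D (x * r 0 * wd [1]) ∧ Settled S J D (x * r 0 * wd [1] * antipode) := by
  have h01 : x * r 0 * wd [1] = x * wd [0, 1] := by rw [← wd_singleton 0, mul_wd_wd]; rfl
  rw [h01]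
  have hc : Y.cell (x * wd [0, 1]) := (Y.cell_wd x (by decide)).2 hx
  have ht : Y.tri (x * wd [0, 1]) = ((Y.tri x).flip 0).flip 1 := Y.tri_wd _ _
  have htop : Y.top (x * wd [0, 1]) = Y.top x := Y.top_wd x (by decide)
  have hnear : Y.near (x * wd [0, 1]) = Y.near x := Y.near_wd x (by decide)
  have hSw : vertexOf (x * wd [0, 1]) ∈ S := by
    rw [← h01, wd_singleton, vertexOf_mul (r_mem (by simp))]; exact hS
  refine ⟨⟨Y.not_enters hJ hc (htop ▸ hf) (by rw [ht]; exact hf'), hz⟩, ?_⟩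
  by_cases hb : Y.near x (Y.tri x).b
  · have hcr := Y.cross_wd hc hSw [1, 2] (by decide) (by rw [Y.tri_wd, hnear, ht]; exact hb)
    have ht' : Y.tri (x * wd [0, 1] * wd rho) = Y.tri (x * wd [0, 1]) := by
      rw [Y.tri_wd, ht]; generalize Y.tri x = t; revert t; decide +kernel
    have hf2 : f ∈ Y.top (x * wd [0, 1] * wd rho) := by
      refine (hcr.2 f ?_).2 (htop ▸ hf)
      rw [Y.tri_wd, ht]; exact hfb
    refine Settled.congr ⟨Y.not_enters hJ hcr.1 hf2 ?_, ?_⟩ (legOf_mul_antipode _)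
    · change f ∉ ((Y.tri (x * wd [0, 1] * wd rho)).flip 0).faces
      rw [ht', ht]; exact hf'
    · exact hn _ hcr.1 ht' hf2 hb
  · exact (hD.settled_of_leaves (Y.leaves_rho hJ hc hSw (by rw [ht, hnear]; exact hb))).congr
      (legOf_mul_antipode _)

theorem eq_or_adj (Y : Layer S B) {g : Flag} {x f : Face} (hx : Y.near g x) (hf : f ∈ Y.top g) :
    f = x ∨ adj x f :=
  or_iff_not_imp_left.2 fun h => Y.near_adj g x f hx hf h

theorem not_near (Y : Layer S B) {g : Flag} {x f : Face} (hf : f ∈ Y.top g) (h : x ≠ f)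
    (h' : adj x f = false) : ¬ Y.near g x := by
  intro hx
  rw [Y.near_adj g x f hx hf h.symm] at h'
  exact Bool.false_ne_true h'.symm

theorem mem_of_near (Y : Layer S B) {x : Flag} (hx : Y.cell x) (hS : vertexOf x ∈ S)
    (hn : Y.near x (Y.tri x).c) : vertexOf (x * r 0) ∈ S := by
  obtain ⟨f, hf, hf'⟩ := Y.exists_mem_of_mem hx hS (Y.near_nonempty x _ hn)
  by_cases h : f ∈ (Y.tri (x * r 0)).faces
  · exfalso
    have h1 := Y.eq_or_adj hn hf
    rw [Y.tri_mul] at h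
    have key : ∀ (t : Tri) (f : Face), f ∉ t.faces → f ∈ (t.flip 0).faces → (f = t.c ∨ adj t.c f) →
        False := by decide +kernel
    exact key _ f hf' h h1
  · exact Y.mem_of_notMem_faces ((Y.cell_mul x 0 (by decide)).2 hx)
      ((Y.top_mul x 0 (by decide)).symm ▸ hf) h

/-- The last clique contains a face not at the far vertex. If both end faces were near, that face
would be a common neighbour excluded by `Tri.antipodal_faces`. -/
theorem not_near_other (Y : Layer S B) {x : Flag} (hx : Y.cell x) (hS : vertexOf (x * r 0) ∈ S)
    (hn : Y.near x (Y.tri x).c) : ¬ Y.near x ((Y.tri x).flip 0).c := by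
  intro hc'
  obtain ⟨g, hg, hg'⟩ := Y.exists_mem_of_mem ((Y.cell_mul x 0 (by decide)).2 hx) hS (by
    rw [Y.top_mul x 0 (by decide)]; exact Y.near_nonempty x _ hn)
  rw [Y.top_mul x 0 (by decide)] at hg
  rw [Y.tri_mul] at hg'
  exact Tri.antipodal_faces _ g hg' (Y.eq_or_adj hn hg) (Y.eq_or_adj hc' hg)

/-- The leg of `x` vanishes, if the third edges at its other end behave well. -/
theorem zeroAt_of_settled (Y : Layer S B) (hJ : ∀ g, legOf g ∈ J ↔ vertexOf (g * r 0) ∈ B)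
    (hD : AxisSolution e S J D) {x : Flag} (hx : Y.cell x) (hS : vertexOf x ∈ S)
    (hn : Y.near x (Y.tri x).c) {p : Flag → Prop} (hp : p x) (hp2 : p x → p (x * r 2))
    (h : ∀ x, p x → Y.cell x → vertexOf x ∈ S → Y.near x (Y.tri x).c → vertexOf (x * r 0) ∈ S →
      Settled S J D (x * r 0 * wd [1]) ∧ Settled S J D (x * r 0 * wd [1] * antipode)) :
    ZeroAt D x := by
  have hw := Y.mem_of_near hx hS hn
  have hc' := Y.not_near_other hx hw hn
  have hx0 : Y.cell (x * r 0) := (Y.cell_mul x 0 (by decide)).2 hx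
  rw [← Y.near_mul x 0 (by decide), ← Y.tri_mul] at hc'
  have h02 : x * r 0 * r 2 = x * r 2 * r 0 := by
    rw [mul_assoc, r_comm_of_eq_two (i := 0) (j := 2) rfl, ← mul_assoc]
  have h2 : x * r 0 * wd [2, 1] = x * r 2 * r 0 * wd [1] := by
    rw [← h02, wd_cons, mul_assoc _ (r 2)]
  have hv2 : ∀ y, vertexOf (y * r 2) = vertexOf y := fun y => vertexOf_mul (r_mem (by simp)) y
  refine hD.zeroAt_of_settled (fun h => Y.disjoint _ hS ?_) hw
    ((hD.settled_of_leaves (Y.leaves_rho hJ hx0 hw hc')).congr (legOf_mul_antipode _))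
    (h x hp hx hS hn hw) ?_
  · have := (hJ _).1 h.2.2
    rwa [mul_assoc, r_sq, mul_one] at this
  · rw [h2]
    refine h _ (hp2 hp) ((Y.cell_mul x 2 (by decide)).2 hx) ((hv2 x).symm ▸ hS) ?_ ?_
    · rw [Y.near_mul x 2 (by decide), Y.tri_mul]; exact hn
    · rw [← h02, hv2]; exact hw

/-- The face met at the end of a third edge at the far vertex is not adjacent to the third face of
`x`. As the latter is in the last clique, the former is far, and `D` vanishes there; the same holds
after crossing the second face. -/
theorem zeroAt_of_mem (Y : Layer S B) (hJ : ∀ g, legOf g ∈ J ↔ vertexOf (g * r 0) ∈ B)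
    (hD : AxisSolution e S J D) {x : Flag} (hx : Y.cell x) (hS : vertexOf x ∈ S)
    (hc : (Y.tri x).c ∈ Y.top x) : ZeroAt D x := by
  by_cases hn : Y.near x (Y.tri x).c
  · refine Y.zeroAt_of_settled hJ hD hx hS hn (p := fun x => (Y.tri x).c ∈ Y.top x) hc ?_ ?_
    · intro h
      rw [Y.tri_mul, Y.top_mul x 2 (by decide)]; exact h
    · intro x hc hx hS hn hw
      obtain ⟨h1, h2, h3, h4, -⟩ := Tri.c_notMem_faces_next (Y.tri x)
      have hz : ∀ z, Y.cell z → Y.tri z = Y.tri (x * wd [0, 1]) → (Y.tri x).c ∈ Y.top z →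
          ZeroAt D (z * r 0) := by
        intro z hz ht hf
        refine Y.zeroAt_of_not_near hJ hD ((Y.cell_mul z 0 (by decide)).2 hz) ?_
        rw [Y.near_mul z 0 (by decide), Y.tri_mul, ht, Y.tri_wd]
        exact Y.not_near hf h2 h3
      exact Y.settled_axis hJ hD hx hw hc h4 h1 (hz _ ((Y.cell_wd x (by decide)).2 hx) rfl
        ((Y.top_wd x (w := [0, 1]) (by decide)).symm ▸ hc)) fun z h1 h2 h3 _ => hz z h1 h2 h3
  · exact Y.zeroAt_of_not_near hJ hD hx hn

theorem tri_rho (Y : Layer S B) (x : Flag) : Y.tri (x * wd rho) = Y.tri x := by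
  rw [Y.tri_wd]; generalize Y.tri x = t; revert t; decide +kernel

/-- Reflection in the third face passes to the antipodal leg, where `zeroAt_of_mem` applies. -/
theorem zeroAt_of_mem_rho (Y : Layer S B) (hJ : ∀ g, legOf g ∈ J ↔ vertexOf (g * r 0) ∈ B)
    (hD : AxisSolution e S J D) {x : Flag} (hx : Y.cell x)
    (hn : Y.near x (Y.tri x).c) (hc : (Y.tri x).c ∈ Y.top (x * wd rho)) : ZeroAt D x := by
  by_cases hS : vertexOf x ∈ S
  · have hcr := Y.cross_wd hx hS [1, 2] (by decide) (by rw [Y.tri_wd]; exact hn)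
    refine hD.zeroAt_mul_antipode ((Y.zeroAt_of_mem hJ hD hcr.1 ?_ ?_).congr (legOf_mul_antipode x))
    · obtain ⟨v, hv, h4⟩ := exists_vertexWord (w := rho) (by decide)
      change vertexOf (x * wd rho) ∈ S
      rw [h4, vertexOf_wd hv]
      exact hS
    · change (Y.tri (x * wd rho)).c ∈ Y.top (x * wd rho)
      rwa [Y.tri_rho]
  · exact hD.zeroAt_of_notMem hS

theorem top_rho (Y : Layer S B) (x : Flag) : Y.top (x * wd rho) = Y.top (x * wd [1, 2] * r 3) := by
  rw [← Y.top_wd (x * wd [1, 2] * r 3) (w := [2, 1]) (by decide), ← wd_singleton 3, mul_wd_wd,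
    mul_wd_wd]
  rfl

/-- After the previous cases the third face is near but belongs to the last clique on neither side
of its wall, so it passes below that clique. A face `f` of the clique away from the vertex then
serves as a witness: it prevents the third edges at the far end from entering, and controls the face
at their other ends. -/
theorem zeroAt_of_cell (Y : Layer S B) (hJ : ∀ g, legOf g ∈ J ↔ vertexOf (g * r 0) ∈ B)
    (hD : AxisSolution e S J D) {x : Flag} (hx : Y.cell x) (hS : vertexOf x ∈ S) :
    ZeroAt D x := by
  by_cases hn : Y.near x (Y.tri x).c
  swap
  · exact Y.zeroAt_of_not_near hJ hD hx hn
  by_cases hc : (Y.tri x).c ∈ Y.top x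
  · exact Y.zeroAt_of_mem hJ hD hx hS hc
  by_cases hc2 : (Y.tri x).c ∈ Y.top (x * wd rho)
  · exact Y.zeroAt_of_mem_rho hJ hD hx hn hc2
  refine Y.zeroAt_of_settled hJ hD hx hS hn
    (p := fun x => (Y.tri x).c ∉ Y.top x ∧ (Y.tri x).c ∉ Y.top (x * wd rho)) ⟨hc, hc2⟩ ?_ ?_
  · intro h
    have h1 : x * r 2 * wd rho = x * wd rho * r 2 := by
      rw [mul_assoc, mul_assoc, ← wd_singleton 2, ← wd_append, ← wd_append]
      congr 1
      rw [wd_eq_iff]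
      decide +kernel
    rw [h1, Y.tri_mul, Y.top_mul _ 2 (by decide), Y.top_mul _ 2 (by decide)]
    exact h
  · rintro x ⟨hc, hc2⟩ hx hS hn hw
    obtain ⟨f, hf, hf'⟩ := Y.exists_mem_of_mem hx hS (Y.near_nonempty x _ hn)
    have hcf : adj (Y.tri x).c f := (Y.eq_or_adj hn hf).resolve_left fun h => hc (h ▸ hf)
    obtain ⟨h1, h2, h3, h4, h5, -⟩ := Tri.c_notMem_faces_next (Y.tri x)
    have hfb : f ≠ (Y.tri x).b := fun h => hf' (by rw [h]; simp [Tri.faces])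
    have hf2 := Tri.notMem_faces_next _ f hf' hcf
    refine Y.settled_axis hJ hD hx hw hf hfb hf2 ?_ ?_
    · rw [← wd_singleton 0, mul_wd_wd]
      have hq : Y.cell (x * wd ([0, 1] ++ [0])) := (Y.cell_wd x (by decide)).2 hx
      have hqt : Y.tri (x * wd ([0, 1] ++ [0])) = (Y.tri x).next := Y.tri_wd _ _
      have hqn : Y.near (x * wd ([0, 1] ++ [0])) = Y.near x := Y.near_wd x (by decide)
      by_cases hb : Y.near x (Y.tri x).next.c
      · refine Y.zeroAt_of_mem_rho hJ hD hq (by rw [hqn, hqt]; exact hb) ?_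
        -- Otherwise the third face and the new face would both pass below the last clique, which
        -- forces them to be equal or adjacent.
        by_contra hb2
        rw [hqt] at hb2
        have hk : x * wd [1, 2] * wd [2, 1, 0, 1, 0, 1, 2] = x * wd ([0, 1] ++ [0]) * wd [1, 2] := by
          rw [mul_wd_wd, mul_wd_wd]
          congr 1
          rw [wd_eq_iff]
          decide +kernel
        have hta : (Y.tri (x * wd [1, 2])).a = (Y.tri x).c := by rw [Y.tri_wd]; rfl
        have htb : (Y.tri (x * wd ([0, 1] ++ [0]) * wd [1, 2])).a = (Y.tri x).next.c := by
          rw [Y.tri_wd, hqt]; rfl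
        have htop : Y.top (x * wd [1, 2]) = Y.top x := Y.top_wd x (by decide)
        have hnear : Y.near (x * wd [1, 2]) = Y.near x := Y.near_wd x (by decide)
        have := Y.deep_adj (x * wd [1, 2]) (wd [2, 1, 0, 1, 0, 1, 2])
          (wd_mem_cellStab (by decide)) (by rwa [hnear, hta]) (by rwa [htop, hta])
          (by rwa [← Y.top_rho, hta]) (by rwa [hk, hnear, htb]) (by
            rw [hk, htop, htb]
            intro h
            have := Y.eq_or_adj hn h
            rw [adj_comm, h3] at this
            exact this.elim h2 Bool.false_ne_true)
          (by rwa [hk, ← Y.top_rho, htb])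
        rw [hk, hta, htb, adj_comm, h3] at this
        exact this.elim (fun h => h2 h.symm) Bool.false_ne_true
      · exact Y.zeroAt_of_not_near hJ hD hq (by rw [hqn, hqt]; exact hb)
    · intro z hz ht hfz hb
      refine Y.zeroAt_of_not_near hJ hD ((Y.cell_mul z 0 (by decide)).2 hz) ?_
      rw [Y.near_mul z 0 (by decide), Y.tri_mul, ht, Y.tri_wd]
      intro h6
      -- A neighbour `f` of the third face and of the new face, away from the vertex, is not
      -- adjacent to the second face; but the second face is near.
      have h7 := Tri.not_adj_b _ f hf' hcf ((Y.eq_or_adj h6 hfz).resolve_left fun h =>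
        hf2 (by rw [h]; simp [Tri.faces, Tri.next, Tri.flip, Tri.c]))
      rw [(Y.eq_or_adj hb hf).resolve_left hfb] at h7
      exact Bool.false_ne_true h7.symm

theorem axisSolution_eq_zero (Y : Layer S B) (hJ : ∀ g, legOf g ∈ J ↔ vertexOf (g * r 0) ∈ B)
    (hD : AxisSolution e S J D) (g : Flag) : D g = 0 := by
  by_cases hg : vertexOf g ∈ S
  · rcases Y.leaves_or_exists hJ hg with h | ⟨x, hx, h⟩
    · exact hD.leaves g h
    · have h1 := (Y.zeroAt_of_cell hJ hD hx (by rwa [(vertexOf_of_legOf_eq h).1])).congr h.symm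
      simpa using h1 1 (one_mem _)
  · exact hD.zero g hg

theorem isometry_antipode {C : Construction} {N m : ℕ} (Y : Layer S B)
    (hJ : ∀ g, legOf g ∈ J ↔ vertexOf (g * r 0) ∈ B) (hfin : S.Finite) (hC : C.HasShape N m)
    (hN : 0 < N) (hm : 0 < m) (hη : C.PairedBy antipode) (h1 : r 1 ∈ C.block) (e : Pairing) :
    C.ClusterIsometry e S J := by
  have hv : ∀ {w : Word}, (∀ i ∈ w, i ≠ 0) → ∀ g, vertexOf (g * wd w) = vertexOf g := by
    intro w hw g
    obtain ⟨v, hv, h⟩ := exists_vertexWord hw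
    rw [h, vertexOf_wd hv]
  have hne : ∀ {v w : Word}, (∀ i ∈ v, i ≠ 0) → (∀ i ∈ w, i ≠ 0) → inLeg (v.reverse ++ w) = false →
      ∀ g, Enters S J (g * wd v) → ¬ Enters S J (g * wd w) := fun hv' hw' h g h2 h3 =>
    legOf_ne g h (Y.enters_unique hJ h3 h2 ((hv hv' g).trans (hv hw' g).symm))
  refine Construction.clusterIsometry_of hC hN hm hη e hfin J ?_ ?_ ?_
  · intro g h
    rw [antipode_eq]
    exact hne (v := []) (by simp) (by decide) (by decide +kernel) g (by rwa [wd_nil, mul_one])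
  · intro g _
    -- At most one leg enters, so of two different axes of the block one is free.
    by_cases h : Enters S J (g * wd []) ∨ Enters S J (g * wd antipodeWord)
    · refine ⟨wd [1], by rwa [wd_singleton], ?_⟩
      rw [antipode_eq, mul_wd_wd]
      rcases h with h | h
      · exact ⟨hne (by simp) (by decide) (by decide +kernel) g h,
          hne (by simp) (by decide) (by decide +kernel) g h⟩
      · exact ⟨hne (by decide) (by decide) (by decide +kernel) g h,
          hne (by decide) (by decide) (by decide +kernel) g h⟩
    · rw [not_or, wd_nil] at h
      exact ⟨1, one_mem _, h.1, by rw [mul_one, antipode_eq]; exact h.2⟩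
  · intro D h2 h3 h4 h5
    exact Y.axisSolution_eq_zero hJ (e := e) ⟨h2, fun g => h3 g _ hη.mem, h4,
      fun g hg => h5 g hg _ h1⟩

end Layer

end Honeycomb

/-! ### Hexagons: the equations and their basic consequences -/

namespace Honeycomb

/-- The twist of the inversion pairing. -/
abbrev invWord : Word := [0, 2, 3, 2, 3]

theorem inversion_twist : Pairing.inversion.twist = wd invWord := by
  rw [Pairing.twist_eq]

/-- What the criterion for isometry gives for the omnitruncated octahedron. -/
structure HexSolution {S B : Set Vertex} (Y : Layer S B) (J : Set Leg) (D : Flag → ZMod 2) :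
    Prop where
  mem : ∀ g, legOf g ∈ J ↔ vertexOf (g * r 0) ∈ B
  zero : ∀ g, vertexOf g ∉ S → D g = 0
  pair : ∀ g, D (g * wd [1, 2, 1]) = D g
  leaves : ∀ g, Leaves S J g → D g = 0
  block : ∀ g, vertexOf g ∈ S → ∀ i : Fin 4, i = 1 ∨ i = 2 → ¬ Enters S J g →
    ¬ Enters S J (g * wd [1, 2, 1]) → ¬ Enters S J (g * wd [i]) →
    ¬ Enters S J (g * wd [i, 1, 2, 1]) →
    D (g * wd invWord) + D (g * wd ([1, 2, 1] ++ invWord)) =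
      D (g * wd ([i] ++ invWord)) + D (g * wd ([i, 1, 2, 1] ++ invWord))

/-- The leg of `g` does not enter, and `D` vanishes at the flag matched with `g`. -/
def Silent (S : Set Vertex) (J : Set Leg) (D : Flag → ZMod 2) (g : Flag) : Prop :=
  ¬ Enters S J g ∧ D (g * wd invWord) = 0

namespace HexSolution

variable {S B : Set Vertex} {Y : Layer S B} {J : Set Leg} {D : Flag → ZMod 2}

theorem _root_.Honeycomb.vertexOf_mul_invWord (g : Flag) :
    vertexOf (g * wd invWord) = vertexOf (g * r 0) := by
  rw [← inversion_twist, vertexOf_mul_twist]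

theorem silent_of_leaves (hD : HexSolution Y J D) {g : Flag} (h : Leaves S J g) :
    Silent S J D g :=
  ⟨Layer.not_enters_of_leaves h, hD.zero _ (by rw [vertexOf_mul_invWord]; exact h.2.1)⟩

/-- The block equation at the flag matched with `g * wd v`, where the three other terms are silent.
That flag itself does not enter, since its leg leads back to `S`. -/
theorem eq_zero_of_silent (hD : HexSolution Y J D) {g : Flag} (v : Word) {i : Fin 4}
    (hi : i = 1 ∨ i = 2) (hv : inLeg v = true) (hS : vertexOf g ∈ S)
    (hS0 : vertexOf (g * r 0) ∈ S) (h1 : Silent S J D (g * wd (v ++ invWord ++ [1, 2, 1])))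
    (h2 : Silent S J D (g * wd (v ++ invWord ++ [i])))
    (h3 : Silent S J D (g * wd (v ++ invWord ++ [i, 1, 2, 1]))) : D (g * wd v) = 0 := by
  have hl : legOf (g * wd v) = legOf g := legOf_mul (wd_mem_of_inLeg hv) g
  obtain ⟨hl1, hl2⟩ := Layer.vertexOf_of_legOf_eq hl
  have ht : g * wd (v ++ invWord) * wd invWord = g * wd v := by
    rw [wd_append, ← inversion_twist, ← mul_assoc, mul_assoc _ _ (Pairing.twist _),
      Pairing.twist_mul_twist, mul_one]
  rw [← mul_wd_wd] at h1 h2 h3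
  have := hD.block (g * wd (v ++ invWord)) ?_ i hi ?_ h1.1 h2.1 h3.1
  · rw [ht, ← mul_wd_wd _ [1, 2, 1], ← mul_wd_wd _ [i], ← mul_wd_wd _ [i, 1, 2, 1], h1.2, h2.2, h3.2] at this
    simpa using this
  · rw [← mul_wd_wd, vertexOf_mul_invWord, hl2]; exact hS0
  · intro h
    have h4 := (hD.mem _).1 h.2.2
    rw [← vertexOf_mul_invWord, ht, hl1] at h4
    exact Y.disjoint _ hS h4

/-- Here and below `q` leads to a cell of the layer, `p` moves inside that cell, and `v` names the
flag in question; equality of legs is checked on words. A far face also shows that the vertex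
reached belongs to `S`. -/
theorem leaves_of_not_near (hD : HexSolution Y J D) {g : Flag} (q p v : Word)
    (hc : Y.cell (g * wd q)) (hp : ∀ i ∈ p, i ≠ 3)
    (h : inLeg (v.reverse ++ (q ++ p ++ rho)) = true)
    (hn : ¬ Y.near (g * wd q) ((q ++ p).foldl Tri.flip (Y.tri g)).c) :
    Leaves S J (g * wd v) := by
  refine (Layer.leaves_congr (Layer.legOf_of_inLeg g h)).2 ?_
  have hcp : Y.cell (g * wd (q ++ p)) := by
    rw [← mul_wd_wd]; exact (Y.cell_wd _ hp).2 hc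
  rw [← mul_wd_wd]
  have hn' : ¬ Y.near (g * wd (q ++ p)) (Y.tri (g * wd (q ++ p))).c := by
    rw [Y.tri_wd]
    rwa [← mul_wd_wd, Y.near_wd _ hp]
  refine Y.leaves_rho hD.mem hcp ((Y.mem_iff _ hcp).2 ?_) hn'
  rintro ⟨h1, h2⟩
  obtain ⟨f, hf, h3, h4⟩ := Y.exists_not_adj _ _ hn' h1
  rw [Tri.adj_of_mem _ (by simp [Tri.faces]) (h2 hf) h3.symm] at h4
  exact Bool.false_ne_true h4.symm

theorem silent_of_not_near (hD : HexSolution Y J D) {g : Flag} (q p v : Word)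
    (hc : Y.cell (g * wd q)) (hp : ∀ i ∈ p, i ≠ 3)
    (h : inLeg (v.reverse ++ (q ++ p ++ rho)) = true)
    (hn : ¬ Y.near (g * wd q) ((q ++ p).foldl Tri.flip (Y.tri g)).c) :
    Silent S J D (g * wd v) :=
  hD.silent_of_leaves (hD.leaves_of_not_near q p v hc hp h hn)

theorem eq_zero_of_not_near (hD : HexSolution Y J D) {g : Flag} (q p v : Word)
    (hc : Y.cell (g * wd q)) (hp : ∀ i ∈ p, i ≠ 3)
    (h : inLeg ((v ++ [1, 2, 1]).reverse ++ (q ++ p ++ rho)) = true)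
    (hn : ¬ Y.near (g * wd q) ((q ++ p).foldl Tri.flip (Y.tri g)).c) :
    D (g * wd v) = 0 := by
  rw [← hD.pair, mul_wd_wd]
  exact hD.leaves _ (hD.leaves_of_not_near q p _ hc hp h hn)

theorem not_enters_of_mem (hD : HexSolution Y J D) {g : Flag} (q p v : Word)
    (hc : Y.cell (g * wd q)) (hp : ∀ i ∈ p, i ≠ 3) (h : inLeg (v.reverse ++ (q ++ p)) = true)
    {f : Face} (hf : f ∈ Y.top (g * wd q))
    (hf' : f ∉ (((q ++ p).foldl Tri.flip (Y.tri g)).flip 0).faces) :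
    ¬ Enters S J (g * wd v) := by
  have hcp : Y.cell (g * wd (q ++ p)) := by
    rw [← mul_wd_wd]; exact (Y.cell_wd _ hp).2 hc
  rw [Layer.enters_congr (Layer.legOf_of_inLeg g h)]
  refine Y.not_enters hD.mem hcp (f := f) ?_ (by rwa [Y.tri_wd])
  rwa [← mul_wd_wd, Y.top_wd _ hp]

/-- A far face at the far end has a non-neighbour in the last clique, so the clique does not fit
into the faces there. If the clique is empty, no vertex of the cell is inner. -/
theorem not_enters_of_not_near (hD : HexSolution Y J D) {g : Flag} (q p v : Word)
    (hc : Y.cell (g * wd q)) (hp : ∀ i ∈ p, i ≠ 3) (h : inLeg (v.reverse ++ (q ++ p)) = true)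
    {x : Face} (hx : x ∈ (((q ++ p).foldl Tri.flip (Y.tri g)).flip 0).faces)
    (hn : ¬ Y.near (g * wd q) x) : ¬ Enters S J (g * wd v) := by
  by_cases ht : (Y.top (g * wd q)).Nonempty
  · obtain ⟨f, hf, h1, h2⟩ := Y.exists_not_adj _ _ hn ht
    refine hD.not_enters_of_mem q p v hc hp h hf fun h3 => ?_
    rw [Tri.adj_of_mem _ hx h3 h1.symm] at h2
    exact Bool.false_ne_true h2.symm
  · intro h1
    have h2 := ((Layer.enters_congr (Layer.legOf_of_inLeg g h)).1 h1).2.2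
    have hcp : Y.cell (g * wd (q ++ p)) := by
      rw [← mul_wd_wd]; exact (Y.cell_wd _ hp).2 hc
    rw [hD.mem, Y.mem_inner_iff _ ((Y.cell_mul _ 0 (by decide)).2 hcp),
      Y.top_mul _ 0 (by decide), ← mul_wd_wd, Y.top_wd _ hp] at h2
    exact ht h2.1

theorem _root_.Honeycomb.Layer.mem_of_not_near (Y : Layer S B) {g : Flag} (hg : Y.cell g)
    {x : Face} (hx : x ∈ (Y.tri g).faces) (hn : ¬ Y.near g x) : vertexOf g ∈ S := by
  refine (Y.mem_iff g hg).2 fun h => ?_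
  obtain ⟨f, hf, h1, h2⟩ := Y.exists_not_adj _ _ hn h.1
  rw [Tri.adj_of_mem _ hx (h.2 hf) h1.symm] at h2
  exact Bool.false_ne_true h2.symm

theorem _root_.Honeycomb.Layer.mem_mul_of_not_near (Y : Layer S B) {g : Flag} (hg : Y.cell g)
    {x : Face} (hx : x ∈ ((Y.tri g).flip 0).faces) (hn : ¬ Y.near g x) :
    vertexOf (g * r 0) ∈ S :=
  Y.mem_of_not_near ((Y.cell_mul g 0 (by decide)).2 hg) (by rwa [Y.tri_mul])
    (by rwa [Y.near_mul g 0 (by decide)])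

/-- A face that is not near stays so when an adjacent wall is crossed. -/
theorem _root_.Honeycomb.Layer.not_near_cross (Y : Layer S B) {g : Flag} (hg : Y.cell g)
    (hS : vertexOf g ∈ S) (w : Word) (hw : ∀ i ∈ w, i ≠ 3 ∧ i ≠ 0) {x : Face}
    (hn : Y.near g (w.foldl Tri.flip (Y.tri g)).a) (hx : ¬ Y.near g x)
    (h : adj x (w.foldl Tri.flip (Y.tri g)).a = true) : ¬ Y.near (g * wd (w ++ 3 :: w.reverse)) x := by
  rw [← Y.tri_wd] at hn h
  obtain ⟨f, hf, h1, h2⟩ := Y.exists_not_adj _ _ hx (Y.near_nonempty _ _ hn)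
  refine Y.not_near (((Y.cross_wd hg hS w hw hn).2 f ?_).2 hf) h1.symm h2
  rintro rfl
  rw [h] at h2
  exact Bool.false_ne_true h2.symm

theorem eq_zero_congr {g : Flag} {v w : Word} (h : code v = code w) (hw : D (g * wd w) = 0) :
    D (g * wd v) = 0 := by
  rwa [wd_eq_iff.2 h]

theorem eq_zero_pair (hD : HexSolution Y J D) {g : Flag} {v w : Word}
    (h : code (v ++ [1, 2, 1]) = code w) (hw : D (g * wd w) = 0) : D (g * wd v) = 0 := by
  rw [← hD.pair, mul_wd_wd]
  exact eq_zero_congr h hw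

theorem mem_faces (t : Tri) : t.a ∈ t.faces ∧ t.b ∈ t.faces ∧ t.c ∈ t.faces := by
  simp [Tri.faces]

/-- `D` vanishes on a leg between two faces that are not near. -/
theorem eq_zero_of_not_near_ab (hD : HexSolution Y J D) {g : Flag} (hg : Y.cell g)
    (ha : ¬ Y.near g (Y.tri g).a) (hb : ¬ Y.near g (Y.tri g).b) : D g = 0 := by
  have hS := Y.mem_of_not_near hg (mem_faces _).1 ha
  have hS0 := Y.mem_mul_of_not_near hg (x := (Y.tri g).a) (by exact (mem_faces _).1) ha
  have e : g * wd [] = g := by rw [wd_nil, mul_one]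
  have hg' : Y.cell (g * wd []) := by rwa [e]
  rw [← e]
  refine hD.eq_zero_of_silent [] (i := 1) (Or.inl rfl) (by decide +kernel) hS hS0 ?_ ?_ ?_
  · exact hD.silent_of_not_near [] [0, 2, 1] _ hg' (by decide) (by decide +kernel) (by rw [e]; exact ha)
  · exact hD.silent_of_not_near [] [0, 1] _ hg' (by decide) (by decide +kernel) (by rw [e]; exact hb)
  · exact hD.silent_of_not_near [] [0, 2, 1] _ hg' (by decide) (by decide +kernel) (by rw [e]; exact ha)

end HexSolution

end Honeycomb

/-! ### Hexagons: flags with two far faces along the edge -/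

namespace Honeycomb

namespace Tri

theorem other_side : ∀ (t : Tri) (f : Face), t.a ≠ f → adj t.a f = false →
    (f = (t.flip 0).c ∨ adj (t.flip 0).c f) → (f = t.next.c ∨ adj t.next.c f) →
    (t.c ≠ f ∧ adj t.c f = false) ∧ ¬ ((f = ((((t.flip 1).flip 2).flip 1).flip 0).c ∨
      adj ((((t.flip 1).flip 2).flip 1).flip 0).c f) ∧
      (f = (((t.flip 1).flip 2).flip 1).next.c ∨ adj (((t.flip 1).flip 2).flip 1).next.c f)) := by
  decide +kernel

theorem adj_next : ∀ t : Tri, adj t.a (t.flip 0).c = true ∧ adj t.next.c (t.flip 0).c = true := by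
  decide +kernel

/-- A face adjacent to the first and the third face, but not to the second one. -/
theorem eq_of_adj_ac : ∀ (t : Tri) (f : Face), t.b ≠ f → adj t.b f = false →
    (f = t.a ∨ adj t.a f) → (f = t.c ∨ adj t.c f) →
    f ≠ t.a ∧ f ≠ t.c ∧ (t.flip 0).c ≠ f ∧ adj (t.flip 0).c f = false ∧ f ∉ t.next.faces := by
  decide +kernel

theorem not_adj_next : ∀ (t : Tri) (f : Face), t.a ≠ f → adj t.a f = false →
    (f = t.b ∨ adj t.b f) → (f = (t.flip 0).c ∨ adj (t.flip 0).c f) → t.next.c ≠ f ∧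
    adj t.next.c f = false := by
  decide +kernel

theorem eq_of_adj_bc : ∀ (t : Tri) (f : Face), t.a ≠ f → adj t.a f = false →
    (f = t.b ∨ adj t.b f) → (f = t.c ∨ adj t.c f) →
    f ≠ t.b ∧ (t.flip 0).c ≠ f ∧ adj (t.flip 0).c f = false := by
  decide +kernel

theorem not_all : ∀ (t : Tri) (f : Face), f ∉ t.faces → (f = t.a ∨ adj t.a f) →
    (f = t.b ∨ adj t.b f) → (f = t.c ∨ adj t.c f) → False := by
  decide +kernel

end Tri

namespace HexSolution

variable {S B : Set Vertex} {Y : Layer S B} {J : Set Leg} {D : Flag → ZMod 2}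

theorem eq_zero_of_not_near_ab' (hD : HexSolution Y J D) {g : Flag} (q p : Word)
    (hc : Y.cell (g * wd q)) (hp : ∀ i ∈ p, i ≠ 3)
    (ha : ¬ Y.near (g * wd q) ((q ++ p).foldl Tri.flip (Y.tri g)).a)
    (hb : ¬ Y.near (g * wd q) ((q ++ p).foldl Tri.flip (Y.tri g)).b) :
    D (g * wd (q ++ p)) = 0 := by
  have hcp : Y.cell (g * wd (q ++ p)) := by
    rw [← mul_wd_wd]; exact (Y.cell_wd _ hp).2 hc
  refine hD.eq_zero_of_not_near_ab hcp ?_ ?_ <;>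
  · rw [Y.tri_wd, ← mul_wd_wd, Y.near_wd _ hp]
    assumption

theorem mul_wd_nil (g : Flag) : g * wd [] = g := by rw [wd_nil, mul_one]

/-- The block equation for `r 2` across the second wall. The one term that is not settled by the far
faces directly is handled by crossing the end face of the edge, if that face is near. -/
theorem eq_zero_across_aux (hD : HexSolution Y J D) {g : Flag} (hg : Y.cell g)
    (ha : ¬ Y.near g (Y.tri g).a) (hb : ¬ Y.near g (Y.tri g).b)
    (h : ¬ (Y.near g ((Y.tri g).flip 0).c ∧ Y.near g (Y.tri g).next.c)) :
    D (g * wd [2, 3, 2]) = 0 := by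
  have hS := Y.mem_of_not_near hg (mem_faces _).1 ha
  have hS0 := Y.mem_mul_of_not_near hg (x := (Y.tri g).a) (by exact (mem_faces _).1) ha
  have e : g * wd [] = g := mul_wd_nil g
  have hg' : Y.cell (g * wd []) := by rwa [e]
  rw [← e] at ha hb h
  refine hD.eq_zero_of_silent [2, 3, 2] (i := 2) (Or.inr rfl) (by decide +kernel) hS hS0
    ?_ ⟨?_, ?_⟩ ⟨?_, ?_⟩
  · exact hD.silent_of_not_near [] [0, 2, 1] _ hg' (by decide) (by decide +kernel) (by rwa [e] at ha ⊢)
  · exact hD.not_enters_of_not_near [] [0] _ hg' (by decide) (by decide +kernel)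
      (x := (Y.tri g).a) (by exact (mem_faces _).1) (by rwa [e] at ha ⊢)
  · rw [mul_wd_wd]
    exact hD.eq_zero_of_not_near [] [1, 2] _ hg' (by decide) (by decide +kernel) (by rwa [e] at hb ⊢)
  · exact hD.not_enters_of_not_near [] [0, 1, 2] _ hg' (by decide) (by decide +kernel)
      (x := (Y.tri g).a) (by exact (mem_faces _).2.1) (by rwa [e] at ha ⊢)
  · rw [mul_wd_wd]
    by_cases hc : Y.near g ((Y.tri g).flip 0).c
    -- Beyond the wall of the near end face, the first face and the next end face both stay far,
    -- because they are adjacent to the wall crossed. This gives a flag with two far faces along its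
    -- edge.
    · have hy : Y.cell (g * wd [0, 1, 0, 2]) := (Y.cell_wd g (by decide)).2 hg
      have hyn : Y.near (g * wd [0, 1, 0, 2]) = Y.near g := Y.near_wd g (by decide)
      have hyt : Y.tri (g * wd [0, 1, 0, 2]) = (Y.tri g).next.flip 2 := Y.tri_wd _ _
      have hyS : vertexOf (g * wd [0, 1, 0, 2]) ∈ S :=
        Y.mem_of_not_near hy (x := (Y.tri g).a) (by rw [hyt]; exact (mem_faces _).2.1)
          (by rwa [hyn, ← e])
      have hn := h
      rw [e, not_and] at hn
      have hya : Y.near (g * wd [0, 1, 0, 2]) (([] : Word).foldl Tri.flip (Y.tri (g * wd [0, 1, 0, 2]))).a := by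
        rw [hyn, hyt]; exact hc
      have hcr := Y.cross_wd hy hyS [] (by decide) (by rw [mul_wd_nil]; exact hya)
      have h1 := Y.not_near_cross hy hyS [] (by decide) hya (x := (Y.tri g).a) (by rwa [hyn, ← e])
        (by rw [hyt]; exact (Tri.adj_next (Y.tri g)).1)
      have h2 := Y.not_near_cross hy hyS [] (by decide) hya (x := (Y.tri g).next.c)
        (by rw [hyn]; exact hn hc) (by rw [hyt]; exact (Tri.adj_next (Y.tri g)).2)
      rw [mul_wd_wd] at hcr h1 h2
      refine hD.eq_zero_pair (w := [0, 1, 0, 2, 3] ++ [1, 2, 1]) (by decide +kernel) ?_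
      exact hD.eq_zero_of_not_near_ab' [0, 1, 0, 2, 3] [1, 2, 1] hcr.1 (by decide) h2 h1
    · exact hD.eq_zero_of_not_near [] [0, 1, 0, 1, 2] _ hg' (by decide) (by decide +kernel)
        (by rw [e]; exact hc)

/-- If the condition of `eq_zero_across_aux` fails, a face of the last clique shows that it holds
for the opposite corner of the hexagon, whose first and third faces are exchanged. -/
theorem eq_zero_across_of_not_near_ab (hD : HexSolution Y J D) {g : Flag} (hg : Y.cell g)
    (ha : ¬ Y.near g (Y.tri g).a) (hb : ¬ Y.near g (Y.tri g).b) :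
    D (g * wd [2, 3, 2]) = 0 := by
  by_cases h : Y.near g ((Y.tri g).flip 0).c ∧ Y.near g (Y.tri g).next.c
  · obtain ⟨f, hf, h1, h2⟩ := Y.exists_not_adj _ _ ha (Y.near_nonempty _ _ h.1)
    obtain ⟨h3, h4⟩ := Tri.other_side _ f h1.symm h2 (Y.eq_or_adj h.1 hf) (Y.eq_or_adj h.2 hf)
    have hgh : Y.cell (g * wd [1, 2, 1]) := (Y.cell_wd g (by decide)).2 hg
    have hn : Y.near (g * wd [1, 2, 1]) = Y.near g := Y.near_wd g (by decide)
    have ht : Y.tri (g * wd [1, 2, 1]) = (((Y.tri g).flip 1).flip 2).flip 1 := Y.tri_wd _ _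
    refine hD.eq_zero_pair (w := [1, 2, 1] ++ [2, 3, 2]) (by decide +kernel) ?_
    rw [← mul_wd_wd]
    refine hD.eq_zero_across_aux hgh ?_ ?_ ?_
    · rw [hn, ht]; exact Y.not_near hf h3.1 h3.2
    · rw [hn, ht]; exact hb
    · rw [hn, ht]
      exact fun h5 => h4 ⟨Y.eq_or_adj h5.1 hf, Y.eq_or_adj h5.2 hf⟩
  · exact hD.eq_zero_across_aux hg ha hb h

theorem eq_zero_across_of_not_near_ab' (hD : HexSolution Y J D) {g : Flag} (q p : Word)
    (hc : Y.cell (g * wd q)) (hp : ∀ i ∈ p, i ≠ 3)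
    (ha : ¬ Y.near (g * wd q) ((q ++ p).foldl Tri.flip (Y.tri g)).a)
    (hb : ¬ Y.near (g * wd q) ((q ++ p).foldl Tri.flip (Y.tri g)).b) :
    D (g * wd (q ++ p ++ [2, 3, 2])) = 0 := by
  have hcp : Y.cell (g * wd (q ++ p)) := by
    rw [← mul_wd_wd]; exact (Y.cell_wd _ hp).2 hc
  rw [← mul_wd_wd]
  refine hD.eq_zero_across_of_not_near_ab hcp ?_ ?_ <;>
  · rw [Y.tri_wd, ← mul_wd_wd, Y.near_wd _ hp]
    assumption

end HexSolution

end Honeycomb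

/-! ### Hexagons: the remaining combinations of near and far faces -/

namespace Honeycomb

namespace HexSolution

variable {S B : Set Vertex} {Y : Layer S B} {J : Set Leg} {D : Flag → ZMod 2}

theorem cross_a {g : Flag} (Y : Layer S B) (hg : Y.cell g) (hS : vertexOf g ∈ S)
    (ha : Y.near g (Y.tri g).a) : Y.cell (g * wd [3]) ∧ ∀ f ∈ Y.top g, f ≠ (Y.tri g).a →
      f ∈ Y.top (g * wd [3]) := by
  have h := Y.cross_wd hg hS [] (by decide) (by rwa [mul_wd_nil])
  rw [mul_wd_nil] at h
  exact ⟨h.1, fun f hf hfa => (h.2 f hfa).2 hf⟩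

theorem cross_b {g : Flag} (Y : Layer S B) (hg : Y.cell g) (hS : vertexOf g ∈ S)
    (hb : Y.near g (Y.tri g).b) : Y.cell (g * wd [2, 3, 2]) ∧ ∀ f ∈ Y.top g, f ≠ (Y.tri g).b →
      f ∈ Y.top (g * wd [2, 3, 2]) := by
  have ht : (Y.tri (g * wd [2])).a = (Y.tri g).b := by rw [Y.tri_wd]; rfl
  have h := Y.cross_wd hg hS [2] (by decide) (by rwa [ht])
  rw [ht] at h
  exact ⟨h.1, fun f hf hfa => (h.2 f hfa).2 hf⟩

/-- A face `f` of the last clique that makes the second face far is a common neighbour of the first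
and the third. It survives crossing the first wall, and it also makes the end face far, on both
sides of that wall. -/
theorem eq_zero_across_of_near_ac (hD : HexSolution Y J D) {g : Flag} (hg : Y.cell g)
    (ha : Y.near g (Y.tri g).a) (hb : ¬ Y.near g (Y.tri g).b) (hc : Y.near g (Y.tri g).c) :
    D (g * wd [2, 3, 2]) = 0 := by
  have hS := Y.mem_of_not_near hg (mem_faces _).2.1 hb
  have hS0 := Y.mem_mul_of_not_near hg (x := (Y.tri g).b) (by exact (mem_faces _).2.1) hb
  obtain ⟨f, hf, h1, h2⟩ := Y.exists_not_adj _ _ hb (Y.near_nonempty _ _ ha)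
  obtain ⟨h3, h4, h5, h6, h7⟩ := Tri.eq_of_adj_ac _ f h1.symm h2 (Y.eq_or_adj ha hf)
    (Y.eq_or_adj hc hf)
  obtain ⟨hga, hta⟩ := cross_a Y hg hS ha
  have hfa := hta f hf h3
  have hba := Y.not_near hfa h1.symm h2
  have hca := Y.not_near hfa h5 h6
  have hc' := Y.not_near hf h5 h6
  have e : g * wd [] = g := mul_wd_nil g
  have hg' : Y.cell (g * wd []) := by rwa [e]
  refine hD.eq_zero_of_silent [2, 3, 2] (i := 2) (Or.inr rfl) (by decide +kernel) hS hS0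
    ⟨?_, ?_⟩ ⟨?_, ?_⟩ ⟨?_, ?_⟩
  · exact hD.not_enters_of_not_near [3] [0, 2, 1] _ hga (by decide) (by decide +kernel)
      (x := (Y.tri g).b) (by exact (mem_faces _).1) hba
  · rw [mul_wd_wd]
    exact hD.eq_zero_of_not_near [3] [0, 2, 1, 0, 1] _ hga (by decide) (by decide +kernel) hca
  · exact hD.not_enters_of_not_near [] [0] _ hg' (by decide) (by decide +kernel)
      (x := (Y.tri g).b) (by exact (mem_faces _).2.1) (by rw [e]; exact hb)
  · rw [mul_wd_wd]
    exact hD.eq_zero_of_not_near [] [1, 2] _ hg' (by decide) (by decide +kernel)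
      (by rw [e]; exact hb)
  · exact hD.not_enters_of_mem [] [0, 1] _ hg' (by decide) (by decide +kernel) (f := f)
      (by rwa [e]) h7
  · rw [mul_wd_wd]
    exact hD.eq_zero_of_not_near [] [0, 1, 0, 1, 2] _ hg' (by decide) (by decide +kernel)
      (by rw [e]; exact hc')

theorem eq_zero_of_near_ac (hD : HexSolution Y J D) {g : Flag} (hg : Y.cell g)
    (ha : Y.near g (Y.tri g).a) (hb : ¬ Y.near g (Y.tri g).b) (hc : Y.near g (Y.tri g).c) :
    D g = 0 := by
  have hS := Y.mem_of_not_near hg (mem_faces _).2.1 hb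
  have hS0 := Y.mem_mul_of_not_near hg (x := (Y.tri g).b) (by exact (mem_faces _).2.1) hb
  obtain ⟨f, hf, h1, h2⟩ := Y.exists_not_adj _ _ hb (Y.near_nonempty _ _ ha)
  obtain ⟨h3, h4, h5, h6, h7⟩ := Tri.eq_of_adj_ac _ f h1.symm h2 (Y.eq_or_adj ha hf)
    (Y.eq_or_adj hc hf)
  obtain ⟨hga, hta⟩ := cross_a Y hg hS ha
  have hfa := hta f hf h3
  have hba := Y.not_near hfa h1.symm h2
  have hca := Y.not_near hfa h5 h6
  have e : g * wd [] = g := mul_wd_nil g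
  have hg' : Y.cell (g * wd []) := by rwa [e]
  rw [← e]
  refine hD.eq_zero_of_silent [] (i := 1) (Or.inl rfl) (by decide +kernel) hS hS0
    ⟨?_, ?_⟩ ?_ ⟨?_, ?_⟩
  · exact hD.not_enters_of_not_near [3] [0, 2, 1] _ hga (by decide) (by decide +kernel)
      (x := (Y.tri g).b) (by exact (mem_faces _).1) hba
  · rw [mul_wd_wd]
    exact hD.eq_zero_of_not_near [3] [0, 2, 1, 0, 1] _ hga (by decide) (by decide +kernel) hca
  · exact hD.silent_of_not_near [] [0, 1] _ hg' (by decide) (by decide +kernel)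
      (by rw [e]; exact hb)
  · exact hD.not_enters_of_not_near [3] [0, 2, 1] _ hga (by decide) (by decide +kernel)
      (x := (Y.tri g).b) (by exact (mem_faces _).1) hba
  · rw [mul_wd_wd]
    refine eq_zero_congr (w := [3] ++ [0, 2, 1, 0] ++ [2, 3, 2]) (by decide +kernel) ?_
    exact hD.eq_zero_across_of_not_near_ab' [3] [0, 2, 1, 0] hga (by decide) hba hca

/-- The face that makes the first face far survives crossing the second wall and also makes the end
face far there; so beyond that wall two far faces along an edge are available. -/
theorem eq_zero_of_near_bc (hD : HexSolution Y J D) {g : Flag} (hg : Y.cell g)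
    (ha : ¬ Y.near g (Y.tri g).a) (hb : Y.near g (Y.tri g).b) (hc : Y.near g (Y.tri g).c) :
    D g = 0 := by
  have hS := Y.mem_of_not_near hg (mem_faces _).1 ha
  have hS0 := Y.mem_mul_of_not_near hg (x := (Y.tri g).a) (by exact (mem_faces _).1) ha
  obtain ⟨f, hf, h1, h2⟩ := Y.exists_not_adj _ _ ha (Y.near_nonempty _ _ hb)
  obtain ⟨h3, h4, h5⟩ := Tri.eq_of_adj_bc _ f h1.symm h2 (Y.eq_or_adj hb hf) (Y.eq_or_adj hc hf)
  obtain ⟨hgb, htb⟩ := cross_b Y hg hS hb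
  have hfb := htb f hf h3
  have hab := Y.not_near hfb h1.symm h2
  have hcb := Y.not_near hfb h4 h5
  have e : g * wd [] = g := mul_wd_nil g
  have hg' : Y.cell (g * wd []) := by rwa [e]
  rw [← e]
  refine hD.eq_zero_of_silent [] (i := 1) (Or.inl rfl) (by decide +kernel) hS hS0
    ?_ ⟨?_, ?_⟩ ?_
  · exact hD.silent_of_not_near [] [0, 2, 1] _ hg' (by decide) (by decide +kernel)
      (by rw [e]; exact ha)
  · exact hD.not_enters_of_not_near [2, 3, 2] [0, 1] _ hgb (by decide) (by decide +kernel)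
      (x := (Y.tri g).a) (by exact (mem_faces _).1) hab
  · rw [mul_wd_wd]
    refine eq_zero_congr (w := [2, 3, 2] ++ [0, 1, 0] ++ [2, 3, 2]) (by decide +kernel) ?_
    exact hD.eq_zero_across_of_not_near_ab' [2, 3, 2] [0, 1, 0] hgb (by decide) hab hcb
  · exact hD.silent_of_not_near [] [0, 2, 1] _ hg' (by decide) (by decide +kernel)
      (by rw [e]; exact ha)

/-- Here the block equation for `r 2` is used: one of its terms lies between the far first and third
faces, another is moved across the near second wall. -/
theorem eq_zero_of_near_b (hD : HexSolution Y J D) {g : Flag} (hg : Y.cell g)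
    (ha : ¬ Y.near g (Y.tri g).a) (hb : Y.near g (Y.tri g).b) (hc : ¬ Y.near g (Y.tri g).c) :
    D g = 0 := by
  have hS := Y.mem_of_not_near hg (mem_faces _).1 ha
  have hS0 := Y.mem_mul_of_not_near hg (x := (Y.tri g).a) (by exact (mem_faces _).1) ha
  obtain ⟨f, hf, h1, h2⟩ := Y.exists_not_adj _ _ ha (Y.near_nonempty _ _ hb)
  have hfb : f ≠ (Y.tri g).b := by
    rintro rfl
    rw [Tri.ab] at h2
    exact Bool.false_ne_true h2.symm
  obtain ⟨hgb, htb⟩ := cross_b Y hg hS hb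
  have hfb' := htb f hf hfb
  have hab := Y.not_near hfb' h1.symm h2
  have e : g * wd [] = g := mul_wd_nil g
  have hg' : Y.cell (g * wd []) := by rwa [e]
  rw [← e]
  refine hD.eq_zero_of_silent [] (i := 2) (Or.inr rfl) (by decide +kernel) hS hS0
    ?_ ⟨?_, ?_⟩ ⟨?_, ?_⟩
  · exact hD.silent_of_not_near [] [0, 2, 1] _ hg' (by decide) (by decide +kernel)
      (by rw [e]; exact ha)
  · exact hD.not_enters_of_not_near [] [0] _ hg' (by decide) (by decide +kernel)
      (x := (Y.tri g).a) (by exact (mem_faces _).1) (by rw [e]; exact ha)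
  · rw [mul_wd_wd]
    refine hD.eq_zero_pair (w := [] ++ [2, 1, 2, 1]) (by decide +kernel) ?_
    exact hD.eq_zero_of_not_near_ab' [] [2, 1, 2, 1] hg' (by decide) (by rw [e]; exact hc)
      (by rw [e]; exact ha)
  · exact hD.not_enters_of_not_near [2, 3, 2] [0, 1] _ hgb (by decide) (by decide +kernel)
      (x := (Y.tri g).a) (by exact (mem_faces _).1) hab
  · rw [mul_wd_wd]
    -- If the end face is near beyond the second wall, its wall is crossed too. The witness `f`,
    -- still in the last clique, makes the next end face far, and the two far faces remain far.
    by_cases hc' : Y.near (g * wd [2, 3, 2]) ((Y.tri g).flip 0).c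
    · set y := g * wd [2, 3, 2] with hy0
      have hyt : Y.tri y = Y.tri g := by
        rw [hy0, Y.tri_wd]; exact flip_flip 2 _
      have hy : Y.cell (y * wd [0, 1, 0, 2]) := (Y.cell_wd y (by decide)).2 hgb
      have hyn : Y.near (y * wd [0, 1, 0, 2]) = Y.near y := Y.near_wd y (by decide)
      have hyt' : Y.tri (y * wd [0, 1, 0, 2]) = (Y.tri g).next.flip 2 := by
        rw [Y.tri_wd, hyt]; rfl
      have hyS : vertexOf (y * wd [0, 1, 0, 2]) ∈ S :=
        Y.mem_of_not_near hy (x := (Y.tri g).a) (by rw [hyt']; exact (mem_faces _).2.1)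
          (by rwa [hyn])
      have hya : Y.near (y * wd [0, 1, 0, 2])
          (([] : Word).foldl Tri.flip (Y.tri (y * wd [0, 1, 0, 2]))).a := by
        rw [hyn, hyt']; exact hc'
      have hcr := Y.cross_wd hy hyS [] (by decide) (by rw [mul_wd_nil]; exact hya)
      obtain ⟨h3, h4⟩ := Tri.not_adj_next _ f h1.symm h2 (Y.eq_or_adj hb hf)
        (Y.eq_or_adj hc' hfb')
      have h5 := Y.not_near_cross hy hyS [] (by decide) hya (x := (Y.tri g).a) (by rwa [hyn])
        (by rw [hyt']; exact (Tri.adj_next (Y.tri g)).1)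
      have h6 := Y.not_near_cross hy hyS [] (by decide) hya (x := (Y.tri g).next.c)
        (by rw [hyn]; exact Y.not_near hfb' h3 h4)
        (by rw [hyt']; exact (Tri.adj_next (Y.tri g)).2)
      rw [mul_wd_wd, hy0, mul_wd_wd] at hcr h5 h6
      have h7 : ([2, 3, 2, 0, 1, 0, 2, 3] ++ [1, 2, 1] : Word).foldl Tri.flip (Y.tri g) =
          ((((Y.tri g).next.flip 2).flip 1).flip 2).flip 1 := by
        generalize Y.tri g = t; revert t; decide +kernel
      refine hD.eq_zero_pair (w := [2, 3, 2, 0, 1, 0, 2, 3] ++ [1, 2, 1]) (by decide +kernel) ?_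
      refine hD.eq_zero_of_not_near_ab' [2, 3, 2, 0, 1, 0, 2, 3] [1, 2, 1] hcr.1 (by decide) ?_ ?_
      · rw [h7]; exact h6
      · rw [h7]; exact h5
    · exact hD.eq_zero_of_not_near [2, 3, 2] [0, 1, 0, 1, 2] _ hgb (by decide) (by decide +kernel) hc'

end HexSolution

end Honeycomb

/-! ### Hexagons: conclusion for a layer -/

namespace Honeycomb

namespace HexSolution

variable {S B : Set Vertex} {Y : Layer S B} {J : Set Leg} {D : Flag → ZMod 2}

theorem vertexOf_mul_wd {w : Word} (hw : ∀ i ∈ w, i ≠ 0) (g : Flag) :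
    vertexOf (g * wd w) = vertexOf g := by
  obtain ⟨v, hv, h⟩ := exists_vertexWord hw
  rw [h, vertexOf_wd hv]

/-- The half-turn of the hexagon exchanges the first and the third face, which identifies cases. All
three faces cannot be near: a face of the last clique away from the vertex would be adjacent to all
of them. -/
theorem eq_zero_of_cell (hD : HexSolution Y J D) {g : Flag} (hg : Y.cell g)
    (hS : vertexOf g ∈ S) : D g = 0 := by
  have hgh : Y.cell (g * wd [1, 2, 1]) := (Y.cell_wd g (by decide)).2 hg
  have hn : Y.near (g * wd [1, 2, 1]) = Y.near g := Y.near_wd g (by decide)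
  have ht : Y.tri (g * wd [1, 2, 1]) = (((Y.tri g).flip 1).flip 2).flip 1 := Y.tri_wd _ _
  by_cases ha : Y.near g (Y.tri g).a <;> by_cases hb : Y.near g (Y.tri g).b <;>
    by_cases hc : Y.near g (Y.tri g).c
  · obtain ⟨f, hf, hf'⟩ := Y.exists_mem_of_mem hg hS (Y.near_nonempty _ _ ha)
    exact (Tri.not_all _ f hf' (Y.eq_or_adj ha hf) (Y.eq_or_adj hb hf) (Y.eq_or_adj hc hf)).elim
  · rw [← hD.pair]
    exact hD.eq_zero_of_near_bc hgh (by rw [hn, ht]; exact hc) (by rw [hn, ht]; exact hb)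
      (by rw [hn, ht]; exact ha)
  · exact hD.eq_zero_of_near_ac hg ha hb hc
  · rw [← hD.pair]
    exact hD.eq_zero_of_not_near_ab hgh (by rw [hn, ht]; exact hc) (by rw [hn, ht]; exact hb)
  · exact hD.eq_zero_of_near_bc hg ha hb hc
  · exact hD.eq_zero_of_near_b hg ha hb hc
  · exact hD.eq_zero_of_not_near_ab hg ha hb
  · exact hD.eq_zero_of_not_near_ab hg ha hb

theorem eq_zero_across_b (hD : HexSolution Y J D) {g : Flag} (hg : Y.cell g)
    (hS : vertexOf g ∈ S) : D (g * wd [2, 3, 2]) = 0 := by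
  by_cases hb : Y.near g (Y.tri g).b
  · exact hD.eq_zero_of_cell (cross_b Y hg hS hb).1 (by rwa [vertexOf_mul_wd (by decide)])
  by_cases ha : Y.near g (Y.tri g).a
  · by_cases hc : Y.near g (Y.tri g).c
    · exact hD.eq_zero_across_of_near_ac hg ha hb hc
    · refine hD.eq_zero_pair (w := [1, 2, 1] ++ [2, 3, 2]) (by decide +kernel) ?_
      have hn : Y.near (g * wd [1, 2, 1]) = Y.near g := Y.near_wd g (by decide)
      have ht : Y.tri (g * wd [1, 2, 1]) = (((Y.tri g).flip 1).flip 2).flip 1 := Y.tri_wd _ _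
      rw [← mul_wd_wd]
      exact hD.eq_zero_across_of_not_near_ab ((Y.cell_wd g (by decide)).2 hg)
        (by rw [hn, ht]; exact hc) (by rw [hn, ht]; exact hb)
  · exact hD.eq_zero_across_of_not_near_ab hg ha hb

/-- The words for crossing some of the first two walls. -/
def sideWords : List Word := [[], [2, 3, 2], [3], [3, 2, 3, 2]]

theorem eq_zero_across_side (hD : HexSolution Y J D) {g : Flag} (hg : Y.cell g)
    (hS : vertexOf g ∈ S) : ∀ s ∈ sideWords, D (g * wd s) = 0 := by
  have e : g * wd [] = g := mul_wd_nil g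
  have hside : D (g * wd [3]) = 0 ∧ D (g * wd [3, 2, 3, 2]) = 0 := by
    by_cases ha : Y.near g (Y.tri g).a
    · have h := (cross_a Y hg hS ha).1
      have hS' : vertexOf (g * wd [3]) ∈ S := by rwa [vertexOf_mul_wd (by decide)]
      have h2 := hD.eq_zero_across_b h hS'
      rw [mul_wd_wd] at h2
      exact ⟨hD.eq_zero_of_cell h hS', h2⟩
    · exact ⟨hD.eq_zero_of_not_near [] [1, 2, 1] _ (by rwa [e]) (by decide) (by decide +kernel)
          (by rw [e]; exact ha),
        hD.eq_zero_of_not_near [] [1, 2, 1] _ (by rwa [e]) (by decide) (by decide +kernel)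
          (by rw [e]; exact ha)⟩
  intro s hs
  simp only [sideWords, List.mem_cons, List.not_mem_nil, or_false] at hs
  rcases hs with rfl | rfl | rfl | rfl
  · rw [e]; exact hD.eq_zero_of_cell hg hS
  · exact hD.eq_zero_across_b hg hS
  · exact hside.1
  · exact hside.2

theorem eq_zero_across_rho (hD : HexSolution Y J D) {g : Flag} (hg : Y.cell g)
    (hS : vertexOf g ∈ S) : ∀ s ∈ sideWords, D (g * wd (rho ++ s)) = 0 := by
  intro s hs
  by_cases hc : Y.near g (Y.tri g).c
  · have h := (Y.cross_wd hg hS [1, 2] (by decide) (by rw [Y.tri_wd]; exact hc)).1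
    rw [← mul_wd_wd]
    refine hD.eq_zero_across_side h ?_ s hs
    rwa [vertexOf_mul_wd (by decide)]
  · have e : g * wd [] = g := mul_wd_nil g
    have key : ∀ s ∈ sideWords, inLeg ((rho ++ s).reverse ++ ([] ++ [] ++ rho)) = true := by
      decide +kernel
    exact hD.leaves _ (hD.leaves_of_not_near [] [] _ (by rwa [e]) (by decide) (key s hs)
      (by rw [e]; exact hc))

theorem eq_zero (hD : HexSolution Y J D) (z : Flag) : D z = 0 := by
  by_cases hz : vertexOf z ∈ S
  · obtain ⟨k, hk, hx⟩ := Y.exists_cell z hz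
    have hv := vertexOf_mul hk z
    obtain ⟨w, hw, h⟩ := eq_of_vertexOf_eq hv.symm
    -- The 48 flags at a vertex: six in the cell, then optionally across the third wall, then across
    -- any of the first two.
    have key : ∀ w ∈ vertexWords, ∃ p ∈ hexWords, ∃ s ∈ sideWords,
        code w = code (p ++ s) ∨ code w = code (p ++ (rho ++ s)) := by
      decide +kernel
    obtain ⟨p, hp, s, hs, h1⟩ := key w hw
    have hg := (Y.cell_wd (z * k) fun i hi => (Layer.hexWords_letters p hp i hi).1).2 hx
    have hS : vertexOf (z * k * wd p) ∈ S := by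
      rw [vertexOf_mul_wd fun i hi => (Layer.hexWords_letters p hp i hi).2, hv]; exact hz
    rw [h]
    rcases h1 with h1 | h1
    · refine eq_zero_congr h1 ?_
      rw [← mul_wd_wd]
      exact hD.eq_zero_across_side hg hS s hs
    · refine eq_zero_congr h1 ?_
      rw [← mul_wd_wd]
      exact hD.eq_zero_across_rho hg hS s hs
  · exact hD.zero z hz

end HexSolution

theorem Layer.isometry_omnitruncated {S B : Set Vertex} {J : Set Leg} (Y : Layer S B)
    (hJ : ∀ g, legOf g ∈ J ↔ vertexOf (g * r 0) ∈ B) (hfin : S.Finite) :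
    omnitruncated.ClusterIsometry Pairing.inversion S J := by
  have hne : ∀ {v w : Word}, (∀ i ∈ v, i ≠ 0) → (∀ i ∈ w, i ≠ 0) → inLeg (v.reverse ++ w) = false →
      ∀ g, Enters S J (g * wd v) → ¬ Enters S J (g * wd w) := fun hv' hw' h g h2 h3 =>
    legOf_ne g h (Y.enters_unique hJ h3 h2
      ((HexSolution.vertexOf_mul_wd hv' g).trans (HexSolution.vertexOf_mul_wd hw' g).symm))
  have hr : ∀ i : Fin 4, i = 1 ∨ i = 2 → wd [i] ∈ omnitruncated.block := by
    rintro i (rfl | rfl) <;> rw [wd_singleton] <;> exact r_mem (by simp)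
  refine Construction.clusterIsometry_of omnitruncated_hasShape (by simp) (by simp)
    omnitruncated_pairedBy _ hfin J ?_ ?_ ?_
  · intro g h
    rw [hexAntipode_eq]
    exact hne (v := []) (by simp) (by decide) (by decide +kernel) g (by rwa [wd_nil, mul_one])
  · intro g _
    rw [hexAntipode_eq]
    by_cases h : Enters S J (g * wd [])
    · refine ⟨wd [1], hr 1 (Or.inl rfl), ?_⟩
      rw [mul_wd_wd]
      exact ⟨hne (by simp) (by decide) (by decide +kernel) g h,
        hne (by simp) (by decide) (by decide +kernel) g h⟩
    · by_cases h' : Enters S J (g * wd [1, 2, 1])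
      · refine ⟨wd [2], hr 2 (Or.inr rfl), ?_⟩
        rw [mul_wd_wd]
        exact ⟨hne (by decide) (by decide) (by decide +kernel) g h',
          hne (by decide) (by decide) (by decide +kernel) g h'⟩
      · rw [wd_nil] at h
        exact ⟨1, one_mem _, h, by rwa [mul_one]⟩
  · intro D h2 h3 h4 h5
    have hpair : ∀ g, D (g * wd [1, 2, 1]) = D g := fun g => by
      have := h3 g _ omnitruncated_pairedBy.mem
      rwa [hexAntipode_eq] at this
    refine HexSolution.eq_zero (Y := Y) (J := J) ⟨hJ, h2, hpair, h4, ?_⟩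
    intro g hg i hi h6 h7 h8 h9
    have := h5 g hg _ (hr i hi) h6
    rw [hexAntipode_eq, inversion_twist] at this
    simp only [mul_wd_wd] at this
    exact this h7 h8 h9

end Honeycomb

/-! ### The multi-tensor isometry condition -/

namespace Honeycomb

theorem legOf_mem_incoming (seed : Set Vertex) (n : ℕ) (g : Flag) :
    legOf g ∈ incoming seed n ↔ vertexOf (g * r 0) ∈ inner seed n := by
  constructor
  · rintro ⟨h, e, h1⟩
    rwa [← (Layer.vertexOf_of_legOf_eq e).2]
  · exact fun h => ⟨g, rfl, h⟩

theorem finite_layer {seed : Set Vertex} (h : seed.Finite) (n : ℕ) : (layer seed n).Finite :=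
  (finite_ball h n).subset Set.sdiff_subset

namespace Construction

variable {C : Construction} {N m : ℕ} {η : Flag} {e : Pairing}

/-- The seed vertex is treated separately, because the levels around a vertex describe only the
later layers. It has no incoming and no internal legs, so every qubit leaves. -/
theorem isometry_layer_zero (hC : C.HasShape N m) (hN : 0 < N) (hm : 0 < m) (hη : C.PairedBy η)
    (v : Vertex) : C.ClusterIsometry e (layer {v} 0) (incoming {v} 0) := by
  have hJ : ∀ g, legOf g ∉ incoming {v} 0 := fun g h => ((legOf_mem_incoming _ _ g).1 h).elim
  have hS : layer {v} 0 = {v} := Set.sdiff_empty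
  refine clusterIsometry_of hC hN hm hη e (finite_layer (Set.finite_singleton v) 0) _
    (fun g h => (hJ g h.2.2).elim)
    (fun g _ => ⟨1, one_mem _, fun h => hJ _ h.2.2, fun h => hJ _ h.2.2⟩) ?_
  intro D h0 _ h1 _ g
  by_cases hg : vertexOf g ∈ layer {v} 0
  · refine h1 g ⟨hg, fun h => ?_, hJ g⟩
    rw [hS] at hg h
    exact vertexOf_mul_r0_ne g (Eq.trans h (Eq.symm hg))
  · exact h0 g hg

theorem multiTensorIsometry_of (hC : C.HasShape N m) (hN : 0 < N) (hm : 0 < m)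
    (hη : C.PairedBy η)
    (hedge : ∀ g, C.ClusterIsometry e (edgeVertices g) (edgeLegs g))
    (hlayer : ∀ (S B : Set Vertex) (J : Set Leg), Layer S B →
      (∀ g, legOf g ∈ J ↔ vertexOf (g * r 0) ∈ B) → S.Finite → C.ClusterIsometry e S J) :
    C.MultiTensorIsometry e := by
  refine ⟨hedge, fun v n => ⟨finite_layer (Set.finite_singleton v) n, ?_⟩,
    fun c n => ⟨finite_layer (finite_cellVertices c) n, ?_⟩⟩
  · cases n with
    | zero => exact isometry_layer_zero hC hN hm hη v
    | succ n =>
      obtain ⟨Y⟩ := exists_layer_vertex v n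
      exact hlayer _ _ _ Y (legOf_mem_incoming _ _) (finite_layer (Set.finite_singleton v) _)
  · obtain ⟨Y⟩ := exists_layer_cell c n
    exact hlayer _ _ _ Y (legOf_mem_incoming _ _) (finite_layer (finite_cellVertices c) _)

theorem multiTensorIsometry_antipode (hC : C.HasShape N m) (hN : 0 < N) (hm : 0 < m)
    (hη : C.PairedBy antipode) (h1 : r 1 ∈ C.block) (e : Pairing) : C.MultiTensorIsometry e :=
  multiTensorIsometry_of hC hN hm hη (edge_isometry_antipode hC hN hm hη h1 e)
    fun _ _ _ Y hJ hS => Y.isometry_antipode hJ hS hC hN hm hη h1 e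

end Construction

theorem omnitruncated_multiTensorIsometry :
    omnitruncated.MultiTensorIsometry Pairing.inversion :=
  Construction.multiTensorIsometry_of omnitruncated_hasShape (by simp) (by simp)
    omnitruncated_pairedBy edge_isometry_omnitruncated
    fun _ _ _ Y hJ hS => Y.isometry_omnitruncated hJ hS

end Honeycomb

theorem mainTheorem2 :
    (∀ (Q P : Type) (_ : Finite Q) (_ : Finite P) (_ : Nonempty P) (pair : Q → P),
      (∀ p : P, {q : Q | pair q = p}.ncard = 2) → XICode.IsEncoding pair) ∧
    (Honeycomb.octahedron.HasShape 1 3 ∧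
      Honeycomb.octahedron.AngularUniform 2 ∧
      ∀ e : Honeycomb.Pairing, Honeycomb.octahedron.MultiTensorIsometry e) ∧
    (Honeycomb.truncated.HasShape 6 2 ∧
      Honeycomb.truncated.AngularUniform 1 ∧
      ∀ e : Honeycomb.Pairing, Honeycomb.truncated.MultiTensorIsometry e) ∧
    (Honeycomb.truncatedGHZ.HasShape 6 2 ∧
      Honeycomb.truncatedGHZ.AngularUniform 1 ∧
      ∀ e : Honeycomb.Pairing, Honeycomb.truncatedGHZ.MultiTensorIsometry e) ∧
    (Honeycomb.cantellated.HasShape 4 3 ∧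
      Honeycomb.cantellated.AngularUniform 2 ∧
      ∀ e : Honeycomb.Pairing, Honeycomb.cantellated.MultiTensorIsometry e) ∧
    (Honeycomb.omnitruncated.HasShape 8 3 ∧
      Honeycomb.omnitruncated.MultiAngularUniform 1 ∧
      Honeycomb.omnitruncated.MultiTensorIsometry Honeycomb.Pairing.inversion) := by
  have hmem : ∀ {s : Set Honeycomb.Flag}, Honeycomb.r 1 ∈ s →
      Honeycomb.r 1 ∈ Subgroup.closure s := Honeycomb.r_mem
  refine ⟨?_, ⟨Honeycomb.octahedron_hasShape, Honeycomb.octahedron_angularUniform, ?_⟩,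
    ⟨Honeycomb.truncated_hasShape, Honeycomb.truncated_angularUniform, ?_⟩,
    ⟨Honeycomb.truncatedGHZ_hasShape, Honeycomb.truncatedGHZ_angularUniform, ?_⟩,
    ⟨Honeycomb.cantellated_hasShape, Honeycomb.cantellated_angularUniform, ?_⟩,
    ⟨Honeycomb.omnitruncated_hasShape, Honeycomb.omnitruncated_multiAngularUniform,
      Honeycomb.omnitruncated_multiTensorIsometry⟩⟩
  · intro Q P _ hP _ pair h
    have := Fintype.ofFinite P
    exact XICode.isEncoding h
  · exact Honeycomb.Construction.multiTensorIsometry_antipode Honeycomb.octahedron_hasShape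
      (by simp) (by simp) Honeycomb.octahedron_pairedBy (hmem (by simp))
  · exact Honeycomb.Construction.multiTensorIsometry_antipode Honeycomb.truncated_hasShape
      (by simp) (by simp) Honeycomb.truncated_pairedBy (hmem (by simp))
  · exact Honeycomb.Construction.multiTensorIsometry_antipode Honeycomb.truncatedGHZ_hasShape
      (by simp) (by simp) Honeycomb.truncatedGHZ_pairedBy (hmem (by simp))
  · exact Honeycomb.Construction.multiTensorIsometry_antipode Honeycomb.cantellated_hasShape
      (by simp) (by simp) Honeycomb.cantellated_pairedBy (hmem (by simp))
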